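/- **Setting.** Let $G$ be a compact matrix quantum group with Hopf $*$-algebra $\mathcal A$ of polynomial functions, comultiplication $\phi$, counit $\epsilon$, antipode $\kappa$, generated by the entries of its fundamental representation $u$. Let $G_{cl}$ be the group of (unital) $*$-characters of $\mathcal A$, with $gg'=(g\otimes g')\phi$, regarded via $g\mapsto (g(u_{ij}))$ as a closed subgroup of the invertible complex matrices. Let $M$ be a compact smooth manifold; $S(U)$ and $S_c(U)$ denote the complex smooth functions on an open set $U\subseteq M$ (with compact support, respectively). All $*$-homomorphisms are unital. A quantum principal $G$-bundle $P=(\mathcal B,i,F)$ over $M$ consists of a unital $*$-algebra $\mathcal B$ and $*$-homomorphisms $i:S(M)\to\mathcal B$, $F:\mathcal B\to\mathcal B\otimes\mathcal A$ such that each point of $M$ lies in an open set $U$ having a local trivialization, that is, a $*$-homomorphism $\pi_U:\mathcal B\to S(U)\otimes\mathcal A$ with $\pi_U i(f)=f|_U\otimes 1$, $\pi_U(\mathcal B)\supseteq S_c(U)\otimes\mathcal A$, $(\mathrm{id}\otimes\phi)\pi_U=(\pi_U\otimes\mathrm{id})F$, and $\pi_U(i(f)b)=0\Rightarrow i(f)b=0$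 for $f\in S_c(U)$, $b\in\mathcal B$. Here $\mathcal B$ is an $S(M)$-module via $i$. A gauge transformation of $P$ is an $S(M)$-linear $*$-automorphism $\gamma$ of $\mathcal B$ with $F\gamma=(\gamma\otimes\mathrm{id})F$; these form a group under composition. Let $(U_k,\pi_k)_k$ be a finite family of local trivializations whose sets $U_k$ cover $M$. There is a unique family of $*$-homomorphisms $g_{kl}:\mathcal A\to S(U_k\cap U_l)$ such that over $U_k\cap U_l$ one has $\pi_l=\psi_{lk}\pi_k$ with $\psi_{lk}(\varphi\otimes a)=\varphi\, g_{kl}(a^{(1)})\otimes a^{(2)}$. Let $\xi_{kl}(\varphi\otimes a)=\varphi\, g_{kl}(\kappa(a^{(1)})a^{(3)})\otimes a^{(2)}$, and let $\mathcal D$ be the $*$-algebra of all $(q_k)\in\bigoplus_k S(U_k)\otimes\mathcal A$ with $q_k=\xi_{kl}(q_l)$ over $U_k\cap U_l$ for all $k,l$. It is an $S(M)$-algebra via $j_M(f)=(f|_{U_k}\otimes1)_k$; put $\pi^\sharp_k(q)=q_k$. Write $\otimes_M$ for the tensor product over $S(M)$. There are unique $S(M)$-linear maps $$\phi_M:\mathcal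 D\to\mathcal D\otimes_M\mathcal D,\qquad \epsilon_M:\mathcal D\to S(M),\qquad \kappa_M:\mathcal D\to\mathcal D,\qquad \beta_M:\mathcal B\to\mathcal D\otimes_M\mathcal B$$ such that for all $k$ $$(\pi_k^\sharp\otimes\pi_k^\sharp)\phi_M=(\mathrm{id}\otimes\phi)\pi_k^\sharp,\quad \epsilon_M(\cdot)|_{U_k}=(\mathrm{id}\otimes\epsilon)\pi_k^\sharp,\quad \pi_k^\sharp\kappa_M=(\mathrm{id}\otimes\kappa)\pi_k^\sharp,\quad (\pi_k^\sharp\otimes\pi_k)\beta_M=(\mathrm{id}\otimes\phi)\pi_k,$$ where $(S(U_k)\otimes\mathcal A)\otimes_{S(U_k)}(S(U_k)\otimes\mathcal A)$ is identified with $S(U_k)\otimes\mathcal A\otimes\mathcal A$. The classical part $P_{cl}$ of $P$ is the set of $*$-characters $p$ of $\mathcal B$. It is a principal $G_{cl}$-bundle over $M$: $p$ lies over $x\in M$ if $p(i(f))=f(x)$ for all $f\in S(M)$, the right action is $pg=(p\otimes g)F$, and the smooth structure is the one given by the local trivializations $U\times G_{cl}\to P_{cl}$, $(x,g)\mapsto(\mathrm{ev}_x\otimes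 g)\pi_U$. A gauge transformation of $P_{cl}$ is a diffeomorphism of $P_{cl}$ which preserves the fibers over $M$ and commutes with the action of $G_{cl}$. **Proposition.** (i) The formula $\gamma=(f\otimes\mathrm{id})\beta_M$ gives a bijection $f\leftrightarrow\gamma$ between the $S(M)$-linear $*$-homomorphisms $f:\mathcal D\to S(M)$ and the gauge transformations of $P$. Under this bijection, $\epsilon_M$ corresponds to the identity; if $f\leftrightarrow\gamma$ and $f'\leftrightarrow\gamma'$, then $f\kappa_M\leftrightarrow\gamma^{-1}$ and $(f'\otimes f)\phi_M\leftrightarrow\gamma\gamma'$. (ii) For every gauge transformation $\gamma$ of $P$, the map $\gamma_{cl}:P_{cl}\to P_{cl}$, $\gamma_{cl}(p)=p\gamma^{-1}$, is a gauge transformation of $P_{cl}$, and $\gamma\mapsto\gamma_{cl}$ is an isomorphism from the group of gauge transformations of $P$ onto the group of gauge transformations of $P_{cl}$. -/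

import Mathlib

open scoped Manifold ContDiff TensorProduct
open TopologicalSpace (Opens)

noncomputable section

namespace QGauge

universe v w y

/-! ### Smooth functions -/

/-- The `*`-algebra `S(N)` of smooth complex valued functions on a manifold `N` of dimension `d`. -/
def smoothFunctions (d : ℕ) (N : Type w) [TopologicalSpace N]
    [ChartedSpace (EuclideanSpace ℝ (Fin d)) N] : StarSubalgebra ℂ (N → ℂ) where
  carrier := {f | ContMDiff (𝓡 d) 𝓘(ℝ, ℂ) ∞ f}
  mul_mem' {f g} hf hg := by
    have h : ContDiff ℝ ∞ (fun p : ℂ × ℂ => p.1 * p.2) := contDiff_mul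
    exact h.contMDiff.comp (ContMDiff.prodMk_space hf hg)
  add_mem' {f g} hf hg := by
    have h : ContDiff ℝ ∞ (fun p : ℂ × ℂ => p.1 + p.2) := contDiff_add
    exact h.contMDiff.comp (ContMDiff.prodMk_space hf hg)
  algebraMap_mem' _ := contMDiff_const
  star_mem' {f} hf := by
    have h : ContDiff ℝ ∞ (fun z : ℂ => star z) := (starL' ℝ : ℂ ≃L[ℝ] ℂ).contDiff
    exact h.contMDiff.comp hf

/-- The `*`-algebra `S(N)` as a type. -/
def Smooth (d : ℕ) (N : Type w) [TopologicalSpace N]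
    [ChartedSpace (EuclideanSpace ℝ (Fin d)) N] : Type w := smoothFunctions d N

section Instances

variable (d : ℕ) (N : Type w) [TopologicalSpace N] [ChartedSpace (EuclideanSpace ℝ (Fin d)) N]

instance : CommRing (Smooth d N) := inferInstanceAs (CommRing (smoothFunctions d N))

instance : StarRing (Smooth d N) := inferInstanceAs (StarRing (smoothFunctions d N))

instance : Algebra ℂ (Smooth d N) := inferInstanceAs (Algebra ℂ (smoothFunctions d N))

instance : StarModule ℂ (Smooth d N) := inferInstanceAs (StarModule ℂ (smoothFunctions d N))

end Instances

section Base

variable (d : ℕ) {M : Type w} [TopologicalSpace M]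
  [ChartedSpace (EuclideanSpace ℝ (Fin d)) M]

/-- Restriction `S(M) → S(U)` to an open subset. -/
def restr (U : Opens M) : Smooth d M →⋆ₐ[ℂ] Smooth d U where
  toFun f := ⟨fun x => f.1 x, f.2.comp contMDiff_subtype_val⟩
  map_one' := rfl
  map_mul' _ _ := rfl
  map_zero' := rfl
  map_add' _ _ := rfl
  commutes' _ := rfl
  map_star' _ := rfl

/-- Restriction `S(U) → S(W)` between open subsets `W ⊆ U`. -/
def restrLE {W U : Opens M} (h : W ≤ U) : Smooth d U →⋆ₐ[ℂ] Smooth d W where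
  toFun f := ⟨fun x => f.1 (Set.inclusion h x), f.2.comp (contMDiff_inclusion h)⟩
  map_one' := rfl
  map_mul' _ _ := rfl
  map_zero' := rfl
  map_add' _ _ := rfl
  commutes' _ := rfl
  map_star' _ := rfl

/-- Evaluation of smooth functions at a point. -/
def evalAt {N : Type w} [TopologicalSpace N] [ChartedSpace (EuclideanSpace ℝ (Fin d)) N] (x : N) :
    Smooth d N →⋆ₐ[ℂ] ℂ where
  toFun f := f.1 x
  map_one' := rfl
  map_mul' _ _ := rfl
  map_zero' := rfl
  map_add' _ _ := rfl
  commutes' _ := rfl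
  map_star' _ := rfl

variable {d}

instance restrAlgebra (U : Opens M) : Algebra (Smooth d M) (Smooth d U) :=
  (restr d U).toAlgHom.toRingHom.toAlgebra

instance (U : Opens M) : IsScalarTower ℂ (Smooth d M) (Smooth d U) :=
  IsScalarTower.of_algebraMap_eq fun _ => rfl

instance (U : Opens M) : StarModule (Smooth d M) (Smooth d U) where
  star_smul f g := by
    change star (restr d U f * g) = restr d U (star f) * star g
    rw [star_mul', map_star]

end Base

/-! ### Tensor products of `*`-algebras -/

section Tensor

instance tensorStarModule {R S A : Type*} [CommRing R] [StarRing R] [Algebra ℂ R] [CommRing S]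
    [StarRing S] [Algebra ℂ S] [StarModule ℂ S] [Algebra R S] [IsScalarTower ℂ R S]
    [StarModule R S] [Ring A] [StarRing A] [Algebra ℂ A] [StarModule ℂ A] :
    StarModule R (S ⊗[ℂ] A) where
  star_smul r x := by
    induction x with
    | zero => simp
    | add x y hx hy => simp only [smul_add, star_add, hx, hy]
    | tmul s a => simp [TensorProduct.smul_tmul', star_smul]

variable {A B C : Type*} [Ring A] [Ring B] [StarRing A] [StarRing B]
    [Algebra ℂ A] [Algebra ℂ B] [StarModule ℂ A] [StarModule ℂ B]

/-- For `p : B → C`, `g : A → C` with values in a commutative `*`-algebra, the `*`-homomorphism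
`p ⊗ g : B ⊗ A → C`, `b ⊗ a ↦ p(b) g(a)`. -/
def starLift [CommRing C] [StarRing C] [Algebra ℂ C] (p : B →⋆ₐ[ℂ] C) (g : A →⋆ₐ[ℂ] C) :
    B ⊗[ℂ] A →⋆ₐ[ℂ] C where
  __ := Algebra.TensorProduct.lift p.toAlgHom g.toAlgHom fun _ _ => Commute.all _ _
  map_star' x := by
    change Algebra.TensorProduct.lift p.toAlgHom g.toAlgHom _ (star x) =
      star (Algebra.TensorProduct.lift p.toAlgHom g.toAlgHom _ x)
    induction x with
    | zero => simp
    | add x y hx hy => simp only [map_add, star_add, hx, hy]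
    | tmul b a =>
      simp only [TensorProduct.star_tmul, Algebra.TensorProduct.lift_tmul, star_mul']
      exact congrArg₂ (· * ·) (map_star p b) (map_star g a)

/-- For `f : B → C` the map `f ⊗ id : B ⊗ A → C ⊗ A`. -/
abbrev mapLeft (A : Type*) [Ring A] [Algebra ℂ A] {B C : Type*} [Ring B] [Ring C] [Algebra ℂ B]
    [Algebra ℂ C] (f : B →ₐ[ℂ] C) : B ⊗[ℂ] A →ₐ[ℂ] C ⊗[ℂ] A :=
  Algebra.TensorProduct.map f (AlgHom.id ℂ A)

/-- `f ⊗ id` is a `*`-homomorphism if `f` is. -/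
theorem mapLeft_star {A B C : Type*} [Ring A] [Ring B] [Ring C] [StarRing A] [StarRing B]
    [StarRing C] [Algebra ℂ A] [Algebra ℂ B] [Algebra ℂ C] [StarModule ℂ A] [StarModule ℂ B]
    [StarModule ℂ C] (f : B →⋆ₐ[ℂ] C) (x : B ⊗[ℂ] A) :
    mapLeft A f.toAlgHom (star x) = star (mapLeft A f.toAlgHom x) := by
  induction x with
  | zero => simp
  | add x y hx hy => simp only [map_add, star_add, hx, hy]
  | tmul b a =>
    simp only [mapLeft, TensorProduct.star_tmul, Algebra.TensorProduct.map_tmul]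
    exact congrArg (· ⊗ₜ _) (map_star f b)

end Tensor

/-! ### Compact matrix quantum groups -/

/-- A matrix `x` with entries in a `*`-algebra is equivalent to a unitary matrix if `Q x Q⁻¹` is
unitary for some invertible scalar matrix `Q`. -/
def IsUnitarizable {A : Type*} [Ring A] [StarRing A] [Algebra ℂ A] {n : ℕ}
    (x : Matrix (Fin n) (Fin n) A) : Prop :=
  ∃ Q : (Matrix (Fin n) (Fin n) ℂ)ˣ,
    Q.1.map (algebraMap ℂ A) * x * (Q⁻¹).1.map (algebraMap ℂ A) ∈
      unitary (Matrix (Fin n) (Fin n) A)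

/-- A compact matrix quantum group, given by its Hopf `*`-algebra `A` of polynomial functions and
its fundamental representation `u`, whose entries generate `A` as a `*`-algebra. Compactness is
expressed by the fact that `u` and its conjugate are equivalent to unitary representations. -/
structure CompactMatrixQuantumGroup where
  A : Type v
  [ring : Ring A]
  [starRing : StarRing A]
  [hopf : HopfAlgebra ℂ A]
  [starModule : StarModule ℂ A]
  /-- the comultiplication is a `*`-homomorphism -/
  comul_star : ∀ a : A, Coalgebra.comul (R := ℂ) (star a) = star (Coalgebra.comul (R := ℂ) a)
  n : ℕ
  u : Matrix (Fin n) (Fin n) A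
  comul_u : ∀ i j, Coalgebra.comul (R := ℂ) (u i j) = ∑ k, u i k ⊗ₜ[ℂ] u k j
  generates : StarAlgebra.adjoin ℂ {a : A | ∃ i j, a = u i j} = ⊤
  unitarizable : IsUnitarizable u
  unitarizable_conj : IsUnitarizable (u.map star)

attribute [instance] CompactMatrixQuantumGroup.ring CompactMatrixQuantumGroup.starRing
  CompactMatrixQuantumGroup.hopf CompactMatrixQuantumGroup.starModule

/-- The classical part `G_cl` of `G`: the `*`-characters of `A`. -/
abbrev CompactMatrixQuantumGroup.Cl (G : CompactMatrixQuantumGroup.{v}) : Type v := G.A →⋆ₐ[ℂ] ℂ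

/-- The embedding of `G_cl` into the complex `n × n` matrices given by the fundamental
representation. -/
def CompactMatrixQuantumGroup.Cl.toMatrix {G : CompactMatrixQuantumGroup.{v}} (g : G.Cl) :
    Fin G.n → Fin G.n → ℂ := fun i j => g (G.u i j)

section Twist

variable {G : CompactMatrixQuantumGroup.{v}} {S : Type w} [CommRing S] [StarRing S] [Algebra ℂ S]

/-- The homomorphism `a ↦ g(κ(a))`, for a `*`-homomorphism `g` from `A` to a commutative
`*`-algebra. -/
def compAntipode (g : G.A →⋆ₐ[ℂ] S) : G.A →ₐ[ℂ] S :=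
  AlgHom.ofLinearMap (g.toAlgHom.toLinearMap ∘ₗ HopfAlgebra.antipode ℂ)
    (by simp) (fun a b => by
      simp only [LinearMap.comp_apply, HopfAlgebra.antipode_mul_antidistrib]
      simp [mul_comm])

/-- The `S`-linear map `ψ : S ⊗ A → S ⊗ A`, `ψ(φ ⊗ a) = φ g(a⁽¹⁾) ⊗ a⁽²⁾`. -/
def psi (g : G.A →⋆ₐ[ℂ] S) : S ⊗[ℂ] G.A →ₐ[S] S ⊗[ℂ] G.A :=
  Algebra.TensorProduct.lift (Algebra.ofId S (S ⊗[ℂ] G.A))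
    ((mapLeft G.A g.toAlgHom).comp (Bialgebra.comulAlgHom ℂ G.A))
    (fun s _ => Algebra.commute_algebraMap_left s _)

/-- The map `A → S ⊗ A`, `a ↦ g(κ(a⁽¹⁾) a⁽³⁾) ⊗ a⁽²⁾`. -/
def xiAux (g : G.A →⋆ₐ[ℂ] S) : G.A →ₐ[ℂ] S ⊗[ℂ] G.A :=
  (Algebra.TensorProduct.lift (mapLeft G.A (compAntipode g))
    ((Algebra.ofId S (S ⊗[ℂ] G.A)).restrictScalars ℂ |>.comp g.toAlgHom)
    (fun _ b => Algebra.commute_algebraMap_right (g b) _)).comp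
  ((mapLeft G.A (Bialgebra.comulAlgHom ℂ G.A)).comp (Bialgebra.comulAlgHom ℂ G.A))

/-- The `S`-linear map `ξ : S ⊗ A → S ⊗ A`, `ξ(φ ⊗ a) = φ g(κ(a⁽¹⁾) a⁽³⁾) ⊗ a⁽²⁾`. -/
def xi (g : G.A →⋆ₐ[ℂ] S) : S ⊗[ℂ] G.A →ₐ[S] S ⊗[ℂ] G.A :=
  Algebra.TensorProduct.lift (Algebra.ofId S (S ⊗[ℂ] G.A)) (xiAux g)
    (fun s _ => Algebra.commute_algebraMap_left s _)

theorem psi_tmul (g : G.A →⋆ₐ[ℂ] S) (s : S) (a : G.A) :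
    psi g (s ⊗ₜ a) = algebraMap S (S ⊗[ℂ] G.A) s * mapLeft G.A g.toAlgHom (Coalgebra.comul a) :=
  Algebra.TensorProduct.lift_tmul _ _ _ _ _

theorem xi_tmul (g : G.A →⋆ₐ[ℂ] S) (s : S) (a : G.A) :
    xi g (s ⊗ₜ a) = algebraMap S (S ⊗[ℂ] G.A) s * xiAux g a :=
  Algebra.TensorProduct.lift_tmul _ _ _ _ _

variable [StarModule ℂ S]

theorem counit_star (a : G.A) :
    Coalgebra.counit (R := ℂ) (star a) = star (Coalgebra.counit (R := ℂ) a) := by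
  let e : G.A →ₗ[ℂ] ℂ :=
    { toFun := fun x => star (Coalgebra.counit (R := ℂ) (star x))
      map_add' := by simp
      map_smul' := by simp }
  have h1 : ∀ t : G.A ⊗[ℂ] G.A, (TensorProduct.lid ℂ G.A) (e.rTensor G.A t) =
      star ((TensorProduct.lid ℂ G.A) (Coalgebra.counit.rTensor G.A (star t))) := by
    intro t
    induction t with
    | zero => simp
    | add x y hx hy => simp only [map_add, star_add, hx, hy]
    | tmul x y => simp [e]
  have h2 : ∀ t : G.A ⊗[ℂ] G.A, e ((TensorProduct.rid ℂ G.A) (Coalgebra.counit.lTensor G.A t)) =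
      Coalgebra.counit (R := ℂ) ((TensorProduct.lid ℂ G.A) (e.rTensor G.A t)) := by
    intro t
    induction t with
    | zero => simp
    | add x y hx hy => simp only [map_add, hx, hy]
    | tmul x y => simp [mul_comm]
  have h3 := h2 (Coalgebra.comul a)
  rw [h1, ← G.comul_star] at h3
  simp only [Coalgebra.rTensor_counit_comul, Coalgebra.lTensor_counit_comul,
    TensorProduct.lid_tmul, TensorProduct.rid_tmul, one_smul, star_star] at h3
  rw [← h3]
  simp [e]

theorem compAntipode_star (g : G.A →⋆ₐ[ℂ] S) (a : G.A) :
    compAntipode g (star a) = star (compAntipode g a) := by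
  let k : G.A →ₗ[ℂ] S :=
    { toFun := fun x => star (compAntipode g (star x))
      map_add' := by simp
      map_smul' := by simp }
  let gl : G.A →ₗ[ℂ] S := g.toAlgHom.toLinearMap
  have e1 : ∀ t : G.A ⊗[ℂ] G.A,
      LinearMap.mul' ℂ S (TensorProduct.map (compAntipode g).toLinearMap gl t) =
        g (LinearMap.mul' ℂ G.A ((HopfAlgebra.antipode ℂ).rTensor G.A t)) := by
    intro t
    induction t with
    | zero => simp
    | add x y hx hy => simp only [map_add, hx, hy]
    | tmul x y => simp [gl, compAntipode]
  have e2 : ∀ t : G.A ⊗[ℂ] G.A, LinearMap.mul' ℂ S (TensorProduct.map gl k t) =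
        star (g (LinearMap.mul' ℂ G.A ((HopfAlgebra.antipode ℂ).lTensor G.A (star t)))) := by
    intro t
    induction t with
    | zero => simp
    | add x y hx hy => simp only [map_add, star_add, hx, hy]
    | tmul x y => simp [gl, k, compAntipode, map_star]
  have h : WithConv.toConv (compAntipode g).toLinearMap = WithConv.toConv k := by
    apply left_inv_eq_right_inv (a := WithConv.toConv gl)
    · apply WithConv.ofConv_injective
      ext x
      simp only [LinearMap.convMul_def, LinearMap.convOne_def, WithConv.ofConv_toConv,
        LinearMap.comp_apply, e1, HopfAlgebra.mul_antipode_rTensor_comul_apply]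
      exact AlgHomClass.commutes g _
    · apply WithConv.ofConv_injective
      ext x
      simp only [LinearMap.convMul_def, LinearMap.convOne_def, WithConv.ofConv_toConv,
        LinearMap.comp_apply, e2, ← G.comul_star, HopfAlgebra.mul_antipode_lTensor_comul_apply]
      simp [counit_star, Algebra.algebraMap_eq_smul_one]
  have h' := congrArg (fun f : G.A →ₗ[ℂ] S => f (star a)) (WithConv.toConv_injective h)
  simpa [k] using h'

theorem xiAux_star (g : G.A →⋆ₐ[ℂ] S) (a : G.A) : xiAux g (star a) = star (xiAux g a) := by
  have h1 : ∀ x : G.A ⊗[ℂ] G.A,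
      mapLeft G.A (compAntipode g) (star x) = star (mapLeft G.A (compAntipode g) x) := by
    intro x
    induction x with
    | zero => simp
    | add x y hx hy => simp only [map_add, star_add, hx, hy]
    | tmul x y => simp [compAntipode_star]
  have h2 : ∀ x : G.A ⊗[ℂ] G.A,
      mapLeft G.A (Bialgebra.comulAlgHom ℂ G.A) (star x) =
        star (mapLeft G.A (Bialgebra.comulAlgHom ℂ G.A) x) := by
    intro x
    induction x with
    | zero => simp
    | add x y hx hy => simp only [map_add, star_add, hx, hy]
    | tmul x y => simp [G.comul_star]
  simp only [xiAux, AlgHom.comp_apply, Bialgebra.comulAlgHom_apply, G.comul_star]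
  rw [h2]
  generalize mapLeft G.A (Bialgebra.comulAlgHom ℂ G.A) (Coalgebra.comul a) = t
  induction t with
  | zero => simp
  | add x y hx hy => simp only [map_add, star_add, hx, hy]
  | tmul x y =>
    have h3 : star (algebraMap S (S ⊗[ℂ] G.A) (g y)) = algebraMap S (S ⊗[ℂ] G.A) (g (star y)) := by
      simp [Algebra.TensorProduct.algebraMap_apply, map_star]
    have h4 : ∀ x y, Algebra.TensorProduct.lift (mapLeft G.A (compAntipode g))
        (((Algebra.ofId S (S ⊗[ℂ] G.A)).restrictScalars ℂ).comp g.toAlgHom)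
        (fun _ b => Algebra.commute_algebraMap_right (g b) _) (x ⊗ₜ y) =
        mapLeft G.A (compAntipode g) x * algebraMap S (S ⊗[ℂ] G.A) (g y) :=
      fun _ _ => Algebra.TensorProduct.lift_tmul _ _ _ _ _
    rw [TensorProduct.star_tmul]
    refine (h4 _ _).trans (Eq.trans ?_ (congrArg star (h4 _ _)).symm)
    rw [star_mul, h1, h3]
    exact (Algebra.commute_algebraMap_right (g (star y)) _).eq

theorem xi_star (g : G.A →⋆ₐ[ℂ] S) (x : S ⊗[ℂ] G.A) : xi g (star x) = star (xi g x) := by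
  induction x with
  | zero => simp
  | add x y hx hy => simp only [map_add, star_add, hx, hy]
  | tmul s a =>
    have h3 : star (algebraMap S (S ⊗[ℂ] G.A) s) = algebraMap S (S ⊗[ℂ] G.A) (star s) := by
      simp [Algebra.TensorProduct.algebraMap_apply]
    rw [TensorProduct.star_tmul, xi_tmul, xi_tmul, star_mul, h3, xiAux_star]
    exact (Algebra.commute_algebraMap_left (star s) _).eq

end Twist

/-! ### Quantum principal bundles -/

/-- The conditions on a `*`-homomorphism `π : B → S(U) ⊗ A` to be a local trivialization over the
open set `U` of a triple `(B, i, F)`. -/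
structure IsLocalTrivialization {d : ℕ} {M : Type w} [TopologicalSpace M]
    [ChartedSpace (EuclideanSpace ℝ (Fin d)) M] {G : CompactMatrixQuantumGroup.{v}}
    {B : Type y} [Ring B] [StarRing B] [Algebra ℂ B] [StarModule ℂ B]
    (i : Smooth d M →⋆ₐ[ℂ] B) (F : B →⋆ₐ[ℂ] B ⊗[ℂ] G.A)
    (U : Opens M) (π : B →⋆ₐ[ℂ] Smooth d U ⊗[ℂ] G.A) : Prop where
  /-- `π i(f) = f|_U ⊗ 1` -/
  base : ∀ f, π (i f) = restr d U f ⊗ₜ 1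
  /-- `π(B) ⊇ S_c(U) ⊗ A` -/
  range : ∀ φ : Smooth d U, HasCompactSupport φ.1 → ∀ a : G.A, ∃ b, π b = φ ⊗ₜ a
  /-- `(id ⊗ φ) π = (π ⊗ id) F` -/
  equivariant : ∀ b, (Coalgebra.comul (R := ℂ) (A := G.A)).lTensor (Smooth d U) (π b) =
    TensorProduct.assoc ℂ (Smooth d U) G.A G.A
      (π.toAlgHom.toLinearMap.rTensor G.A (F b))
  /-- `π(i(f) b) = 0` implies `i(f) b = 0` for all `f ∈ S_c(U)` -/
  injective : ∀ f : Smooth d M, HasCompactSupport f.1 → tsupport f.1 ⊆ U →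
    ∀ b, π (i f * b) = 0 → i f * b = 0

/-- A quantum principal `G`-bundle `P = (B, i, F)` over `M`. -/
structure QuantumPrincipalBundle (G : CompactMatrixQuantumGroup.{v}) (d : ℕ) (M : Type w)
    [TopologicalSpace M] [ChartedSpace (EuclideanSpace ℝ (Fin d)) M] where
  B : Type y
  [ring : Ring B]
  [starRing : StarRing B]
  [algebra : Algebra ℂ B]
  [starModule : StarModule ℂ B]
  i : Smooth d M →⋆ₐ[ℂ] B
  F : B →⋆ₐ[ℂ] B ⊗[ℂ] G.A
  locallyTrivial : ∀ x : M, ∃ U : Opens M, x ∈ U ∧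
    ∃ π : B →⋆ₐ[ℂ] Smooth d U ⊗[ℂ] G.A, IsLocalTrivialization i F U π

attribute [instance] QuantumPrincipalBundle.ring QuantumPrincipalBundle.starRing
  QuantumPrincipalBundle.algebra QuantumPrincipalBundle.starModule

namespace QuantumPrincipalBundle

variable {G : CompactMatrixQuantumGroup.{v}} {d : ℕ} {M : Type w} [TopologicalSpace M]
  [ChartedSpace (EuclideanSpace ℝ (Fin d)) M] (P : QuantumPrincipalBundle.{v, w, y} G d M)

/-- `B` is an `S(M)`-module by `f • b = i(f) b`. -/
instance : Module (Smooth d M) P.B := Module.compHom P.B P.i.toAlgHom.toRingHom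

theorem smul_def (f : Smooth d M) (b : P.B) : f • b = P.i f * b := rfl

/-- The group of gauge transformations of `P`: the `S(M)`-linear `*`-automorphisms `γ` of `B` with
`F γ = (γ ⊗ id) F`. -/
def gaugeGroup : Subgroup (P.B ≃⋆ₐ[ℂ] P.B) where
  carrier := {γ | (∀ (f : Smooth d M) (b : P.B), γ (f • b) = f • γ b) ∧
    ∀ b, P.F (γ b) = mapLeft G.A (AlgHomClass.toAlgHom γ) (P.F b)}
  mul_mem' {γ γ'} h h' := by
    refine ⟨fun f b => by simp [h.1, h'.1], fun b => ?_⟩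
    rw [StarAlgEquiv.mul_apply, h.2, h'.2]
    generalize P.F b = t
    induction t with
    | zero => simp
    | add x y hx hy => simp only [map_add, hx, hy]
    | tmul x y => simp
  one_mem' := by
    refine ⟨fun f b => rfl, fun b => ?_⟩
    rw [StarAlgEquiv.one_apply]
    generalize P.F b = t
    induction t with
    | zero => simp
    | add x y hx hy => rw [map_add, ← hx, ← hy]
    | tmul x y => simp
  inv_mem' {γ} h := by
    have hi : ∀ x, γ⁻¹ (γ x) = x := fun x => γ.symm_apply_apply x
    have hi' : ∀ x, γ (γ⁻¹ x) = x := fun x => γ.apply_symm_apply x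
    refine ⟨fun f b => ?_, fun b => ?_⟩
    · have h1 := congrArg (fun x => γ⁻¹ x) (h.1 f (γ⁻¹ b))
      simp only [hi, hi'] at h1
      exact h1.symm
    · have h1 := h.2 (γ⁻¹ b)
      rw [hi'] at h1
      rw [h1]
      generalize P.F (γ⁻¹ b) = t
      induction t with
      | zero => simp
      | add x y hx hy => rw [map_add, map_add, ← hx, ← hy]
      | tmul x y => simp [hi]

/-! ### The classical part of a quantum principal bundle -/

/-- The total space of the classical part `P_cl` of `P`: the `*`-characters of `B`. -/
abbrev Cl : Type y := P.B →⋆ₐ[ℂ] ℂ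

variable {P}

/-- The right action of `G_cl` on `P_cl`: `p g = (p ⊗ g) F`. -/
def Cl.act (p : P.Cl) (g : G.Cl) : P.Cl := (starLift p g).comp P.F

/-- The projection of `P_cl` to `M`: the point `p` lies over `x` if `p(i(f)) = f(x)` for all `f`. -/
def Cl.LiesOver (p : P.Cl) (x : M) : Prop := ∀ f : Smooth d M, p (P.i f) = f.1 x

/-- The map `U × G_cl → P_cl` given by a local trivialization, `(x, g) ↦ (ev_x ⊗ g) π`. -/
def localPoint {U : Opens M} (π : P.B →⋆ₐ[ℂ] Smooth d U ⊗[ℂ] G.A) (x : U) (g : G.Cl) :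
    P.Cl := (starLift (evalAt d x) g).comp π

/-- A function on `P_cl` is smooth if, in every local trivialization, it is a smooth function on
`U × G_cl`. Here `G_cl` has its structure of a closed subgroup of the invertible matrices, and a
function on `U × G_cl` is smooth if it extends locally to a smooth function on the manifold of all
pairs of a point of `M` and a matrix. -/
def IsSmoothFunction (f : P.Cl → ℂ) : Prop :=
  ∀ (U : Opens M) (π : P.B →⋆ₐ[ℂ] Smooth d U ⊗[ℂ] G.A),
    IsLocalTrivialization P.i P.F U π → ∀ (x : U) (g : G.Cl),
      ∃ (O : Set (M × (Fin G.n → Fin G.n → ℂ))) (f' : M × (Fin G.n → Fin G.n → ℂ) → ℂ),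
        IsOpen O ∧ (x.1, g.toMatrix) ∈ O ∧
        ContMDiffOn ((𝓡 d).prod 𝓘(ℝ, Fin G.n → Fin G.n → ℂ)) 𝓘(ℝ, ℂ) ∞ f' O ∧
        ∀ (x' : U) (g' : G.Cl), (x'.1, g'.toMatrix) ∈ O →
          f (localPoint π x' g') = f' (x'.1, g'.toMatrix)

/-- A self-map of `P_cl` is smooth if it pulls back smooth functions to smooth functions. -/
def IsSmoothMap (ψ : P.Cl → P.Cl) : Prop :=
  ∀ f : P.Cl → ℂ, IsSmoothFunction f → IsSmoothFunction (f ∘ ψ)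

variable (P)

/-- The group of gauge transformations of the classical principal `G_cl`-bundle `P_cl`: the
diffeomorphisms of `P_cl` which preserve the fibers over `M` and commute with the right action
of `G_cl`. -/
def classicalGaugeGroup : Subgroup (Equiv.Perm P.Cl) where
  carrier := {ψ | IsSmoothMap ψ ∧ IsSmoothMap ψ.symm ∧
    (∀ (p : P.Cl) (x : M), (ψ p).LiesOver x ↔ p.LiesOver x) ∧
    ∀ (p : P.Cl) (g : G.Cl), ψ (p.act g) = (ψ p).act g}
  mul_mem' {ψ ψ'} h h' := ⟨fun f hf => h'.1 _ (h.1 f hf), fun f hf => h.2.1 _ (h'.2.1 f hf),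
    fun p x => (h.2.2.1 _ x).trans (h'.2.2.1 p x), fun p g => by
      simp only [Equiv.Perm.mul_apply, h.2.2.2, h'.2.2.2]⟩
  one_mem' := ⟨fun _ hf => hf, fun _ hf => hf, fun _ _ => Iff.rfl, fun _ _ => rfl⟩
  inv_mem' {ψ} h := ⟨h.2.1, h.1, fun p x => by
      have := h.2.2.1 (ψ.symm p) x
      rw [ψ.apply_symm_apply] at this
      exact this.symm,
    fun p g => by
      change ψ.symm (p.act g) = (ψ.symm p).act g
      rw [ψ.symm_apply_eq, h.2.2.2, ψ.apply_symm_apply]⟩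

end QuantumPrincipalBundle

/-! ### The quantum gauge bundle -/

/-- A trivialization system: local trivializations over the members of a finite open cover. -/
structure TrivializationSystem {G : CompactMatrixQuantumGroup.{v}} {d : ℕ} {M : Type w}
    [TopologicalSpace M] [ChartedSpace (EuclideanSpace ℝ (Fin d)) M]
    (P : QuantumPrincipalBundle.{v, w, y} G d M) where
  m : ℕ
  U : Fin m → Opens M
  cover : ∀ x : M, ∃ k, x ∈ U k
  π : ∀ k, P.B →⋆ₐ[ℂ] Smooth d (U k) ⊗[ℂ] G.A
  isLocalTrivialization : ∀ k, IsLocalTrivialization P.i P.F (U k) (π k)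

namespace TrivializationSystem

variable {G : CompactMatrixQuantumGroup.{v}} {d : ℕ} {M : Type w} [TopologicalSpace M]
  [ChartedSpace (EuclideanSpace ℝ (Fin d)) M] {P : QuantumPrincipalBundle.{v, w, y} G d M}
  (τ : TrivializationSystem P)

/-- Restriction `S(U_k) ⊗ A → S(U_k ∩ U_l) ⊗ A`. -/
def restrLeft (k l : Fin τ.m) : Smooth d (τ.U k) ⊗[ℂ] G.A →ₐ[ℂ]
    Smooth d (τ.U k ⊓ τ.U l : Opens M) ⊗[ℂ] G.A :=
  mapLeft G.A (restrLE d inf_le_left).toAlgHom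

/-- Restriction `S(U_l) ⊗ A → S(U_k ∩ U_l) ⊗ A`. -/
def restrRight (k l : Fin τ.m) : Smooth d (τ.U l) ⊗[ℂ] G.A →ₐ[ℂ]
    Smooth d (τ.U k ⊓ τ.U l : Opens M) ⊗[ℂ] G.A :=
  mapLeft G.A (restrLE d inf_le_right).toAlgHom

/-- Families of maps `g_{kl}` from `U_k ∩ U_l` to `G_cl`, smooth in the sense that they are given by
`*`-homomorphisms `A → S(U_k ∩ U_l)`. -/
abbrev TransitionFamily : Type (max v w) :=
  ∀ k l, G.A →⋆ₐ[ℂ] Smooth d (τ.U k ⊓ τ.U l : Opens M)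

/-- The family `g` is the cocycle of the trivialization system: the retrivialization maps
`ψ_{lk}(φ ⊗ a) = φ g_{kl}(a⁽¹⁾) ⊗ a⁽²⁾` transform `π_k` into `π_l` over `U_k ∩ U_l`. -/
def IsCocycle (g : τ.TransitionFamily) : Prop :=
  ∀ k l b, τ.restrRight k l (τ.π l b) = psi (g k l) (τ.restrLeft k l (τ.π k b))

/-- The algebra `D` of functions on the quantum gauge bundle, as a `*`-subalgebra of
`⊕_k S(U_k) ⊗ A`: the families `q` with `q_k = ξ_{kl}(q_l)` over `U_k ∩ U_l`, where
`ξ_{kl}(φ ⊗ a) = φ g_{kl}(κ(a⁽¹⁾) a⁽³⁾) ⊗ a⁽²⁾`. Its `S(M)`-algebra structure is the one given by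
`j_M(f) = (f|_{U_k} ⊗ 1)_k`. -/
def gaugeAlgebra (g : τ.TransitionFamily) :
    StarSubalgebra (Smooth d M) (∀ k, Smooth d (τ.U k) ⊗[ℂ] G.A) where
  carrier := {q | ∀ k l, τ.restrLeft k l (q k) = xi (g k l) (τ.restrRight k l (q l))}
  mul_mem' {q r} hq hr k l := by
    simp only [Pi.mul_apply, map_mul, hq k l, hr k l]
  add_mem' {q r} hq hr k l := by
    simp only [Pi.add_apply, map_add, hq k l, hr k l]
  algebraMap_mem' f k l :=
    have h : τ.restrRight k l (algebraMap (Smooth d M)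
        (∀ k, Smooth d (τ.U k) ⊗[ℂ] G.A) f l) =
        algebraMap (Smooth d (τ.U k ⊓ τ.U l : Opens M)) _
          (restrLE d inf_le_left (restr d (τ.U k) f)) :=
      congrArg (_ ⊗ₜ[ℂ] ·) (map_one (AlgHom.id ℂ G.A))
    have h' : τ.restrLeft k l (algebraMap (Smooth d M)
        (∀ k, Smooth d (τ.U k) ⊗[ℂ] G.A) f k) =
        algebraMap (Smooth d (τ.U k ⊓ τ.U l : Opens M)) _
          (restrLE d inf_le_left (restr d (τ.U k) f)) :=
      congrArg (_ ⊗ₜ[ℂ] ·) (map_one (AlgHom.id ℂ G.A))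
    (h'.trans ((xi (g k l)).commutes _).symm).trans (congrArg (xi (g k l)) h).symm
  star_mem' {q} hq k l := by
    have h := congrArg star (hq k l)
    rw [← xi_star] at h
    exact (mapLeft_star _ (q k)).trans
      (h.trans (congrArg (xi (g k l)) (mapLeft_star _ (q l)).symm))

variable (g : τ.TransitionFamily)

/-- The `*`-algebra `D` as a type. -/
def D : Type (max v w) := τ.gaugeAlgebra g

instance : Ring (τ.D g) := inferInstanceAs (Ring (τ.gaugeAlgebra g))

instance : StarRing (τ.D g) := inferInstanceAs (StarRing (τ.gaugeAlgebra g))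

instance : Algebra (Smooth d M) (τ.D g) := inferInstanceAs (Algebra _ (τ.gaugeAlgebra g))

instance : StarModule (Smooth d M) (τ.D g) := inferInstanceAs (StarModule _ (τ.gaugeAlgebra g))

/-- The coordinate map `π_k` as an `S(M)`-linear map on `B`. -/
def πLinear (k : Fin τ.m) :
    P.B →ₗ[Smooth d M] Smooth d (τ.U k) ⊗[ℂ] G.A where
  toFun := τ.π k
  map_add' := map_add _
  map_smul' f b := by
    change τ.π k (P.i f * b) = f • τ.π k b
    rw [map_mul, (τ.isLocalTrivialization k).base, Algebra.smul_def]
    rfl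

/-- The coordinate map `π♯_k` on `D`. -/
def πSharp (k : Fin τ.m) :
    τ.D g →ₗ[Smooth d M] Smooth d (τ.U k) ⊗[ℂ] G.A where
  toFun q := q.1 k
  map_add' _ _ := rfl
  map_smul' _ _ := rfl

/-- For `S(M)`-linear maps `p`, `q` with values in `S(U) ⊗ A`, the map `p ⊗ q` on the tensor product
over `S(M)`, with values in `(S(U) ⊗ A) ⊗_U (S(U) ⊗ A) = S(U) ⊗ A ⊗ A`. Under this identification
`(φ ⊗ a) ⊗ (φ' ⊗ a')` is `φ φ' ⊗ a ⊗ a'`, the product of `φ ⊗ a ⊗ 1` and `φ' ⊗ 1 ⊗ a'`. -/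
def tensorLocal {U : Opens M} {X Y : Type*} [AddCommMonoid X] [AddCommMonoid Y]
    [Module (Smooth d M) X] [Module (Smooth d M) Y]
    (p : X →ₗ[Smooth d M] Smooth d U ⊗[ℂ] G.A)
    (q : Y →ₗ[Smooth d M] Smooth d U ⊗[ℂ] G.A) :
    X ⊗[Smooth d M] Y →ₗ[Smooth d M]
      Smooth d U ⊗[ℂ] (G.A ⊗[ℂ] G.A) :=
  TensorProduct.lift ((LinearMap.mul (Smooth d M)
      (Smooth d U ⊗[ℂ] (G.A ⊗[ℂ] G.A))).compl₁₂
    ((Algebra.TensorProduct.map (AlgHom.id (Smooth d M) (Smooth d U))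
      (Algebra.TensorProduct.includeLeft : G.A →ₐ[ℂ] G.A ⊗[ℂ] G.A)).toLinearMap ∘ₗ p)
    ((Algebra.TensorProduct.map (AlgHom.id (Smooth d M) (Smooth d U))
      (Algebra.TensorProduct.includeRight : G.A →ₐ[ℂ] G.A ⊗[ℂ] G.A)).toLinearMap ∘ₗ q))

/-- `φ_M : D → D ⊗_M D` is the map with `(π♯_k ⊗ π♯_k) φ_M = (id ⊗ φ) π♯_k`. -/
def IsComul (φM : τ.D g →ₗ[Smooth d M]
    τ.D g ⊗[Smooth d M] τ.D g) : Prop :=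
  ∀ k q, tensorLocal (τ.πSharp g k) (τ.πSharp g k) (φM q) =
    (Coalgebra.comul (R := ℂ) (A := G.A)).lTensor (Smooth d (τ.U k)) (τ.πSharp g k q)

/-- `ε_M : D → S(M)` is the map with `ε_M(q)|_{U_k} = (id ⊗ ε) π♯_k(q)`. -/
def IsCounit (εM : τ.D g →ₗ[Smooth d M] Smooth d M) : Prop :=
  ∀ k q, restr d (τ.U k) (εM q) = TensorProduct.rid ℂ (Smooth d (τ.U k))
    ((Coalgebra.counit (R := ℂ) (A := G.A)).lTensor (Smooth d (τ.U k)) (τ.πSharp g k q))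

/-- `κ_M : D → D` is the map with `π♯_k κ_M = (id ⊗ κ) π♯_k`. -/
def IsAntipode (κM : τ.D g →ₗ[Smooth d M] τ.D g) : Prop :=
  ∀ k q, τ.πSharp g k (κM q) =
    (HopfAlgebra.antipode ℂ (A := G.A)).lTensor (Smooth d (τ.U k)) (τ.πSharp g k q)

/-- `β_M : B → D ⊗_M B` is the map with `(π♯_k ⊗ π_k) β_M = (id ⊗ φ) π_k`. -/
def IsCoaction (βM : P.B →ₗ[Smooth d M]
    τ.D g ⊗[Smooth d M] P.B) : Prop :=
  ∀ k b, tensorLocal (τ.πSharp g k) (τ.πLinear k) (βM b) =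
    (Coalgebra.comul (R := ℂ) (A := G.A)).lTensor (Smooth d (τ.U k)) (τ.π k b)

/-- The `S(M)`-linear (unital) `*`-homomorphisms `D → S(M)`. -/
abbrev Sect : Type (max v w) := τ.D g →⋆ₐ[Smooth d M] Smooth d M

variable {τ g}

/-- `f ⊗ id : D ⊗_M B → B`, `q ⊗ b ↦ f(q) b`. -/
def tensorId (f : τ.Sect g) :
    τ.D g ⊗[Smooth d M] P.B →ₗ[Smooth d M] P.B :=
  TensorProduct.lift
    ((LinearMap.lsmul (Smooth d M) P.B).comp f.toAlgHom.toLinearMap)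

/-- `f' ⊗ f : D ⊗_M D → S(M)`, `q' ⊗ q ↦ f'(q') f(q)`. -/
def tensorSect (f' f : τ.Sect g) :
    τ.D g ⊗[Smooth d M] τ.D g →ₗ[Smooth d M]
      Smooth d M :=
  TensorProduct.lift ((LinearMap.mul (Smooth d M) (Smooth d M)).compl₁₂
    f'.toAlgHom.toLinearMap f.toAlgHom.toLinearMap)

end TrivializationSystem

end QGauge

end

noncomputable section

namespace QGauge

universe v w y

/-! ### Smooth functions on open subsets -/

section SmoothTools

variable {d : ℕ} {N : Type w} [TopologicalSpace N] [ChartedSpace (EuclideanSpace ℝ (Fin d)) N]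

/-! The whole statement reduces to families of characters of `A`. An element of `S(N) ⊗ V` is
determined by its values in `V` (`evTen_ext`). Over `x ∈ U`, a trivialization gives a surjective
fiber map `B → A`. Every covariant `*`-homomorphism `B → A` lying over `x` factors through it as a
right colinear endomorphism of `A`, and such an endomorphism is a left translation `a ↦ χ(a⁽¹⁾)
a⁽²⁾` (`eq_lam`), here by a character `χ` (`IsLocalTrivialization.exists_lam`). Applied to the other
fiber maps this gives the cocycle; applied to a gauge transformation it gives functions `c_k : U_k →
G_cl`. They are smooth because smoothness can be tested on elements of `B`
(`IsLocalTrivialization.contMDiff_char`).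

With the product `χθ = (χ ⊗ θ)φ`, the local functions of one gauge transformation satisfy `c_k
g_{kl} = g_{kl} c_l`. At a point `ξ_{kl}` is the adjoint action of `g_{kl}`, so `*`-homomorphisms `D
→ S(M)` are exactly the smooth families with the same compatibility (`exists_sect`,
`exists_sect_char`). Since `β_M` is locally the coproduct, `(f ⊗ id)β_M` translates each fiber by
the character of `f` (`fib_coaction`). This gives the bijection in (i). Counit, antipode and
coproduct become unit, inverse and product of characters, and composition of translations reverses
the order of the product.

The maps `φ_M` and `β_M` take values in tensor products over `S(M)`. Both `B` and `D` are locally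
split: cut off by a function supported in `U_k`, they look like `S(U_k) ⊗ A`. Partitions of unity
then show that an element of such a tensor product is determined by its local representatives
(`eq_zero_of_tensorLocal`) and that compatible local maps glue (`exists_tensorLocal_eq`). The
compatibility required is `comul_ad` and `comul_lam_inv`.

For (ii), every character of `B` lies over a point of `M` (`exists_eq_evalAt`), hence is some
`localPoint π x χ`. The group `G_cl` acts by right multiplication on `χ`, so a classical gauge
transformation is left multiplication by a smooth family `c_k`, again with the same compatibility.
It therefore comes from a section of `D`, and so from a gauge transformation of `P`. -/

theorem smooth_ext {f g : Smooth d N} (h : ∀ x, f.1 x = g.1 x) : f = g := Subtype.ext (funext h)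

@[simp] theorem smooth_add_apply (f g : Smooth d N) (x : N) : (f + g).1 x = f.1 x + g.1 x := rfl

@[simp] theorem smooth_mul_apply (f g : Smooth d N) (x : N) : (f * g).1 x = f.1 x * g.1 x := rfl

@[simp] theorem smooth_sub_apply (f g : Smooth d N) (x : N) : (f - g).1 x = f.1 x - g.1 x := rfl

@[simp] theorem smooth_smul_apply (c : ℂ) (g : Smooth d N) (x : N) : (c • g).1 x = c * g.1 x := rfl

@[simp] theorem smooth_zero_apply (x : N) : (0 : Smooth d N).1 x = 0 := rfl

@[simp] theorem smooth_one_apply (x : N) : (1 : Smooth d N).1 x = 1 := rfl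

@[simp] theorem smooth_star_apply (g : Smooth d N) (x : N) : (star g).1 x = star (g.1 x) := rfl

@[simp] theorem smooth_algebraMap_apply (c : ℂ) (x : N) :
    (algebraMap ℂ (Smooth d N) c).1 x = c := rfl

theorem smooth_sum_apply {ι : Type*} (s : Finset ι) (f : ι → Smooth d N) (x : N) :
    (∑ k ∈ s, f k).1 x = ∑ k ∈ s, (f k).1 x :=
  map_sum (evalAt d x) f s

variable {M : Type w} [TopologicalSpace M] [ChartedSpace (EuclideanSpace ℝ (Fin d)) M]

@[simp] theorem smooth_smul_opens_apply {U : Opens M} (f : Smooth d M) (φ : Smooth d U) (x : U) :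
    (f • φ).1 x = f.1 x.1 * φ.1 x := rfl

/-- Extension of a function on `U` by zero. -/
def extendZero {U : Opens M} (φ : U → ℂ) : M → ℂ := Function.extend Subtype.val φ 0

theorem extendZero_apply {U : Opens M} (φ : U → ℂ) (x : U) : extendZero φ x.1 = φ x :=
  Subtype.val_injective.extend_apply _ _ _

theorem extendZero_of_notMem {U : Opens M} (φ : U → ℂ) {x : M} (hx : x ∉ U) :
    extendZero φ x = 0 :=
  Function.extend_apply' _ _ _ (by rintro ⟨y, rfl⟩; exact hx y.2)

theorem contMDiffAt_extendZero {U : Opens M} (φ : Smooth d U) (x : U) :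
    ContMDiffAt (𝓡 d) 𝓘(ℝ, ℂ) ∞ (extendZero φ.1) x.1 := by
  rw [← contMDiffAt_subtype_iff]
  have : (fun x : U => extendZero φ.1 x.1) = φ.1 := funext fun _ => extendZero_apply _ _
  rw [this]
  exact φ.2.contMDiffAt

/-- A function which is smooth at every point of `U` restricts to a smooth function on `U`. -/
def smoothOn (U : Opens M) (F : M → ℂ) (hF : ∀ x ∈ U, ContMDiffAt (𝓡 d) 𝓘(ℝ, ℂ) ∞ F x) :
    Smooth d U :=
  ⟨fun x => F x.1, fun x => contMDiffAt_subtype_iff.2 (hF x.1 x.2)⟩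

theorem contMDiffAt_mul {F F' : M → ℂ} {x : M} (h : ContMDiffAt (𝓡 d) 𝓘(ℝ, ℂ) ∞ F x)
    (h' : ContMDiffAt (𝓡 d) 𝓘(ℝ, ℂ) ∞ F' x) :
    ContMDiffAt (𝓡 d) 𝓘(ℝ, ℂ) ∞ (fun y => F y * F' y) x := by
  have h0 : ContDiff ℝ ∞ (fun p : ℂ × ℂ => p.1 * p.2) := contDiff_mul
  exact h0.contMDiff.contMDiffAt.comp x (h.prodMk_space h')

/-- Extension by zero may be discontinuous at the boundary of `U`, but off the closed support of `h`
the product vanishes in a neighbourhood. -/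
theorem contMDiffAt_mul_extendZero {U : Opens M} (h : Smooth d M) (φ : Smooth d U) {x : M}
    (hx : x ∈ U ∨ x ∉ tsupport h.1) :
    ContMDiffAt (𝓡 d) 𝓘(ℝ, ℂ) ∞ (fun y => h.1 y * extendZero φ.1 y) x := by
  rcases hx with hx | hx
  · exact contMDiffAt_mul h.2.contMDiffAt (contMDiffAt_extendZero φ ⟨x, hx⟩)
  · refine (contMDiffAt_const (c := (0 : ℂ))).congr_of_eventuallyEq ?_
    filter_upwards [notMem_tsupport_iff_eventuallyEq.1 hx] with y hy
    simp [hy]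

/-- Multiplication by a function `h` with support in `U` and extension by zero. -/
def extendBy {U : Opens M} (h : Smooth d M) (hU : tsupport h.1 ⊆ U) (φ : Smooth d U) :
    Smooth d M :=
  ⟨fun y => h.1 y * extendZero φ.1 y, fun _ => contMDiffAt_mul_extendZero h φ
    (or_iff_not_imp_right.2 fun hx' => hU (not_not.1 hx'))⟩

theorem restr_extendBy {U : Opens M} (h : Smooth d M) (hU : tsupport h.1 ⊆ U) (φ : Smooth d U) :
    restr d U (extendBy h hU φ) = h • φ :=
  smooth_ext fun x => congrArg (h.1 x.1 * ·) (extendZero_apply φ.1 x)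

theorem extendBy_apply {U : Opens M} (h : Smooth d M) (hU : tsupport h.1 ⊆ U) (φ : Smooth d U)
    (x : U) : (extendBy h hU φ).1 x.1 = h.1 x.1 * φ.1 x :=
  congrArg (h.1 x.1 * ·) (extendZero_apply φ.1 x)

/-- Multiplication by a function `h` with support in `V` and extension by zero, as a map from
`S(U ∩ V)` to `S(U)`. -/
def extendInter {U V : Opens M} (h : Smooth d M) (hV : tsupport h.1 ⊆ V) :
    Smooth d (U ⊓ V : Opens M) →ₗ[ℂ] Smooth d U where
  toFun φ := smoothOn U (fun y => h.1 y * extendZero φ.1 y) fun x hx =>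
    contMDiffAt_mul_extendZero h φ (or_iff_not_imp_right.2 fun hx' => ⟨hx, hV (not_not.1 hx')⟩)
  map_add' φ φ' := smooth_ext fun x => by
    change h.1 x.1 * extendZero _ x.1 = h.1 x.1 * extendZero _ x.1 + h.1 x.1 * extendZero _ x.1
    by_cases hx : x.1 ∈ U ⊓ V
    · lift x.1 to (U ⊓ V : Opens M) using hx with z
      simp only [extendZero_apply, smooth_add_apply, mul_add]
    · simp only [extendZero_of_notMem _ hx, mul_zero, add_zero]
  map_smul' c φ := smooth_ext fun x => by
    change h.1 x.1 * extendZero _ x.1 = c * (h.1 x.1 * extendZero _ x.1)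
    by_cases hx : x.1 ∈ U ⊓ V
    · lift x.1 to (U ⊓ V : Opens M) using hx with z
      simp only [extendZero_apply, smooth_smul_apply]
      ring
    · simp only [extendZero_of_notMem _ hx, mul_zero]

theorem extendInter_apply {U V : Opens M} (h : Smooth d M) (hV : tsupport h.1 ⊆ V)
    (φ : Smooth d (U ⊓ V : Opens M)) (x : U) (hx : x.1 ∈ V) :
    (extendInter h hV φ).1 x = h.1 x.1 * φ.1 ⟨x.1, x.2, hx⟩ :=
  congrArg (h.1 x.1 * ·) (extendZero_apply φ.1 ⟨x.1, x.2, hx⟩)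

theorem extendInter_of_notMem {U V : Opens M} (h : Smooth d M) (hV : tsupport h.1 ⊆ V)
    (φ : Smooth d (U ⊓ V : Opens M)) (x : U) (hx : x.1 ∉ V) :
    (extendInter h hV φ).1 x = 0 := by
  change h.1 x.1 * extendZero φ.1 x.1 = 0
  rw [image_eq_zero_of_notMem_tsupport fun h' => hx (hV h'), zero_mul]

/-- In a compact `M` the closed support of `h` is compact, and it stays compact when viewed inside
`U`. This makes cut-off functions admissible in the range condition of a local trivialization. -/
theorem hasCompactSupport_restr_mul [T2Space M] [CompactSpace M] {U : Opens M} (h : Smooth d M)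
    (hU : tsupport h.1 ⊆ U) (φ : Smooth d U) : HasCompactSupport (h • φ).1 := by
  have hc : IsCompact ((Subtype.val : U → M) ⁻¹' tsupport h.1) := by
    refine Subtype.isCompact_iff.2 ?_
    have he := Subtype.image_preimage_coe (U : Set M) (tsupport h.1)
    rw [Set.inter_eq_right.2 hU] at he
    exact he.symm.subst (motive := IsCompact) (isClosed_tsupport _).isCompact
  refine HasCompactSupport.intro hc fun x hx => ?_
  rw [smooth_smul_opens_apply, image_eq_zero_of_notMem_tsupport hx, zero_mul]

theorem smooth_isUnit (f : Smooth d M) (hf : ∀ x, f.1 x ≠ 0) : ∃ g : Smooth d M, g * f = 1 := by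
  refine ⟨⟨fun x => (f.1 x)⁻¹, fun x => ?_⟩, smooth_ext fun x => inv_mul_cancel₀ (hf x)⟩
  exact (contDiffAt_inv ℝ (hf x)).contMDiffAt.comp x f.2.contMDiffAt

/-- Every `*`-character of `S(M)` is the evaluation at a point. -/
theorem exists_eq_evalAt [CompactSpace M] (χ : Smooth d M →⋆ₐ[ℂ] ℂ) : ∃ x : M, ∀ f, χ f = f.1 x := by
  by_contra! hne
  choose f hf using hne
  -- If `χ` is no evaluation, then for each `x` its kernel contains a function not vanishing at `x`.
  let e : M → Smooth d M := fun x => f x - algebraMap ℂ _ (χ (f x))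
  have he : ∀ x, χ (e x) = 0 := fun x => by
    have : χ (algebraMap ℂ (Smooth d M) (χ (f x))) = χ (f x) := AlgHomClass.commutes χ _
    simp only [e, map_sub, this, sub_self]
  have hex : ∀ x, (e x).1 x ≠ 0 := fun x => by
    simp only [e, smooth_sub_apply, smooth_algebraMap_apply]
    exact sub_ne_zero.2 (hf x).symm
  obtain ⟨t, ht⟩ := isCompact_univ.elim_finite_subcover (fun x => {y | (e x).1 y ≠ 0})
    (fun x => isOpen_ne_fun (e x).2.continuous continuous_const)
    (fun x _ => Set.mem_iUnion.2 ⟨x, hex x⟩)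
  -- Finitely many of these functions have no common zero, so the sum of their squared moduli is
  -- invertible, yet it lies in the kernel of `χ`.
  let s : Smooth d M := ∑ x ∈ t, star (e x) * e x
  have hs : χ s = 0 := by
    simp only [s, map_sum, map_mul, he, mul_zero, Finset.sum_const_zero]
  have hsx : ∀ y, s.1 y ≠ 0 := fun y hy => by
    obtain ⟨x, hx⟩ := Set.mem_iUnion.1 (ht (Set.mem_univ y))
    obtain ⟨hxt, hxy⟩ := Set.mem_iUnion.1 hx
    have h1 : s.1 y = ((∑ x ∈ t, Complex.normSq ((e x).1 y) : ℝ) : ℂ) := by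
      rw [smooth_sum_apply, Complex.ofReal_sum]
      exact Finset.sum_congr rfl fun x _ => (Complex.normSq_eq_conj_mul_self).symm
    rw [h1, Complex.ofReal_eq_zero,
      Finset.sum_eq_zero_iff_of_nonneg fun _ _ => Complex.normSq_nonneg _] at hy
    exact hxy (Complex.normSq_eq_zero.1 (hy x hxt))
  obtain ⟨g, hg⟩ := smooth_isUnit s hsx
  have := congrArg χ hg
  rw [map_mul, hs, mul_zero, map_one] at this
  exact zero_ne_one this

/-! ### Partitions of unity and cutoff functions -/

section Partition

variable [T2Space M] [CompactSpace M] [IsManifold (𝓡 d) ∞ M]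

/-- A smooth partition of unity subordinate to a finite open cover. -/
theorem exists_partition {m : ℕ} (U : Fin m → Opens M) (hU : ∀ x, ∃ k, x ∈ U k) :
    ∃ c : Fin m → Smooth d M, (∀ k, tsupport (c k).1 ⊆ U k) ∧ ∑ k, c k = 1 := by
  obtain ⟨ρ, hρ⟩ := SmoothPartitionOfUnity.exists_isSubordinate (𝓡 d) (isClosed_univ (X := M))
    (fun k => (U k : Set M)) (fun k => (U k).2)
    (fun x _ => Set.mem_iUnion.2 (hU x))
  have hc : ContDiff ℝ ∞ (fun t : ℝ => (t : ℂ)) := Complex.ofRealCLM.contDiff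
  let c : Fin m → Smooth d M := fun k =>
    ⟨fun x => (ρ k x : ℂ), hc.contMDiff.comp (ρ k).contMDiff⟩
  refine ⟨c, fun k => ?_, smooth_ext fun x => ?_⟩
  · refine Set.Subset.trans (closure_mono fun x hx => ?_) (hρ k)
    intro h0
    apply hx
    change ((ρ k x : ℝ) : ℂ) = 0
    rw [h0, Complex.ofReal_zero]
  · rw [smooth_sum_apply]
    change ∑ k, ((ρ k x : ℝ) : ℂ) = 1
    have := ρ.sum_eq_one (Set.mem_univ x)
    rw [finsum_eq_sum_of_fintype] at this
    rw [← Complex.ofReal_sum, this, Complex.ofReal_one]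

/-- A smooth function with support in `U` which equals one on a closed subset. -/
theorem exists_bump (U : Opens M) (K : Set M) (hK : IsClosed K) (hKU : K ⊆ U) :
    ∃ h : Smooth d M, tsupport h.1 ⊆ U ∧ ∀ x ∈ K, h.1 x = 1 := by
  -- In a partition for the cover by `U` and the complement of `K`, the second function vanishes on
  -- `K`, so the first is one there.
  obtain ⟨c, hc, hs⟩ := exists_partition (d := d) ![U, ⟨Kᶜ, hK.isOpen_compl⟩] (fun x => by
    by_cases hx : x ∈ K
    · exact ⟨0, hKU hx⟩
    · exact ⟨1, hx⟩)
  refine ⟨c 0, hc 0, fun x hx => ?_⟩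
  have h1 : (c 1).1 x = 0 := image_eq_zero_of_notMem_tsupport fun h => hc 1 h hx
  have h2 := congrArg (fun f : Smooth d M => f.1 x) hs
  simpa [Fin.sum_univ_two, h1] using h2

theorem exists_bump_point (U : Opens M) (x : U) :
    ∃ h : Smooth d M, tsupport h.1 ⊆ U ∧ h.1 x.1 = 1 := by
  obtain ⟨h, h1, h2⟩ := exists_bump (d := d) U {x.1} isClosed_singleton (by simp)
  exact ⟨h, h1, h2 _ rfl⟩

/-- Equality with one near the point, not only at it, is what testing smoothness requires. A closed
neighbourhood inside `U` exists because compact Hausdorff spaces are regular. -/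
theorem exists_bump_nhds (U : Opens M) (x : U) :
    ∃ h : Smooth d M, tsupport h.1 ⊆ U ∧ ∀ᶠ y in nhds x.1, h.1 y = 1 := by
  obtain ⟨K, hK, hc, hKU⟩ := exists_mem_nhds_isClosed_subset (U.2.mem_nhds x.2)
  obtain ⟨h, h1, h2⟩ := exists_bump (d := d) U K hc hKU
  exact ⟨h, h1, Filter.mem_of_superset hK h2⟩

end Partition

end SmoothTools

/-! ### Translations on the Hopf algebra -/

section Translation

open Coalgebra HopfAlgebra

variable {G : CompactMatrixQuantumGroup.{v}}

/-- The left translation `a ↦ χ(a⁽¹⁾) a⁽²⁾` by a linear functional. -/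
def lam (χ : G.A →ₗ[ℂ] ℂ) : G.A →ₗ[ℂ] G.A :=
  (TensorProduct.lid ℂ G.A).toLinearMap ∘ₗ χ.rTensor G.A ∘ₗ comul

/-- The right translation `a ↦ a⁽¹⁾ χ(a⁽²⁾)` by a linear functional. -/
def rho (χ : G.A →ₗ[ℂ] ℂ) : G.A →ₗ[ℂ] G.A :=
  (TensorProduct.rid ℂ G.A).toLinearMap ∘ₗ χ.lTensor G.A ∘ₗ comul

theorem lam_apply (χ : G.A →ₗ[ℂ] ℂ) (a : G.A) :
    lam χ a = TensorProduct.lid ℂ G.A (χ.rTensor G.A (comul a)) := rfl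

theorem rho_apply (χ : G.A →ₗ[ℂ] ℂ) (a : G.A) :
    rho χ a = TensorProduct.rid ℂ G.A (χ.lTensor G.A (comul a)) := rfl

/-- Coassociativity: both sides are `χ(a⁽¹⁾) a⁽²⁾ ⊗ a⁽³⁾`. Left translations are thus right
colinear, and `eq_lam` is the converse. -/
theorem comul_lam (χ : G.A →ₗ[ℂ] ℂ) (a : G.A) :
    comul (R := ℂ) (lam χ a) = (lam χ).rTensor G.A (comul a) := by
  have h1 : ∀ t : G.A ⊗[ℂ] G.A, comul (R := ℂ) (TensorProduct.lid ℂ G.A (χ.rTensor G.A t)) =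
      TensorProduct.lid ℂ (G.A ⊗[ℂ] G.A) (χ.rTensor _ (comul.lTensor G.A t)) := by
    intro t
    induction t with
    | zero => simp
    | add x y hx hy => simp only [map_add, hx, hy]
    | tmul x y => simp
  have h2 : ∀ t : G.A ⊗[ℂ] G.A, (lam χ).rTensor G.A t = TensorProduct.lid ℂ (G.A ⊗[ℂ] G.A)
      (χ.rTensor _ (TensorProduct.assoc ℂ G.A G.A G.A (comul.rTensor G.A t))) := by
    intro t
    induction t with
    | zero => simp
    | add x y hx hy => simp only [map_add, hx, hy]
    | tmul x y =>
      simp only [LinearMap.rTensor_tmul, lam_apply]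
      generalize comul (R := ℂ) x = s
      induction s with
      | zero => simp
      | add x y hx hy => simp only [map_add, TensorProduct.add_tmul, hx, hy]
      | tmul x z => simp [TensorProduct.smul_tmul']
  rw [lam_apply, h1, h2, coassoc_apply]

theorem comul_rho (χ : G.A →ₗ[ℂ] ℂ) (a : G.A) :
    comul (R := ℂ) (rho χ a) = (rho χ).lTensor G.A (comul a) := by
  have h1 : ∀ t : G.A ⊗[ℂ] G.A, comul (R := ℂ) (TensorProduct.rid ℂ G.A (χ.lTensor G.A t)) =
      TensorProduct.rid ℂ (G.A ⊗[ℂ] G.A) (χ.lTensor _ (comul.rTensor G.A t)) := by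
    intro t
    induction t with
    | zero => simp
    | add x y hx hy => simp only [map_add, hx, hy]
    | tmul x y => simp
  have h2 : ∀ t : G.A ⊗[ℂ] G.A, (rho χ).lTensor G.A t = TensorProduct.rid ℂ (G.A ⊗[ℂ] G.A)
      (χ.lTensor _ ((TensorProduct.assoc ℂ G.A G.A G.A).symm (comul.lTensor G.A t))) := by
    intro t
    induction t with
    | zero => simp
    | add x y hx hy => simp only [map_add, hx, hy]
    | tmul x y =>
      simp only [LinearMap.lTensor_tmul, rho_apply]
      generalize comul (R := ℂ) y = s
      induction s with
      | zero => simp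
      | add x y hx hy => simp only [map_add, TensorProduct.tmul_add, hx, hy]
      | tmul y z => simp
  rw [rho_apply, h1, h2, ← coassoc_apply, LinearEquiv.symm_apply_apply]

/-- Both sides are `a⁽¹⁾ χ(a⁽²⁾) ⊗ a⁽³⁾`: the functional acts on the middle leg, which may be split
off from either side. -/
theorem rTensor_rho_comul (χ : G.A →ₗ[ℂ] ℂ) (a : G.A) :
    (rho χ).rTensor G.A (comul a) = (lam χ).lTensor G.A (comul a) := by
  have h1 : ∀ t : G.A ⊗[ℂ] G.A, (rho χ).rTensor G.A t =
      (TensorProduct.lid ℂ G.A).toLinearMap.lTensor G.A ((χ.rTensor G.A).lTensor G.A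
        (TensorProduct.assoc ℂ G.A G.A G.A (comul.rTensor G.A t))) := by
    intro t
    induction t with
    | zero => simp
    | add x y hx hy => simp only [map_add, hx, hy]
    | tmul x y =>
      simp only [LinearMap.rTensor_tmul, rho_apply]
      generalize comul (R := ℂ) x = s
      induction s with
      | zero => simp
      | add x y hx hy => simp only [map_add, TensorProduct.add_tmul, hx, hy]
      | tmul x z => simp [TensorProduct.smul_tmul]
  have h2 : ∀ t : G.A ⊗[ℂ] G.A, (lam χ).lTensor G.A t =
      (TensorProduct.lid ℂ G.A).toLinearMap.lTensor G.A ((χ.rTensor G.A).lTensor G.A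
        (comul.lTensor G.A t)) := by
    intro t
    induction t with
    | zero => simp
    | add x y hx hy => simp only [map_add, hx, hy]
    | tmul x y => simp [lam_apply]
  rw [h1, h2, coassoc_apply]

@[simp] theorem counit_lam (χ : G.A →ₗ[ℂ] ℂ) (a : G.A) : counit (R := ℂ) (lam χ a) = χ a := by
  have h : ∀ t : G.A ⊗[ℂ] G.A, counit (R := ℂ) (TensorProduct.lid ℂ G.A (χ.rTensor G.A t)) =
      χ (TensorProduct.rid ℂ G.A (counit.lTensor G.A t)) := by
    intro t
    induction t with
    | zero => simp
    | add x y hx hy => simp only [map_add, hx, hy]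
    | tmul x y => simp [mul_comm]
  rw [lam_apply, h, lTensor_counit_comul]
  simp

@[simp] theorem counit_rho (χ : G.A →ₗ[ℂ] ℂ) (a : G.A) : counit (R := ℂ) (rho χ a) = χ a := by
  have h : ∀ t : G.A ⊗[ℂ] G.A, counit (R := ℂ) (TensorProduct.rid ℂ G.A (χ.lTensor G.A t)) =
      χ (TensorProduct.lid ℂ G.A (counit.rTensor G.A t)) := by
    intro t
    induction t with
    | zero => simp
    | add x y hx hy => simp only [map_add, hx, hy]
    | tmul x y => simp [mul_comm]
  rw [rho_apply, h, rTensor_counit_comul]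
  simp

/-- A right colinear endomorphism is a left translation. -/
theorem eq_lam (T : G.A →ₗ[ℂ] G.A)
    (hT : ∀ a, comul (R := ℂ) (T a) = T.rTensor G.A (comul a)) (a : G.A) :
    T a = lam (counit ∘ₗ T) a := by
  rw [lam_apply, LinearMap.rTensor_comp, LinearMap.comp_apply, ← hT, rTensor_counit_comul]
  simp

/-- A left colinear endomorphism is a right translation. -/
theorem eq_rho (T : G.A →ₗ[ℂ] G.A)
    (hT : ∀ a, comul (R := ℂ) (T a) = T.lTensor G.A (comul a)) (a : G.A) :
    T a = rho (counit ∘ₗ T) a := by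
  rw [rho_apply, LinearMap.lTensor_comp, LinearMap.comp_apply, ← hT, lTensor_counit_comul]
  simp

/-- A composite of right colinear maps is right colinear, hence a translation, and its functional is
read off with the counit. The functional `χ ∘ lam θ` is the convolution `θχ`, so the order is
reversed. -/
theorem lam_lam (χ θ : G.A →ₗ[ℂ] ℂ) (a : G.A) : lam χ (lam θ a) = lam (χ ∘ₗ lam θ) a := by
  refine (eq_lam (lam χ ∘ₗ lam θ) (fun b => ?_) a).trans
    (congrArg (fun s => lam s a) (LinearMap.ext fun b => counit_lam _ _))
  rw [LinearMap.comp_apply, comul_lam, comul_lam, LinearMap.rTensor_comp, LinearMap.comp_apply]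

theorem rho_rho (χ θ : G.A →ₗ[ℂ] ℂ) (a : G.A) : rho χ (rho θ a) = rho (χ ∘ₗ rho θ) a := by
  refine (eq_rho (rho χ ∘ₗ rho θ) (fun b => ?_) a).trans
    (congrArg (fun s => rho s a) (LinearMap.ext fun b => counit_rho _ _))
  rw [LinearMap.comp_apply, comul_rho, comul_rho, LinearMap.lTensor_comp, LinearMap.comp_apply]

@[simp] theorem lam_counit (a : G.A) : lam counit a = a := by
  rw [lam_apply, rTensor_counit_comul]
  simp

@[simp] theorem rho_counit (a : G.A) : rho counit a = a := by
  rw [rho_apply, lTensor_counit_comul]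
  simp

/-- Both sides are `χ(a⁽¹⁾) θ(a⁽²⁾)`. This transfers facts about left translations to right
translations. -/
theorem apply_rho (χ θ : G.A →ₗ[ℂ] ℂ) (a : G.A) : χ (rho θ a) = θ (lam χ a) := by
  rw [rho_apply, lam_apply]
  generalize comul (R := ℂ) a = t
  induction t with
  | zero => simp
  | add x y hx hy => simp only [map_add, hx, hy]
  | tmul x y => simp [mul_comm]

theorem lam_rho (χ θ : G.A →ₗ[ℂ] ℂ) (a : G.A) : lam χ (rho θ a) = rho θ (lam χ a) := by
  rw [lam_apply, comul_rho, lam_apply]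
  generalize comul (R := ℂ) a = t
  induction t with
  | zero => simp
  | add x y hx hy => simp only [map_add, hx, hy]
  | tmul x y => simp

/-! ### Characters, their inverses and their translations -/

namespace CompactMatrixQuantumGroup.Cl

/-- The linear functional underlying a character. -/
def lin (χ : G.Cl) : G.A →ₗ[ℂ] ℂ := χ.toAlgHom.toLinearMap

@[simp] theorem lin_apply (χ : G.Cl) (a : G.A) : χ.lin a = χ a := rfl

/-- The inverse character. -/
def inv (χ : G.Cl) : G.Cl where
  __ := compAntipode χ
  map_star' := compAntipode_star χ

theorem inv_apply (χ : G.Cl) (a : G.A) : χ.inv a = χ (antipode ℂ a) := rfl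

/-- The trivial character, given by the counit. -/
def one (G : CompactMatrixQuantumGroup.{v}) : G.Cl where
  __ := Bialgebra.counitAlgHom ℂ G.A
  map_star' := counit_star

theorem one_apply (a : G.A) : one G a = counit (R := ℂ) a := rfl

theorem lin_ext {χ θ : G.Cl} (h : ∀ a, χ a = θ a) : χ = θ := StarAlgHom.ext h

theorem apply_lam_inv (χ : G.Cl) (a : G.A) : χ (lam χ.inv.lin a) = counit (R := ℂ) a := by
  have h : ∀ t : G.A ⊗[ℂ] G.A, χ (TensorProduct.lid ℂ G.A (χ.inv.lin.rTensor G.A t)) =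
      χ (LinearMap.mul' ℂ G.A ((antipode ℂ).rTensor G.A t)) := by
    intro t
    induction t with
    | zero => simp
    | add x y hx hy => simp only [map_add, hx, hy]
    | tmul x y => simp [inv_apply]
  rw [lam_apply, h, mul_antipode_rTensor_comul_apply]
  exact AlgHomClass.commutes χ _

theorem inv_lam_apply (χ : G.Cl) (a : G.A) : χ.inv (lam χ.lin a) = counit (R := ℂ) a := by
  have h : ∀ t : G.A ⊗[ℂ] G.A, χ.inv (TensorProduct.lid ℂ G.A (χ.lin.rTensor G.A t)) =
      χ (LinearMap.mul' ℂ G.A ((antipode ℂ).lTensor G.A t)) := by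
    intro t
    induction t with
    | zero => simp
    | add x y hx hy => simp only [map_add, hx, hy]
    | tmul x y => simp [inv_apply]
  rw [lam_apply, h, mul_antipode_lTensor_comul_apply]
  exact AlgHomClass.commutes χ _

theorem lam_lam_inv (χ : G.Cl) (a : G.A) : lam χ.lin (lam χ.inv.lin a) = a := by
  rw [lam_lam, show χ.lin ∘ₗ lam χ.inv.lin = counit from LinearMap.ext χ.apply_lam_inv, lam_counit]

theorem lam_inv_lam (χ : G.Cl) (a : G.A) : lam χ.inv.lin (lam χ.lin a) = a := by
  rw [lam_lam, show χ.inv.lin ∘ₗ lam χ.lin = counit from LinearMap.ext χ.inv_lam_apply, lam_counit]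

theorem rho_inv_rho (χ : G.Cl) (a : G.A) : rho χ.inv.lin (rho χ.lin a) = a := by
  rw [rho_rho, show χ.inv.lin ∘ₗ rho χ.lin = counit from
    LinearMap.ext fun b => (apply_rho χ.inv.lin χ.lin b).trans (χ.apply_lam_inv b), rho_counit]

/-- A one-sided inverse suffices because `lam χ` is already invertible; the counit then recovers the
character from its translation. -/
theorem eq_inv_of_lam_lam {χ θ : G.Cl} (h : ∀ a, lam χ.lin (lam θ.lin a) = a) : θ = χ.inv := by
  refine lin_ext fun a => ?_
  have h1 := congrArg (lam χ.inv.lin) (h a)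
  rw [lam_inv_lam] at h1
  rw [← lin_apply, ← counit_lam, h1, counit_lam, lin_apply]

@[simp] theorem inv_inv (χ : G.Cl) : χ.inv.inv = χ :=
  (eq_inv_of_lam_lam χ.lam_inv_lam).symm

theorem lam_mul (χ : G.Cl) (a b : G.A) : lam χ.lin (a * b) = lam χ.lin a * lam χ.lin b := by
  have h : ∀ a, lam χ.lin a = ((Algebra.TensorProduct.lid ℂ G.A).toAlgHom.comp
      ((mapLeft G.A χ.toAlgHom).comp (Bialgebra.comulAlgHom ℂ G.A))) a := fun a => rfl
  simp only [h, map_mul]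

theorem lam_one (χ : G.Cl) : lam χ.lin 1 = 1 := by
  simp [lam_apply, Algebra.TensorProduct.one_def]

theorem lam_star (χ : G.Cl) (a : G.A) : lam χ.lin (star a) = star (lam χ.lin a) := by
  rw [lam_apply, lam_apply, G.comul_star]
  generalize comul (R := ℂ) a = t
  induction t with
  | zero => simp
  | add x y hx hy => simp only [map_add, star_add, hx, hy]
  | tmul x y => simp [map_star]

theorem rho_mul (χ : G.Cl) (a b : G.A) : rho χ.lin (a * b) = rho χ.lin a * rho χ.lin b := by
  have h : ∀ a, rho χ.lin a = ((Algebra.TensorProduct.rid ℂ ℂ G.A).toAlgHom.comp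
      ((Algebra.TensorProduct.map (AlgHom.id ℂ G.A) χ.toAlgHom).comp
        (Bialgebra.comulAlgHom ℂ G.A))) a := fun a => rfl
  simp only [h, map_mul]

theorem rho_one (χ : G.Cl) : rho χ.lin 1 = 1 := by
  simp [rho_apply, Algebra.TensorProduct.one_def]

end CompactMatrixQuantumGroup.Cl

/-! ### Antipode, coproduct and the adjoint action -/

open CompactMatrixQuantumGroup

/-- The identity is invertible for convolution, with inverse the antipode, and can be cancelled. -/
theorem linearMap_ext_of_convolution_id {S T : G.A →ₗ[ℂ] G.A}
    (h : ∀ a, LinearMap.mul' ℂ G.A (S.rTensor G.A (comul a)) =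
      LinearMap.mul' ℂ G.A (T.rTensor G.A (comul a))) : S = T := by
  have h' : WithConv.toConv S * WithConv.toConv LinearMap.id =
      WithConv.toConv T * WithConv.toConv LinearMap.id :=
    WithConv.ofConv_injective (LinearMap.ext h)
  have h2 := congrArg (· * WithConv.toConv (antipode ℂ (A := G.A))) h'
  simp only [mul_assoc, LinearMap.id_mul_antipode, mul_one] at h2
  exact WithConv.toConv_injective h2

theorem linearMap_ext_of_id_convolution {S T : G.A →ₗ[ℂ] G.A}
    (h : ∀ a, LinearMap.mul' ℂ G.A (S.lTensor G.A (comul a)) =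
      LinearMap.mul' ℂ G.A (T.lTensor G.A (comul a))) : S = T := by
  have h' : WithConv.toConv LinearMap.id * WithConv.toConv S =
      WithConv.toConv LinearMap.id * WithConv.toConv T :=
    WithConv.ofConv_injective (LinearMap.ext h)
  have h2 := congrArg (WithConv.toConv (antipode ℂ (A := G.A)) * ·) h'
  simp only [← mul_assoc, LinearMap.antipode_mul_id, one_mul] at h2
  exact WithConv.toConv_injective h2

/-- Both sides, convolved with the identity, give `χ(a) 1`. On the right this uses that `rho χ⁻¹` is
multiplicative and inverts `rho χ`, so it can be pulled out of the product. -/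
theorem antipode_lam (χ : G.Cl) (a : G.A) :
    antipode ℂ (lam χ.lin a) = rho χ.inv.lin (antipode ℂ a) := by
  refine LinearMap.congr_fun (linearMap_ext_of_convolution_id (S := antipode ℂ ∘ₗ lam χ.lin)
    (T := rho χ.inv.lin ∘ₗ antipode ℂ) fun b => ?_) a
  have h1 : ∀ t : G.A ⊗[ℂ] G.A,
      LinearMap.mul' ℂ G.A ((rho χ.inv.lin ∘ₗ antipode ℂ).rTensor G.A t) = rho χ.inv.lin
        (LinearMap.mul' ℂ G.A ((antipode ℂ).rTensor G.A ((rho χ.lin).lTensor G.A t))) := by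
    intro t
    induction t with
    | zero => simp
    | add x y hx hy => simp only [map_add, hx, hy]
    | tmul x y => simp [Cl.rho_mul, Cl.rho_inv_rho]
  rw [h1, ← comul_rho, mul_antipode_rTensor_comul_apply, LinearMap.rTensor_comp,
    LinearMap.comp_apply, ← comul_lam, mul_antipode_rTensor_comul_apply, counit_lam, counit_rho,
    Algebra.algebraMap_eq_smul_one, map_smul, Cl.rho_one]

theorem antipode_rho (χ : G.Cl) (a : G.A) :
    antipode ℂ (rho χ.lin a) = lam χ.inv.lin (antipode ℂ a) := by
  refine LinearMap.congr_fun (linearMap_ext_of_id_convolution (S := antipode ℂ ∘ₗ rho χ.lin)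
    (T := lam χ.inv.lin ∘ₗ antipode ℂ) fun b => ?_) a
  have h1 : ∀ t : G.A ⊗[ℂ] G.A,
      LinearMap.mul' ℂ G.A ((lam χ.inv.lin ∘ₗ antipode ℂ).lTensor G.A t) = lam χ.inv.lin
        (LinearMap.mul' ℂ G.A ((antipode ℂ).lTensor G.A ((lam χ.lin).rTensor G.A t))) := by
    intro t
    induction t with
    | zero => simp
    | add x y hx hy => simp only [map_add, hx, hy]
    | tmul x y => simp [Cl.lam_mul, Cl.lam_inv_lam]
  rw [h1, ← comul_lam, mul_antipode_lTensor_comul_apply, LinearMap.lTensor_comp,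
    LinearMap.comp_apply, ← comul_rho, mul_antipode_lTensor_comul_apply, counit_lam, counit_rho,
    Algebra.algebraMap_eq_smul_one, map_smul, Cl.lam_one]

/-- The adjoint action `a ↦ χ(κ(a⁽¹⁾) a⁽³⁾) a⁽²⁾` of a character. -/
def ad (χ : G.Cl) : G.A →ₗ[ℂ] G.A := lam χ.inv.lin ∘ₗ rho χ.lin

theorem ad_apply (χ : G.Cl) (a : G.A) : ad χ a = lam χ.inv.lin (rho χ.lin a) := rfl

/-- The antipode exchanges left and right translations and inverts the character, and the two kinds
of translation commute. Hence the componentwise antipode respects the gluing in `D`. -/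
theorem antipode_ad (χ : G.Cl) (a : G.A) : antipode ℂ (ad χ a) = ad χ (antipode ℂ a) := by
  rw [ad_apply, antipode_lam, Cl.inv_inv, antipode_rho, ad_apply, lam_rho]

/-- On a coproduct, `rho χ` on the first leg equals `lam χ` on the second (`rTensor_rho_comul`),
where `lam χ⁻¹` cancels it. -/
theorem map_rho_lam_comul (χ : G.Cl) (a : G.A) :
    TensorProduct.map (rho χ.lin) (lam χ.inv.lin) (comul a) = comul a := by
  rw [← LinearMap.lTensor_comp_rTensor, LinearMap.comp_apply, rTensor_rho_comul,
    ← LinearMap.comp_apply, ← LinearMap.lTensor_comp,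
    show lam χ.inv.lin ∘ₗ lam χ.lin = LinearMap.id from LinearMap.ext χ.lam_inv_lam,
    LinearMap.lTensor_id, LinearMap.id_apply]

/-- The inner translations of the two adjoint actions cancel by `map_rho_lam_comul`; the outer ones
are colinear and come out of the coproduct. This is the compatibility that lets local coproducts
glue to `φ_M`. -/
theorem comul_ad (χ : G.Cl) (a : G.A) :
    comul (R := ℂ) (ad χ a) = TensorProduct.map (ad χ) (ad χ) (comul a) := by
  have h : TensorProduct.map (ad χ) (ad χ) =
      TensorProduct.map (lam χ.inv.lin) (rho χ.lin) ∘ₗ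
        TensorProduct.map (rho χ.lin) (lam χ.inv.lin) := by
    rw [← TensorProduct.map_comp]
    exact congrArg _ (LinearMap.ext fun b => lam_rho _ _ _)
  rw [h, LinearMap.comp_apply, map_rho_lam_comul, ad_apply, comul_lam, comul_rho,
    ← LinearMap.comp_apply, LinearMap.rTensor_comp_lTensor]

/-- The analogue of `comul_ad` for `β_M`: under a change of trivialization the leg in `D` changes by
the adjoint action, the leg in `B` by a translation. -/
theorem comul_lam_inv (χ : G.Cl) (a : G.A) :
    comul (R := ℂ) (lam χ.inv.lin a) = TensorProduct.map (ad χ) (lam χ.inv.lin) (comul a) := by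
  have h : TensorProduct.map (ad χ) (lam χ.inv.lin) =
      (lam χ.inv.lin).rTensor G.A ∘ₗ TensorProduct.map (rho χ.lin) (lam χ.inv.lin) := by
    rw [LinearMap.rTensor, ← TensorProduct.map_comp]
    rfl
  rw [h, LinearMap.comp_apply, map_rho_lam_comul, comul_lam]

/-- The hypothesis says that `σ` is the product `χθ`, in the form in which the cocycle identity
supplies it. -/
theorem ad_ad {χ θ σ : G.Cl} (h : ∀ a, lam σ.lin a = lam θ.lin (lam χ.lin a)) (a : G.A) :
    ad χ (ad θ a) = ad σ a := by
  have h1 : ∀ b, lam σ.inv.lin b = lam χ.inv.lin (lam θ.inv.lin b) := fun b => by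
    have h2 : b = lam σ.lin (lam χ.inv.lin (lam θ.inv.lin b)) := by
      rw [h, Cl.lam_lam_inv, Cl.lam_lam_inv]
    conv_lhs => rw [h2, Cl.lam_inv_lam]
  have h3 : ∀ b, rho σ.lin b = rho χ.lin (rho θ.lin b) := fun b => by
    rw [rho_rho]
    refine congrArg (fun s => rho s b) (LinearMap.ext fun c => ?_)
    rw [LinearMap.comp_apply, apply_rho, ← counit_lam σ.lin, h, counit_lam]
  simp only [ad_apply, h1, h3, lam_rho]

theorem ad_inv_ad (χ : G.Cl) (a : G.A) : ad χ.inv (ad χ a) = a := by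
  rw [ad_apply, ad_apply, Cl.inv_inv, ← lam_rho, Cl.lam_lam_inv, Cl.rho_inv_rho]

end Translation

/-! ### Evaluation of functions with values in a vector space -/

section Evaluation

variable {d : ℕ} {N : Type w} [TopologicalSpace N] [ChartedSpace (EuclideanSpace ℝ (Fin d)) N]
  {V : Type*} [AddCommGroup V] [Module ℂ V]

/-- Evaluation at a point of the elements of `S(N) ⊗ V`. -/
def evTen (x : N) : Smooth d N ⊗[ℂ] V →ₗ[ℂ] V :=
  (TensorProduct.lid ℂ V).toLinearMap ∘ₗ (evalAt d x).toAlgHom.toLinearMap.rTensor V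

@[simp] theorem evTen_tmul (x : N) (φ : Smooth d N) (v : V) : evTen x (φ ⊗ₜ[ℂ] v) = φ.1 x • v :=
  rfl

/-- The smooth function `x ↦ θ(z(x))`. -/
def slice (θ : V →ₗ[ℂ] ℂ) : Smooth d N ⊗[ℂ] V →ₗ[ℂ] Smooth d N :=
  (TensorProduct.rid ℂ (Smooth d N)).toLinearMap ∘ₗ θ.lTensor (Smooth d N)

theorem slice_apply (θ : V →ₗ[ℂ] ℂ) (z : Smooth d N ⊗[ℂ] V) (x : N) :
    (slice θ z).1 x = θ (evTen x z) := by
  induction z with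
  | zero => simp
  | add z w hz hw => simp only [map_add, smooth_add_apply, hz, hw]
  | tmul φ v => simp [slice, mul_comm]

/-- A basis of `V` turns `S(N) ⊗ V` into finitely supported families of functions. The coordinates
are slices, and a slice is determined by point values. -/
theorem evTen_ext {z w : Smooth d N ⊗[ℂ] V} (h : ∀ x, evTen x z = evTen x w) : z = w := by
  let b := Module.Free.chooseBasis ℂ V
  have hs : ∀ θ : V →ₗ[ℂ] ℂ, slice θ z = slice θ w := fun θ =>
    smooth_ext fun x => by rw [slice_apply, slice_apply, h]
  let e := TensorProduct.equivFinsuppOfBasisRight (M := Smooth d N) b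
  have he : ∀ u i, e u i = slice (b.coord i) u := by
    intro u i
    induction u with
    | zero => simp
    | add z w hz hw => simp only [map_add, Finsupp.add_apply, hz, hw]
    | tmul φ v => simp [e, slice]
  apply e.injective
  ext1 i
  rw [he, he, hs]

theorem evTen_lTensor {W : Type*} [AddCommGroup W] [Module ℂ W] (T : V →ₗ[ℂ] W) (x : N)
    (z : Smooth d N ⊗[ℂ] V) : evTen x (T.lTensor (Smooth d N) z) = T (evTen x z) := by
  induction z with
  | zero => simp
  | add z w hz hw => simp only [map_add, hz, hw]
  | tmul φ v => simp

theorem evTen_smul {M : Type w} [TopologicalSpace M] [ChartedSpace (EuclideanSpace ℝ (Fin d)) M]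
    {U : Opens M} (x : U) (f : Smooth d M) (z : Smooth d U ⊗[ℂ] V) :
    evTen x (f • z) = f.1 x.1 • evTen x z := by
  induction z with
  | zero => simp
  | add z w hz hw => simp only [smul_add, map_add, hz, hw]
  | tmul φ v => simp [TensorProduct.smul_tmul', mul_smul]

section Algebra

variable {A : Type*} [Ring A] [Algebra ℂ A]

theorem evTen_mul (x : N) (z w : Smooth d N ⊗[ℂ] A) :
    evTen x (z * w) = evTen x z * evTen x w := by
  induction z with
  | zero => simp
  | add z z' hz hz' => simp only [add_mul, map_add, hz, hz']
  | tmul φ a =>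
    induction w with
    | zero => simp
    | add w w' hw hw' => simp only [mul_add, map_add, hw, hw']
    | tmul φ' a' =>
      simp only [Algebra.TensorProduct.tmul_mul_tmul, evTen_tmul, smooth_mul_apply,
        smul_mul_smul_comm]

@[simp] theorem evTen_one (x : N) : evTen x (1 : Smooth d N ⊗[ℂ] A) = 1 := by
  simp [Algebra.TensorProduct.one_def]

theorem evTen_star [StarRing A] [StarModule ℂ A] (x : N) (z : Smooth d N ⊗[ℂ] A) :
    evTen x (star z) = star (evTen x z) := by
  induction z with
  | zero => simp
  | add z w hz hw => simp only [star_add, map_add, hz, hw]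
  | tmul φ a => simp [TensorProduct.star_tmul]

theorem evTen_starLift [StarRing A] [StarModule ℂ A] (x : N) (χ : A →⋆ₐ[ℂ] ℂ)
    (z : Smooth d N ⊗[ℂ] A) : starLift (evalAt d x) χ z = χ (evTen x z) := by
  induction z with
  | zero => simp
  | add z w hz hw => simp only [map_add, hz, hw]
  | tmul φ a =>
    rw [evTen_tmul, map_smul]
    exact Algebra.TensorProduct.lift_tmul _ _ (fun _ _ => Commute.all _ _) _ _

theorem evTen_algebraMap (x : N) (s : Smooth d N) (z : Smooth d N ⊗[ℂ] A) :
    evTen x (algebraMap (Smooth d N) _ s * z) = s.1 x • evTen x z := by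
  rw [evTen_mul, Algebra.TensorProduct.algebraMap_apply, evTen_tmul, smul_mul_assoc]
  simp

end Algebra

end Evaluation

/-! ### Locally split modules -/

section LocallySplit

variable {d : ℕ} {M : Type w} [TopologicalSpace M] [ChartedSpace (EuclideanSpace ℝ (Fin d)) M]
  {U : Opens M} {V : Type*} [AddCommGroup V] [Module ℂ V]
  {X : Type*} [AddCommGroup X] [Module (Smooth d M) X]

/-- An `S(M)`-linear map `p : X → S(U) ⊗ V` identifies the elements of `X` which are compactly
supported in `U` with compactly supported functions with values in `V`. -/
structure IsLocallySplit (p : X →ₗ[Smooth d M] Smooth d U ⊗[ℂ] V) : Prop where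
  range : ∀ h : Smooth d M, tsupport h.1 ⊆ U → ∀ z, ∃ b, p b = h • z
  injective : ∀ h : Smooth d M, tsupport h.1 ⊆ U → ∀ b, p b = 0 → h • b = 0

/-- After multiplication by a cutoff, a local coefficient becomes a global function, so
`S(M)`-linearity applies to it. -/
theorem smul_tmul_eq (h : Smooth d M) (hU : tsupport h.1 ⊆ U) (φ : Smooth d U) (v : V) :
    h • (φ ⊗ₜ[ℂ] v) = extendBy h hU φ • ((1 : Smooth d U) ⊗ₜ[ℂ] v) := by
  rw [TensorProduct.smul_tmul', TensorProduct.smul_tmul', ← restr_extendBy h hU]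
  congr 1
  exact (mul_one _).symm

variable [T2Space M] [CompactSpace M] [IsManifold (𝓡 d) ∞ M]
  {p : X →ₗ[Smooth d M] Smooth d U ⊗[ℂ] V}

namespace IsLocallySplit

/-- A locally split map has a partial inverse for every cutoff function. -/
theorem exists_section (hp : IsLocallySplit p) (h : Smooth d M) (hU : tsupport h.1 ⊆ U) :
    ∃ s : Smooth d U ⊗[ℂ] V →ₗ[Smooth d M] X,
      (∀ z, p (s z) = h • z) ∧ ∀ b, s (p b) = h • b := by
  -- Preimages of `h • z` are unique only up to the kernel of `p`. A second cutoff, equal to one on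
  -- the support of `h`, kills the ambiguity without changing `h • z`; this makes the choice linear.
  obtain ⟨h', hU', h1⟩ := exists_bump (d := d) U (tsupport h.1) (isClosed_tsupport _) hU
  have hh : h' * h = h := smooth_ext fun x => by
    by_cases hx : x ∈ tsupport h.1
    · rw [smooth_mul_apply, h1 x hx, one_mul]
    · rw [smooth_mul_apply, image_eq_zero_of_notMem_tsupport hx, mul_zero]
  choose f hf using hp.range h hU
  have key : ∀ b z, p b = h • z → h' • b = h' • f z := fun b z hb => by
    rw [← sub_eq_zero, ← smul_sub]
    exact hp.injective h' hU' _ (by rw [map_sub, hb, hf, sub_self])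
  refine ⟨{ toFun := fun z => h' • f z, map_add' := fun z w => ?_, map_smul' := fun g z => ?_ },
    fun z => ?_, fun b => ?_⟩
  · rw [← smul_add]
    exact (key _ _ (by rw [map_add, hf, hf, smul_add])).symm
  · rw [RingHom.id_apply, smul_comm]
    exact (key _ _ (by rw [map_smul, hf, smul_comm])).symm
  · change p (h' • f z) = _
    rw [map_smul, hf, smul_smul, hh]
  · change h' • f (p b) = _
    rw [← key (h • b) (p b) (map_smul _ _ _), smul_smul, hh]

theorem surjective (hp : IsLocallySplit p) (x : U) (v : V) : ∃ b, evTen x (p b) = v := by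
  obtain ⟨h, hU, h1⟩ := exists_bump_point (d := d) U x
  obtain ⟨b, hb⟩ := hp.range h hU (1 ⊗ₜ v)
  exact ⟨b, by simp [hb, evTen_smul, h1]⟩

/-- A map which is `S(M)`-linear for the action of `S(M)` by evaluation at `x` factors through the
fiber at `x`. -/
theorem exists_factor (hp : IsLocallySplit p) (x : U) {W : Type*} [AddCommGroup W] [Module ℂ W]
    (L : X →+ W) (hL : ∀ (f : Smooth d M) b, L (f • b) = f.1 x.1 • L b) :
    ∃ T : V →ₗ[ℂ] W, ∀ b, L b = T (evTen x (p b)) := by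
  obtain ⟨h, hU, h1⟩ := exists_bump_point (d := d) U x
  obtain ⟨s, hs, hs'⟩ := hp.exists_section h hU
  -- Lift the constant function with value `v`.
  let T : V →ₗ[ℂ] W :=
    { toFun := fun v => L (s (1 ⊗ₜ v))
      map_add' := fun v v' => by rw [TensorProduct.tmul_add, map_add, map_add]
      map_smul' := fun c v => by
        have : (1 : Smooth d U) ⊗ₜ[ℂ] (c • v) =
            algebraMap ℂ (Smooth d M) c • ((1 : Smooth d U) ⊗ₜ[ℂ] v) := by
          rw [algebraMap_smul, TensorProduct.tmul_smul]
        rw [this, map_smul, hL]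
        rfl }
  have key : ∀ z, L (s z) = T (evTen x z) := fun z => by
    induction z with
    | zero => simp
    | add z w hz hw => simp only [map_add, hz, hw]
    | tmul φ v =>
      -- At `x` the cutoff `h` is one, so inserting it changes nothing after `L`, while it turns the
      -- local coefficient `φ` into the global function `hφ`.
      have h2 := hL h (s (φ ⊗ₜ v))
      rw [h1, one_smul, ← map_smul, smul_tmul_eq h hU, map_smul, hL, extendBy_apply, h1,
        one_mul] at h2
      rw [← h2, evTen_tmul, map_smul]
      rfl
  refine ⟨T, fun b => ?_⟩
  rw [← key, hs', hL, h1, one_smul]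

end IsLocallySplit

end LocallySplit

/-! ### Tensor products of locally split modules -/

section TensorLocal

open TrivializationSystem

variable {G : CompactMatrixQuantumGroup.{v}} {d : ℕ} {M : Type w} [TopologicalSpace M]
  [ChartedSpace (EuclideanSpace ℝ (Fin d)) M] {U : Opens M}
  {X Y : Type*} [AddCommGroup X] [Module (Smooth d M) X] [AddCommGroup Y] [Module (Smooth d M) Y]

theorem evTen_tensorLocal_tmul (p : X →ₗ[Smooth d M] Smooth d U ⊗[ℂ] G.A)
    (q : Y →ₗ[Smooth d M] Smooth d U ⊗[ℂ] G.A) (x : U) (b : X) (c : Y) :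
    evTen x (tensorLocal p q (b ⊗ₜ c)) = evTen x (p b) ⊗ₜ evTen x (q c) := by
  have h1 : ∀ z : Smooth d U ⊗[ℂ] G.A, evTen x (Algebra.TensorProduct.map
      (AlgHom.id (Smooth d M) (Smooth d U))
      (Algebra.TensorProduct.includeLeft : G.A →ₐ[ℂ] G.A ⊗[ℂ] G.A) z) =
      evTen x z ⊗ₜ[ℂ] (1 : G.A) := fun z => by
    induction z with
    | zero => simp
    | add z w hz hw => simp only [map_add, TensorProduct.add_tmul, hz, hw]
    | tmul φ a => simp [TensorProduct.smul_tmul']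
  have h2 : ∀ z : Smooth d U ⊗[ℂ] G.A, evTen x (Algebra.TensorProduct.map
      (AlgHom.id (Smooth d M) (Smooth d U))
      (Algebra.TensorProduct.includeRight : G.A →ₐ[ℂ] G.A ⊗[ℂ] G.A) z) =
      (1 : G.A) ⊗ₜ[ℂ] evTen x z := fun z => by
    induction z with
    | zero => simp
    | add z w hz hw => simp only [map_add, TensorProduct.tmul_add, hz, hw]
    | tmul φ a => simp
  refine (evTen_mul x _ _).trans ((congrArg₂ (· * ·) (h1 _) (h2 _)).trans ?_)
  simp

/-- Partial inverses of two locally split maps give a partial inverse of their tensor product. -/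
theorem exists_tensor_section (s : Smooth d U ⊗[ℂ] G.A →ₗ[Smooth d M] X)
    (s' : Smooth d U ⊗[ℂ] G.A →ₗ[Smooth d M] Y) :
    ∃ σ : Smooth d U ⊗[ℂ] (G.A ⊗[ℂ] G.A) →ₗ[Smooth d M] X ⊗[Smooth d M] Y,
      ∀ φ a a', σ (φ ⊗ₜ (a ⊗ₜ a')) = s (φ ⊗ₜ a) ⊗ₜ s' (1 ⊗ₜ a') := by
  -- Scalars act through the constants in `S(M)`. This allows a lift from `S(U) ⊗ A ⊗ A`, with all
  -- function coefficients placed in the first factor.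
  let _ : Module ℂ (X ⊗[Smooth d M] Y) := Module.compHom _ (algebraMap ℂ (Smooth d M))
  have : IsScalarTower ℂ (Smooth d M) (X ⊗[Smooth d M] Y) := ⟨fun c f t => by
    rw [Algebra.smul_def, mul_smul]
    rfl⟩
  have : SMulCommClass ℂ (Smooth d M) (X ⊗[Smooth d M] Y) := ⟨fun c f t =>
    smul_comm (algebraMap ℂ (Smooth d M) c) f t⟩
  have hs' : ∀ (c : ℂ) a', s' ((1 : Smooth d U) ⊗ₜ[ℂ] (c • a')) =
      algebraMap ℂ (Smooth d M) c • s' (1 ⊗ₜ a') := fun c a' => by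
    rw [← map_smul, algebraMap_smul, TensorProduct.tmul_smul]
  let β : Smooth d U ⊗[ℂ] G.A →ₗ[Smooth d M] G.A →ₗ[ℂ] X ⊗[Smooth d M] Y :=
    { toFun := fun z =>
        { toFun := fun a' => s z ⊗ₜ s' (1 ⊗ₜ a')
          map_add' := fun a a' => by rw [TensorProduct.tmul_add, map_add, TensorProduct.tmul_add]
          map_smul' := fun c a' => by
            rw [hs', TensorProduct.tmul_smul]
            rfl }
      map_add' := fun z w => LinearMap.ext fun a' => by
        change s (z + w) ⊗ₜ[Smooth d M] s' (1 ⊗ₜ a') =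
          s z ⊗ₜ[Smooth d M] s' (1 ⊗ₜ a') + s w ⊗ₜ[Smooth d M] s' (1 ⊗ₜ a')
        rw [map_add, TensorProduct.add_tmul]
      map_smul' := fun f z => LinearMap.ext fun a' => by
        change s (f • z) ⊗ₜ[Smooth d M] s' (1 ⊗ₜ a') = f • (s z ⊗ₜ[Smooth d M] s' (1 ⊗ₜ a'))
        rw [map_smul, TensorProduct.smul_tmul'] }
  refine ⟨TensorProduct.AlgebraTensorModule.lift β ∘ₗ
    (TensorProduct.AlgebraTensorModule.assoc ℂ ℂ (Smooth d M) (Smooth d U) G.A G.A).symm.toLinearMap,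
    fun φ a a' => rfl⟩

/-- Each of the two partial inverses contributes a factor `h`. The third is spent on moving a local
coefficient from the second leg to the first, which is possible only for global functions. -/
theorem smul_section_tensorLocal {p : X →ₗ[Smooth d M] Smooth d U ⊗[ℂ] G.A}
    {q : Y →ₗ[Smooth d M] Smooth d U ⊗[ℂ] G.A}
    {s : Smooth d U ⊗[ℂ] G.A →ₗ[Smooth d M] X} {s' : Smooth d U ⊗[ℂ] G.A →ₗ[Smooth d M] Y}
    {σ : Smooth d U ⊗[ℂ] (G.A ⊗[ℂ] G.A) →ₗ[Smooth d M] X ⊗[Smooth d M] Y}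
    (hσ : ∀ φ a a', σ (φ ⊗ₜ (a ⊗ₜ a')) = s (φ ⊗ₜ a) ⊗ₜ s' (1 ⊗ₜ a'))
    (h : Smooth d M) (hU : tsupport h.1 ⊆ U) (hs : ∀ b, s (p b) = h • b)
    (hs' : ∀ b, s' (q b) = h • b) (t : X ⊗[Smooth d M] Y) :
    h • σ (tensorLocal p q t) = (h * (h * h)) • t := by
  have key : ∀ z w : Smooth d U ⊗[ℂ] G.A,
      h • σ (Algebra.TensorProduct.map (AlgHom.id (Smooth d M) (Smooth d U))
        (Algebra.TensorProduct.includeLeft : G.A →ₐ[ℂ] G.A ⊗[ℂ] G.A) z *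
        Algebra.TensorProduct.map (AlgHom.id (Smooth d M) (Smooth d U))
        (Algebra.TensorProduct.includeRight : G.A →ₐ[ℂ] G.A ⊗[ℂ] G.A) w) =
      h • (s z ⊗ₜ s' w) := by
    intro z w
    induction z with
    | zero => simp
    | add z z' hz hz' =>
      simp only [add_mul, smul_add, map_add, hz, hz', TensorProduct.add_tmul]
    | tmul φ a =>
      induction w with
      | zero => simp
      | add w w' hw hw' =>
        simp only [mul_add, smul_add, map_add, hw, hw', TensorProduct.tmul_add]
      | tmul φ' a' =>
        have h1 : Algebra.TensorProduct.map (AlgHom.id (Smooth d M) (Smooth d U))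
            (Algebra.TensorProduct.includeLeft : G.A →ₐ[ℂ] G.A ⊗[ℂ] G.A) (φ ⊗ₜ a) *
            Algebra.TensorProduct.map (AlgHom.id (Smooth d M) (Smooth d U))
            (Algebra.TensorProduct.includeRight : G.A →ₐ[ℂ] G.A ⊗[ℂ] G.A) (φ' ⊗ₜ a') =
            (φ * φ') ⊗ₜ (a ⊗ₜ a') := by simp
        have h2 : h • ((φ * φ') ⊗ₜ[ℂ] a) = extendBy h hU φ' • (φ ⊗ₜ[ℂ] a) := by
          rw [TensorProduct.smul_tmul', TensorProduct.smul_tmul', mul_comm, ← smul_mul_assoc,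
            ← restr_extendBy h hU]
          rfl
        rw [h1, hσ, TensorProduct.smul_tmul', ← map_smul, h2, map_smul, TensorProduct.smul_tmul,
          ← map_smul, ← smul_tmul_eq h hU, map_smul, TensorProduct.tmul_smul]
  induction t with
  | zero => simp
  | add t t' ht ht' => simp only [map_add, smul_add, ht, ht']
  | tmul b c =>
    refine (key (p b) (q c)).trans ?_
    rw [hs, hs', TensorProduct.tmul_smul, ← TensorProduct.smul_tmul', smul_smul, smul_smul,
      mul_assoc]

/-- Here `T` and `T'` are the changes of trivialization at `x`. The formula lets a local inverse
over `U` be read in another trivialization. -/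
theorem evTen_tensorLocal_section {U' : Opens M} {p : X →ₗ[Smooth d M] Smooth d U ⊗[ℂ] G.A}
    {q : Y →ₗ[Smooth d M] Smooth d U ⊗[ℂ] G.A}
    {p' : X →ₗ[Smooth d M] Smooth d U' ⊗[ℂ] G.A}
    {q' : Y →ₗ[Smooth d M] Smooth d U' ⊗[ℂ] G.A}
    {s : Smooth d U ⊗[ℂ] G.A →ₗ[Smooth d M] X} {s' : Smooth d U ⊗[ℂ] G.A →ₗ[Smooth d M] Y}
    {σ : Smooth d U ⊗[ℂ] (G.A ⊗[ℂ] G.A) →ₗ[Smooth d M] X ⊗[Smooth d M] Y}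
    (hσ : ∀ φ a a', σ (φ ⊗ₜ (a ⊗ₜ a')) = s (φ ⊗ₜ a) ⊗ₜ s' (1 ⊗ₜ a'))
    (h : Smooth d M) (hs : ∀ z, p (s z) = h • z) (hs' : ∀ z, q (s' z) = h • z)
    {x : M} (hx : x ∈ U) (hx' : x ∈ U') {T T' : G.A →ₗ[ℂ] G.A}
    (hT : ∀ b, evTen (⟨x, hx'⟩ : U') (p' b) = T (evTen (⟨x, hx⟩ : U) (p b)))
    (hT' : ∀ b, evTen (⟨x, hx'⟩ : U') (q' b) = T' (evTen (⟨x, hx⟩ : U) (q b)))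
    (u : Smooth d U ⊗[ℂ] (G.A ⊗[ℂ] G.A)) :
    evTen (⟨x, hx'⟩ : U') (tensorLocal p' q' (σ u)) =
      (h.1 x * h.1 x) • TensorProduct.map T T' (evTen (⟨x, hx⟩ : U) u) := by
  induction u with
  | zero => simp
  | add t t' ht ht' => simp only [map_add, smul_add, ht, ht']
  | tmul φ c =>
    induction c with
    | zero => simp
    | add t t' ht ht' => simp only [map_add, smul_add, TensorProduct.tmul_add, ht, ht']
    | tmul a a' =>
      rw [hσ, evTen_tensorLocal_tmul, hT, hT', hs, hs', evTen_smul, evTen_smul]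
      simp only [evTen_tmul, map_smul, TensorProduct.map_tmul, smooth_one_apply, one_smul,
        TensorProduct.tmul_smul, ← TensorProduct.smul_tmul', smul_smul]
      congr 1
      ring

variable [T2Space M] [CompactSpace M] [IsManifold (𝓡 d) ∞ M]
  {m : ℕ} {𝒰 : Fin m → Opens M}
  {p : ∀ k, X →ₗ[Smooth d M] Smooth d (𝒰 k) ⊗[ℂ] G.A}
  {q : ∀ k, Y →ₗ[Smooth d M] Smooth d (𝒰 k) ⊗[ℂ] G.A}

/-- Since `h k` is one on the support of `c k`, the weight `c k` absorbs every power of `h k`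
produced by the partial inverses. -/
theorem exists_cutoff (hcover : ∀ x, ∃ k, x ∈ 𝒰 k) : ∃ c h : Fin m → Smooth d M, (∀ k, tsupport (c k).1 ⊆ 𝒰 k) ∧
    (∀ k, tsupport (h k).1 ⊆ 𝒰 k) ∧ (∀ k, c k * h k = c k) ∧ ∑ k, c k = 1 := by
  obtain ⟨c, hc, hs⟩ := exists_partition (d := d) 𝒰 hcover
  choose h hU h1 using fun k =>
    exists_bump (d := d) (𝒰 k) (tsupport (c k).1) (isClosed_tsupport _) (hc k)
  refine ⟨c, h, hc, hU, fun k => smooth_ext fun x => ?_, hs⟩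
  by_cases hx : x ∈ tsupport (c k).1
  · rw [smooth_mul_apply, h1 k x hx, mul_one]
  · rw [smooth_mul_apply, image_eq_zero_of_notMem_tsupport hx, zero_mul]

/-- An element of `X ⊗ Y` is determined by its local representations. -/
theorem eq_zero_of_tensorLocal (hcover : ∀ x, ∃ k, x ∈ 𝒰 k) (hp : ∀ k, IsLocallySplit (p k))
    (hq : ∀ k, IsLocallySplit (q k))
    (t : X ⊗[Smooth d M] Y) (ht : ∀ k, tensorLocal (p k) (q k) t = 0) : t = 0 := by
  obtain ⟨c, h, -, hU, hch, hc1⟩ := exists_cutoff (d := d) hcover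
  rw [← one_smul (Smooth d M) t, ← hc1, Finset.sum_smul]
  refine Finset.sum_eq_zero fun k _ => ?_
  obtain ⟨s, -, hs⟩ := (hp k).exists_section (h k) (hU k)
  obtain ⟨s', -, hs'⟩ := (hq k).exists_section (h k) (hU k)
  obtain ⟨σ, hσ⟩ := exists_tensor_section s s'
  have h1 := smul_section_tensorLocal hσ (h k) (hU k) hs hs' t
  rw [ht, map_zero, smul_zero] at h1
  have h2 : c k = c k * (h k * (h k * h k)) := by rw [← mul_assoc, ← mul_assoc, hch, hch, hch]
  rw [h2, mul_smul, ← h1, smul_zero]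

/-- Compatible local data glue to a map with values in `X ⊗ Y`. -/
theorem exists_tensorLocal_eq (hcover : ∀ x, ∃ k, x ∈ 𝒰 k) (hp : ∀ k, IsLocallySplit (p k))
    (hq : ∀ k, IsLocallySplit (q k))
    {Z : Type*} [AddCommGroup Z] [Module (Smooth d M) Z]
    (r : ∀ k, Z →ₗ[Smooth d M] Smooth d (𝒰 k) ⊗[ℂ] (G.A ⊗[ℂ] G.A))
    (hr : ∀ k l x (hk : x ∈ 𝒰 k) (hl : x ∈ 𝒰 l), ∃ T T' : G.A →ₗ[ℂ] G.A,
      (∀ b, evTen (⟨x, hl⟩ : 𝒰 l) (p l b) = T (evTen (⟨x, hk⟩ : 𝒰 k) (p k b))) ∧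
      (∀ b, evTen (⟨x, hl⟩ : 𝒰 l) (q l b) = T' (evTen (⟨x, hk⟩ : 𝒰 k) (q k b))) ∧
      ∀ z, evTen (⟨x, hl⟩ : 𝒰 l) (r l z) =
        TensorProduct.map T T' (evTen (⟨x, hk⟩ : 𝒰 k) (r k z))) :
    ∃ Λ : Z →ₗ[Smooth d M] X ⊗[Smooth d M] Y, ∀ k z, tensorLocal (p k) (q k) (Λ z) = r k z := by
  obtain ⟨c, h, hc, hU, hch, hc1⟩ := exists_cutoff (d := d) hcover
  choose s hs _ using fun k => (hp k).exists_section (h k) (hU k)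
  choose s' hs' _ using fun k => (hq k).exists_section (h k) (hU k)
  choose σ hσ using fun k => exists_tensor_section (s k) (s' k)
  -- By compatibility, the `k`-th term read in the `l`-th trivialization already equals `c k` times
  -- the prescribed value, and the weights sum to one.
  refine ⟨∑ k, c k • (σ k ∘ₗ r k), fun l z => evTen_ext fun x => ?_⟩
  have h1 : ∀ k, evTen x (tensorLocal (p l) (q l) (c k • σ k (r k z))) =
      (c k).1 x.1 • evTen x (r l z) := fun k => by
    rw [map_smul, evTen_smul]
    by_cases hx : x.1 ∈ 𝒰 k
    · obtain ⟨T, T', hT, hT', hTr⟩ := hr k l x.1 hx x.2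
      rw [evTen_tensorLocal_section (hσ k) (h k) (hs k) (hs' k) hx x.2 hT hT', ← hTr, smul_smul]
      congr 1
      rw [← mul_assoc]
      exact congrArg (fun f : Smooth d M => f.1 x.1)
        (show c k * h k * h k = c k by rw [hch, hch])
    · rw [image_eq_zero_of_notMem_tsupport fun h' => hx (hc k h'), zero_smul, zero_smul]
  simp only [LinearMap.sum_apply, LinearMap.smul_apply, LinearMap.comp_apply, map_sum, h1]
  rw [← Finset.sum_smul, ← smooth_sum_apply, hc1, smooth_one_apply, one_smul]

end TensorLocal

/-! ### Fibers of quantum principal bundles -/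

section Fiber

open Coalgebra

variable {G : CompactMatrixQuantumGroup.{v}} {d : ℕ}

/-- Evaluation at a point as a `*`-homomorphism. -/
def evStar {N : Type w} [TopologicalSpace N] [ChartedSpace (EuclideanSpace ℝ (Fin d)) N] (x : N) :
    Smooth d N ⊗[ℂ] G.A →⋆ₐ[ℂ] G.A where
  toFun := evTen x
  map_one' := evTen_one x
  map_mul' := evTen_mul x
  map_zero' := map_zero _
  map_add' := map_add _
  commutes' c := by
    rw [Algebra.TensorProduct.algebraMap_apply, evTen_tmul, Algebra.algebraMap_eq_smul_one]
    simp [Algebra.algebraMap_eq_smul_one]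
  map_star' := evTen_star x

/-- The character of `A` given by the values of a `*`-homomorphism `A → S(N)` at a point. -/
def pointChar {N : Type w} [TopologicalSpace N] [ChartedSpace (EuclideanSpace ℝ (Fin d)) N]
    (g : G.A →⋆ₐ[ℂ] Smooth d N) (x : N) : G.Cl := (evalAt d x).comp g

@[simp] theorem pointChar_apply {N : Type w} [TopologicalSpace N]
    [ChartedSpace (EuclideanSpace ℝ (Fin d)) N] (g : G.A →⋆ₐ[ℂ] Smooth d N) (x : N) (a : G.A) :
    pointChar g x a = (g a).1 x := rfl

/-- A smooth family of characters defines a `*`-homomorphism `A → S(N)`. -/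
def smoothHom {N : Type w} [TopologicalSpace N] [ChartedSpace (EuclideanSpace ℝ (Fin d)) N]
    (χ : N → G.Cl) (hχ : ∀ a, ContMDiff (𝓡 d) 𝓘(ℝ, ℂ) ∞ fun x => χ x a) :
    G.A →⋆ₐ[ℂ] Smooth d N where
  toFun a := ⟨fun x => χ x a, hχ a⟩
  map_one' := smooth_ext fun x => map_one (χ x)
  map_mul' a b := smooth_ext fun x => map_mul (χ x) a b
  map_zero' := smooth_ext fun x => map_zero (χ x)
  map_add' a b := smooth_ext fun x => map_add (χ x) a b
  commutes' c := smooth_ext fun x => AlgHomClass.commutes (χ x) c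
  map_star' a := smooth_ext fun x => map_star (χ x) a

theorem evTen_mapLeft {N : Type w} [TopologicalSpace N]
    [ChartedSpace (EuclideanSpace ℝ (Fin d)) N] (g : G.A →ₐ[ℂ] Smooth d N) (χ : G.A →ₗ[ℂ] ℂ) (x : N)
    (h : ∀ a, (g a).1 x = χ a) (t : G.A ⊗[ℂ] G.A) :
    evTen x (mapLeft G.A g t) = TensorProduct.lid ℂ G.A (χ.rTensor G.A t) := by
  induction t with
  | zero => simp
  | add t t' ht ht' => simp only [map_add, ht, ht']
  | tmul a a' => simp [h]

theorem evTen_psi {N : Type w} [TopologicalSpace N] [ChartedSpace (EuclideanSpace ℝ (Fin d)) N]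
    (g : G.A →⋆ₐ[ℂ] Smooth d N) (x : N) (z : Smooth d N ⊗[ℂ] G.A) :
    evTen x (psi g z) = lam (pointChar g x).lin (evTen x z) := by
  induction z with
  | zero => simp
  | add t t' ht ht' => simp only [map_add, ht, ht']
  | tmul φ a =>
    rw [psi_tmul, evTen_algebraMap, evTen_mapLeft g.toAlgHom (pointChar g x).lin x fun _ => rfl,
      evTen_tmul, map_smul, lam_apply]

theorem evTen_xi {N : Type w} [TopologicalSpace N] [ChartedSpace (EuclideanSpace ℝ (Fin d)) N]
    (g : G.A →⋆ₐ[ℂ] Smooth d N) (x : N) (z : Smooth d N ⊗[ℂ] G.A) :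
    evTen x (xi g z) = ad (pointChar g x) (evTen x z) := by
  have h : ∀ t : G.A ⊗[ℂ] G.A, evTen x (Algebra.TensorProduct.lift (mapLeft G.A (compAntipode g))
      (((Algebra.ofId (Smooth d N) (Smooth d N ⊗[ℂ] G.A)).restrictScalars ℂ).comp g.toAlgHom)
      (fun _ b => Algebra.commute_algebraMap_right (g b) _)
      (mapLeft G.A (Bialgebra.comulAlgHom ℂ G.A) t)) =
      lam (pointChar g x).inv.lin
        (TensorProduct.rid ℂ G.A ((pointChar g x).lin.lTensor G.A t)) := fun t => by
    induction t with
    | zero => simp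
    | add t t' ht ht' => simp only [map_add, ht, ht']
    | tmul a a' =>
      have h4 : ∀ x y, Algebra.TensorProduct.lift (mapLeft G.A (compAntipode g))
          (((Algebra.ofId (Smooth d N) (Smooth d N ⊗[ℂ] G.A)).restrictScalars ℂ).comp g.toAlgHom)
          (fun _ b => Algebra.commute_algebraMap_right (g b) _) (x ⊗ₜ y) =
          mapLeft G.A (compAntipode g) x * algebraMap (Smooth d N) (Smooth d N ⊗[ℂ] G.A) (g y) :=
        fun _ _ => Algebra.TensorProduct.lift_tmul _ _ _ _ _
      refine (congrArg (evTen x) ((h4 (comul a) a').trans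
        (Algebra.commute_algebraMap_right (g a') _).eq)).trans ?_
      rw [evTen_algebraMap,
        evTen_mapLeft (compAntipode g) (pointChar g x).inv.lin x fun _ => rfl]
      simp [lam_apply]
  induction z with
  | zero => simp
  | add t t' ht ht' => simp only [map_add, ht, ht']
  | tmul φ a =>
    rw [xi_tmul, evTen_algebraMap, evTen_tmul, map_smul, ad_apply, rho_apply]
    exact congrArg _ (h _)

variable {M : Type w} [TopologicalSpace M]
  [ChartedSpace (EuclideanSpace ℝ (Fin d)) M] {P : QuantumPrincipalBundle.{v, w, y} G d M}
  {U : Opens M} {π : P.B →⋆ₐ[ℂ] Smooth d U ⊗[ℂ] G.A}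

/-- The value of a local trivialization at a point. -/
def fiber (π : P.B →⋆ₐ[ℂ] Smooth d U ⊗[ℂ] G.A) (x : U) : P.B →⋆ₐ[ℂ] G.A := (evStar x).comp π

theorem fiber_apply (π : P.B →⋆ₐ[ℂ] Smooth d U ⊗[ℂ] G.A) (x : U) (b : P.B) :
    fiber π x b = evTen x (π b) := rfl

theorem localPoint_apply (π : P.B →⋆ₐ[ℂ] Smooth d U ⊗[ℂ] G.A) (x : U) (χ : G.Cl) (b : P.B) :
    QuantumPrincipalBundle.localPoint π x χ b = χ (fiber π x b) := evTen_starLift _ _ _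

namespace IsLocalTrivialization

/-- A local trivialization as an `S(M)`-linear map. -/
def linear (hπ : IsLocalTrivialization P.i P.F U π) :
    P.B →ₗ[Smooth d M] Smooth d U ⊗[ℂ] G.A where
  toFun := π
  map_add' := map_add _
  map_smul' f b := by
    change π (P.i f * b) = f • π b
    rw [map_mul, hπ.base, Algebra.smul_def]
    rfl

theorem fiber_smul (hπ : IsLocalTrivialization P.i P.F U π) (x : U) (f : Smooth d M) (b : P.B) :
    fiber π x (f • b) = f.1 x.1 • fiber π x b :=
  (congrArg (evTen x) (hπ.linear.map_smul f b)).trans (evTen_smul _ _ _)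

theorem fiber_base (hπ : IsLocalTrivialization P.i P.F U π) (x : U) (f : Smooth d M) :
    fiber π x (P.i f) = algebraMap ℂ _ (f.1 x.1) := by
  rw [fiber_apply, hπ.base, evTen_tmul, Algebra.algebraMap_eq_smul_one]
  rfl

theorem comul_fiber (hπ : IsLocalTrivialization P.i P.F U π) (x : U) (b : P.B) :
    comul (R := ℂ) (fiber π x b) =
      (fiber π x).toAlgHom.toLinearMap.rTensor G.A (P.F b) := by
  rw [fiber_apply, ← evTen_lTensor, hπ.equivariant]
  generalize P.F b = t
  induction t with
  | zero => simp
  | add t t' ht ht' => simp only [map_add, ht, ht']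
  | tmul c a =>
    simp only [LinearMap.rTensor_tmul]
    change evTen x (TensorProduct.assoc ℂ _ G.A G.A (π c ⊗ₜ a)) = evTen x (π c) ⊗ₜ a
    generalize π c = z
    induction z with
    | zero => simp
    | add t t' ht ht' => simp only [TensorProduct.add_tmul, map_add, ht, ht']
    | tmul φ a' => simp [TensorProduct.smul_tmul']

variable [T2Space M] [CompactSpace M]

/-- Compactness of `M` supplies the compact supports demanded by `range` and `injective`; finite
sums extend the range condition from simple tensors to all `z`. -/
theorem isLocallySplit (hπ : IsLocalTrivialization P.i P.F U π) : IsLocallySplit hπ.linear where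
  range h hU z := by
    induction z with
    | zero => exact ⟨0, by simp⟩
    | add z w hz hw =>
      obtain ⟨b, hb⟩ := hz
      obtain ⟨c, hc⟩ := hw
      exact ⟨b + c, by rw [map_add, hb, hc, smul_add]⟩
    | tmul φ a =>
      obtain ⟨b, hb⟩ := hπ.range _ (hasCompactSupport_restr_mul h hU φ) a
      exact ⟨b, hb⟩
  injective h hU b hb := by
    refine hπ.injective h (isClosed_tsupport _).isCompact hU b ?_
    have := hπ.linear.map_smul h b
    rw [hb, smul_zero] at this
    exact this

variable [IsManifold (𝓡 d) ∞ M]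

theorem fiber_surjective (hπ : IsLocalTrivialization P.i P.F U π) (x : U) (a : G.A) :
    ∃ b, fiber π x b = a := hπ.isLocallySplit.surjective x a

/-- A `*`-homomorphism which maps functions on `M` to their values at `x` factors through the fiber
at `x`. -/
theorem exists_factor (hπ : IsLocalTrivialization P.i P.F U π) (x : U) {C : Type*} [Ring C]
    [StarRing C] [Algebra ℂ C] (L : P.B →⋆ₐ[ℂ] C)
    (hL : ∀ f, L (P.i f) = algebraMap ℂ C (f.1 x.1)) :
    ∃ T : G.A →⋆ₐ[ℂ] C, ∀ b, L b = T (fiber π x b) := by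
  obtain ⟨T, hT⟩ := hπ.isLocallySplit.exists_factor x L.toAlgHom.toLinearMap.toAddMonoidHom
    fun f b => by
      change L (P.i f * b) = f.1 x.1 • L b
      rw [map_mul, hL, Algebra.smul_def]
  replace hT : ∀ b, L b = T (fiber π x b) := hT
  -- The algebraic laws pass from `L` to `T` because the fiber map is surjective.
  refine ⟨{ T with
    map_one' := ?_, map_mul' := ?_, map_zero' := T.map_zero, commutes' := ?_, map_star' := ?_ },
    hT⟩
  · change T 1 = 1
    rw [← map_one (fiber π x), ← hT, map_one]
  · intro a b
    change T (a * b) = T a * T b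
    obtain ⟨a, rfl⟩ := hπ.fiber_surjective x a
    obtain ⟨b, rfl⟩ := hπ.fiber_surjective x b
    rw [← map_mul, ← hT, ← hT, ← hT, map_mul]
  · intro c
    change T (algebraMap ℂ _ c) = algebraMap ℂ _ c
    have : fiber π x (algebraMap ℂ _ c) = algebraMap ℂ _ c := AlgHomClass.commutes _ c
    rw [← this, ← hT]
    exact AlgHomClass.commutes _ c
  · intro a
    change T (star a) = star (T a)
    obtain ⟨a, rfl⟩ := hπ.fiber_surjective x a
    rw [← map_star, ← hT, ← hT, map_star]

/-- A right covariant `*`-homomorphism `B → A` over the point `x` is the composition of the fiber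
map with the translation by a character. -/
theorem exists_lam (hπ : IsLocalTrivialization P.i P.F U π) (x : U) (L : P.B →⋆ₐ[ℂ] G.A)
    (hL : ∀ f, L (P.i f) = algebraMap ℂ G.A (f.1 x.1))
    (hc : ∀ b, comul (R := ℂ) (L b) = L.toAlgHom.toLinearMap.rTensor G.A (P.F b)) :
    ∃ χ : G.Cl, ∀ b, L b = lam χ.lin (fiber π x b) := by
  obtain ⟨T, hT⟩ := hπ.exists_factor x L hL
  -- The factor `T` is right colinear, so it is the translation by `ε ∘ T`, a character because `T`
  -- is a `*`-homomorphism.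
  refine ⟨(CompactMatrixQuantumGroup.Cl.one G).comp T, fun b => ?_⟩
  rw [hT]
  refine eq_lam T.toAlgHom.toLinearMap (fun a => ?_) _
  obtain ⟨a, rfl⟩ := hπ.fiber_surjective x a
  change comul (R := ℂ) (T _) = _
  rw [← hT, hc, hπ.comul_fiber, ← LinearMap.comp_apply, ← LinearMap.rTensor_comp]
  congr 2
  exact LinearMap.ext hT

theorem lam_unique (hπ : IsLocalTrivialization P.i P.F U π) (x : U) {χ θ : G.Cl}
    (h : ∀ b, lam χ.lin (fiber π x b) = lam θ.lin (fiber π x b)) : χ = θ := by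
  refine StarAlgHom.ext fun a => ?_
  obtain ⟨b, rfl⟩ := hπ.fiber_surjective x a
  have := congrArg (counit (R := ℂ)) (h b)
  rwa [counit_lam, counit_lam] at this

/-- Smoothness of a family of characters can be tested on the elements of `B`. -/
theorem contMDiff_char (hπ : IsLocalTrivialization P.i P.F U π) {W : Opens M} (hW : W ≤ U)
    (χ : W → G.Cl) (hχ : ∀ b, ContMDiff (𝓡 d) 𝓘(ℝ, ℂ) ∞
      fun x => χ x (fiber π (Set.inclusion hW x) b)) (a : G.A) :
    ContMDiff (𝓡 d) 𝓘(ℝ, ℂ) ∞ fun x => χ x a := by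
  intro x
  obtain ⟨h, hU, h1⟩ := exists_bump_nhds (d := d) U (Set.inclusion hW x)
  -- This `b` has the constant value `a` in the fibers near `x`, so the function at `a` agrees there
  -- with one assumed smooth.
  obtain ⟨b, hb⟩ := hπ.isLocallySplit.range h hU (1 ⊗ₜ a)
  refine (hχ b x).congr_of_eventuallyEq ?_
  have h2 : ∀ᶠ y : W in nhds x, h.1 y.1 = 1 := 
    (continuous_subtype_val (p := fun y => y ∈ W)).continuousAt.eventually h1
  filter_upwards [h2] with y hy
  have hb' : fiber π (Set.inclusion hW y) b = a := by
    refine (congrArg (evTen _) hb).trans ?_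
    rw [evTen_smul, evTen_tmul, smooth_one_apply, one_smul]
    exact (congrArg (· • a) hy).trans (one_smul _ _)
  rw [hb']

end IsLocalTrivialization

end Fiber

/-! ### Cocycles and the quantum gauge bundle -/

namespace TrivializationSystem

open Coalgebra

variable {G : CompactMatrixQuantumGroup.{v}} {d : ℕ} {M : Type w} [TopologicalSpace M]
  [ChartedSpace (EuclideanSpace ℝ (Fin d)) M] {P : QuantumPrincipalBundle.{v, w, y} G d M}
  (τ : TrivializationSystem P)

/-- The fiber map of the `k`-th trivialization at a point of `U_k`. -/
def fib (k : Fin τ.m) {x : M} (hx : x ∈ τ.U k) : P.B →⋆ₐ[ℂ] G.A :=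
  fiber (τ.π k) (⟨x, hx⟩ : τ.U k)

theorem fib_smul_complex (k : Fin τ.m) {x : M} (hx : x ∈ τ.U k) (c : ℂ) (b : P.B) :
    τ.fib k hx (c • b) = c • τ.fib k hx b := map_smul (τ.fib k hx) c b

/-- The value of the transition map `g_{kl}` at a point of `U_k ∩ U_l`. -/
def transition {τ : TrivializationSystem P} (g : τ.TransitionFamily) {k l : Fin τ.m} {x : M}
    (hk : x ∈ τ.U k) (hl : x ∈ τ.U l) : G.Cl :=
  pointChar (g k l) (⟨x, hk, hl⟩ : (τ.U k ⊓ τ.U l : Opens M))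

theorem evTen_restrLeft (k l : Fin τ.m) {x : M} (hk : x ∈ τ.U k) (hl : x ∈ τ.U l)
    (z : Smooth d (τ.U k) ⊗[ℂ] G.A) :
    evTen (⟨x, hk, hl⟩ : (τ.U k ⊓ τ.U l : Opens M)) (τ.restrLeft k l z) =
      evTen (⟨x, hk⟩ : τ.U k) z := by
  induction z with
  | zero => simp
  | add t t' ht ht' => simp only [map_add, ht, ht']
  | tmul φ a => rfl

theorem evTen_restrRight (k l : Fin τ.m) {x : M} (hk : x ∈ τ.U k) (hl : x ∈ τ.U l)
    (z : Smooth d (τ.U l) ⊗[ℂ] G.A) :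
    evTen (⟨x, hk, hl⟩ : (τ.U k ⊓ τ.U l : Opens M)) (τ.restrRight k l z) =
      evTen (⟨x, hl⟩ : τ.U l) z := by
  induction z with
  | zero => simp
  | add t t' ht ht' => simp only [map_add, ht, ht']
  | tmul φ a => rfl

theorem isCocycle_iff (g : τ.TransitionFamily) : τ.IsCocycle g ↔
    ∀ k l x (hk : x ∈ τ.U k) (hl : x ∈ τ.U l) b,
      τ.fib l hl b = lam (transition g hk hl).lin (τ.fib k hk b) := by
  have h : ∀ k l x (hk : x ∈ τ.U k) (hl : x ∈ τ.U l) b,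
      (evTen (⟨x, hk, hl⟩ : (τ.U k ⊓ τ.U l : Opens M)) (τ.restrRight k l (τ.π l b)) =
        evTen (⟨x, hk, hl⟩ : (τ.U k ⊓ τ.U l : Opens M))
          (psi (g k l) (τ.restrLeft k l (τ.π k b)))) ↔
        τ.fib l hl b = lam (transition g hk hl).lin (τ.fib k hk b) := by
    intro k l x hk hl b
    rw [evTen_psi, τ.evTen_restrLeft k l hk hl, τ.evTen_restrRight k l hk hl]
    rfl
  exact ⟨fun hg k l x hk hl b => (h k l x hk hl b).1 (congrArg _ (hg k l b)),
    fun hg k l b => evTen_ext fun x => (h k l x.1 x.2.1 x.2.2 b).2 (hg k l x.1 x.2.1 x.2.2 b)⟩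

theorem mem_gaugeAlgebra_iff (g : τ.TransitionFamily) (q : ∀ k, Smooth d (τ.U k) ⊗[ℂ] G.A) :
    q ∈ τ.gaugeAlgebra g ↔ ∀ k l x (hk : x ∈ τ.U k) (hl : x ∈ τ.U l),
      evTen (⟨x, hk⟩ : τ.U k) (q k) =
        ad (transition g hk hl) (evTen (⟨x, hl⟩ : τ.U l) (q l)) := by
  have h : ∀ k l x (hk : x ∈ τ.U k) (hl : x ∈ τ.U l),
      (evTen (⟨x, hk, hl⟩ : (τ.U k ⊓ τ.U l : Opens M)) (τ.restrLeft k l (q k)) =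
        evTen (⟨x, hk, hl⟩ : (τ.U k ⊓ τ.U l : Opens M))
          (xi (g k l) (τ.restrRight k l (q l)))) ↔
      evTen (⟨x, hk⟩ : τ.U k) (q k) =
        ad (transition g hk hl) (evTen (⟨x, hl⟩ : τ.U l) (q l)) := by
    intro k l x hk hl
    rw [evTen_xi, τ.evTen_restrLeft k l hk hl, τ.evTen_restrRight k l hk hl]
    rfl
  exact ⟨fun hq k l x hk hl => (h k l x hk hl).1 (congrArg _ (hq k l)),
    fun hq k l => evTen_ext fun x => (h k l x.1 x.2.1 x.2.2).2 (hq k l x.1 x.2.1 x.2.2)⟩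

theorem evTen_πSharp (g : τ.TransitionFamily) (q : τ.D g) {k l : Fin τ.m} {x : M}
    (hk : x ∈ τ.U k) (hl : x ∈ τ.U l) :
    evTen (⟨x, hk⟩ : τ.U k) (τ.πSharp g k q) =
      ad (transition g hk hl) (evTen (⟨x, hl⟩ : τ.U l) (τ.πSharp g l q)) :=
  (τ.mem_gaugeAlgebra_iff g q.1).1 q.2 k l x hk hl

section Glue

theorem πLinear_isLocallySplit [T2Space M] [CompactSpace M] (k : Fin τ.m) :
    IsLocallySplit (τ.πLinear k) :=
  (τ.isLocalTrivialization k).isLocallySplit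

variable [T2Space M] [CompactSpace M] [IsManifold (𝓡 d) ∞ M]

theorem fib_surjective (k : Fin τ.m) {x : M} (hx : x ∈ τ.U k) (a : G.A) :
    ∃ b, τ.fib k hx b = a := (τ.isLocalTrivialization k).fiber_surjective _ a

/-- Elements of a locally split module are determined by their local representations. -/
theorem eq_of_locallySplit {X : Type*} [AddCommGroup X] [Module (Smooth d M) X]
    {V : Type*} [AddCommGroup V] [Module ℂ V]
    {p : ∀ k, X →ₗ[Smooth d M] Smooth d (τ.U k) ⊗[ℂ] V} (hp : ∀ k, IsLocallySplit (p k))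
    {b c : X} (h : ∀ k, p k b = p k c) : b = c := by
  obtain ⟨f, hf, hf1⟩ := exists_partition (d := d) τ.U τ.cover
  rw [← sub_eq_zero, ← one_smul (Smooth d M) (b - c), ← hf1, Finset.sum_smul]
  exact Finset.sum_eq_zero fun k _ => (hp k).injective (f k) (hf k) _
    (by rw [map_sub, h, sub_self])

theorem ext_fib {b c : P.B} (h : ∀ k x (hx : x ∈ τ.U k), τ.fib k hx b = τ.fib k hx c) : b = c :=
  τ.eq_of_locallySplit τ.πLinear_isLocallySplit fun k => evTen_ext fun x => h k x.1 x.2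

theorem exists_lam_fib (k l : Fin τ.m) {x : M} (hk : x ∈ τ.U k) (hl : x ∈ τ.U l) :
    ∃ χ : G.Cl, ∀ b, τ.fib l hl b = lam χ.lin (τ.fib k hk b) :=
  (τ.isLocalTrivialization k).exists_lam (⟨x, hk⟩ : τ.U k) (τ.fib l hl)
    ((τ.isLocalTrivialization l).fiber_base (⟨x, hl⟩ : τ.U l))
    ((τ.isLocalTrivialization l).comul_fiber (⟨x, hl⟩ : τ.U l))

/-- Existence and uniqueness hold pointwise, from `exists_lam_fib` and `lam_unique`. Smoothness
holds because the character applied to the `k`-th fiber value of `b` is the counit of the `l`-th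
one. -/
theorem existsUnique_isCocycle : ∃! g : τ.TransitionFamily, τ.IsCocycle g := by
  choose χ hχ using fun (k l : Fin τ.m) (x : (τ.U k ⊓ τ.U l : Opens M)) =>
    τ.exists_lam_fib k l x.2.1 x.2.2
  have hs : ∀ k l a, ContMDiff (𝓡 d) 𝓘(ℝ, ℂ) ∞ fun x => χ k l x a := fun k l a => by
    refine (τ.isLocalTrivialization k).contMDiff_char inf_le_left (χ k l) (fun b => ?_) a
    refine (restrLE d (inf_le_right : τ.U k ⊓ τ.U l ≤ τ.U l) (slice counit (τ.π l b))).2.congr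
      fun x => ?_
    change χ k l x (τ.fib k x.2.1 b) = (slice counit (τ.π l b)).1 (⟨x.1, x.2.2⟩ : τ.U l)
    rw [slice_apply]
    change _ = counit (τ.fib l x.2.2 b)
    rw [hχ k l x b, counit_lam]
    rfl
  refine ⟨fun k l => smoothHom (χ k l) (hs k l), (τ.isCocycle_iff _).2 fun k l x hk hl b =>
    hχ k l ⟨x, hk, hl⟩ b, fun g hg => ?_⟩
  funext k l
  refine StarAlgHom.ext fun a => smooth_ext fun x => ?_
  have h1 : pointChar (g k l) x = χ k l x :=
    (τ.isLocalTrivialization k).lam_unique (⟨x.1, x.2.1⟩ : τ.U k) fun b =>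
      ((τ.isCocycle_iff g).1 hg k l x.1 x.2.1 x.2.2 b).symm.trans (hχ k l x b)
  exact congrArg (fun θ : G.Cl => θ a) h1

variable {τ} {g : τ.TransitionFamily}

namespace IsCocycle

/-- The cocycle identity. -/
theorem lam_transition (hg : τ.IsCocycle g) {k l m : Fin τ.m} {x : M} (hk : x ∈ τ.U k)
    (hl : x ∈ τ.U l) (hm : x ∈ τ.U m) (a : G.A) : lam (transition g hk hm).lin a =
      lam (transition g hl hm).lin (lam (transition g hk hl).lin a) := by
  have h := (τ.isCocycle_iff g).1 hg
  obtain ⟨b, rfl⟩ := τ.fib_surjective k hk a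
  rw [← h, ← h, ← h]

theorem lam_transition_self (hg : τ.IsCocycle g) {k : Fin τ.m} {x : M} (hk : x ∈ τ.U k)
    (a : G.A) : lam (transition g hk hk).lin a = a := by
  obtain ⟨b, rfl⟩ := τ.fib_surjective k hk a
  exact ((τ.isCocycle_iff g).1 hg k k x hk hk b).symm

theorem transition_inv (hg : τ.IsCocycle g) {k l : Fin τ.m} {x : M} (hk : x ∈ τ.U k)
    (hl : x ∈ τ.U l) : transition g hl hk = (transition g hk hl).inv :=
  CompactMatrixQuantumGroup.Cl.eq_inv_of_lam_lam fun a => by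
    rw [← hg.lam_transition hl hk hl, hg.lam_transition_self]

theorem ad_transition (hg : τ.IsCocycle g) {k l m : Fin τ.m} {x : M} (hk : x ∈ τ.U k)
    (hl : x ∈ τ.U l) (hm : x ∈ τ.U m) (a : G.A) : ad (transition g hk hm) a =
      ad (transition g hk hl) (ad (transition g hl hm) a) :=
  (ad_ad (hg.lam_transition hk hl hm) a).symm

theorem ad_transition_self (hg : τ.IsCocycle g) {k : Fin τ.m} {x : M} (hk : x ∈ τ.U k)
    (a : G.A) : ad (transition g hk hk) a = a := by
  -- The cocycle identity makes this map idempotent, and it has a left inverse.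
  have h := congrArg (ad (transition g hk hk).inv) (hg.ad_transition hk hk hk a)
  rwa [ad_inv_ad, ad_inv_ad, eq_comm] at h

/-- A local element over `U_k` is carried to each `U_l` by `ξ_{lk}`, cut off by `h` and extended by
zero. The cocycle identity shows that the resulting family lies in `D`. -/
theorem πSharp_isLocallySplit (hg : τ.IsCocycle g) (k : Fin τ.m) :
    IsLocallySplit (τ.πSharp g k) where
  range h hU z := by
    let q : ∀ l, Smooth d (τ.U l) ⊗[ℂ] G.A := fun l =>
      (extendInter h hU).rTensor G.A (xi (g l k) (τ.restrRight l k z))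
    have hq : ∀ l x (hl : x ∈ τ.U l) (hk : x ∈ τ.U k), evTen (⟨x, hl⟩ : τ.U l) (q l) =
        h.1 x • ad (transition g hl hk) (evTen (⟨x, hk⟩ : τ.U k) z) := by
      intro l x hl hk
      have h1 := evTen_xi (g l k) (⟨x, hl, hk⟩ : (τ.U l ⊓ τ.U k : Opens M)) (τ.restrRight l k z)
      rw [τ.evTen_restrRight l k hl hk] at h1
      refine Eq.trans ?_ (congrArg (h.1 x • ·) h1)
      simp only [q]
      generalize xi (g l k) (τ.restrRight l k z) = u
      induction u with
      | zero => simp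
      | add t t' ht ht' => simp only [map_add, smul_add, ht, ht']
      | tmul φ a =>
        rw [LinearMap.rTensor_tmul, evTen_tmul, evTen_tmul, extendInter_apply _ _ _ _ hk, mul_smul]
    have hq' : ∀ l x (hl : x ∈ τ.U l), x ∉ τ.U k → evTen (⟨x, hl⟩ : τ.U l) (q l) = 0 := by
      intro l x hl hk
      simp only [q]
      generalize xi (g l k) (τ.restrRight l k z) = u
      induction u with
      | zero => simp
      | add t t' ht ht' => simp only [map_add, ht, ht', add_zero]
      | tmul φ a =>
        rw [LinearMap.rTensor_tmul, evTen_tmul, extendInter_of_notMem _ _ _ _ hk, zero_smul]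
    refine ⟨⟨q, (τ.mem_gaugeAlgebra_iff g q).2 fun l m x hl hm => ?_⟩, evTen_ext fun x => ?_⟩
    · by_cases hk : x ∈ τ.U k
      · rw [hq l x hl hk, hq m x hm hk, map_smul, hg.ad_transition hl hm hk]
      · rw [hq' l x hl hk, hq' m x hm hk, map_zero]
    · refine (hq k x.1 x.2 x.2).trans ?_
      rw [hg.ad_transition_self, evTen_smul]
  injective h hU q hq := by
    refine Subtype.ext (funext fun l => evTen_ext fun x => ?_)
    change evTen x (τ.πSharp g l (h • q)) = evTen x 0
    rw [map_smul, evTen_smul, map_zero]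
    by_cases hx : x.1 ∈ τ.U k
    · refine (congrArg (h.1 x.1 • ·) (τ.evTen_πSharp g q x.2 hx)).trans ?_
      rw [hq, map_zero, map_zero, smul_zero]
    · rw [image_eq_zero_of_notMem_tsupport fun h' => hx (hU h'), zero_smul]

end IsCocycle

end Glue

end TrivializationSystem

/-! ### Structure maps of the quantum gauge bundle -/

namespace TrivializationSystem

open Coalgebra HopfAlgebra

variable {G : CompactMatrixQuantumGroup.{v}} {d : ℕ} {M : Type w} [TopologicalSpace M]
  [ChartedSpace (EuclideanSpace ℝ (Fin d)) M] {P : QuantumPrincipalBundle.{v, w, y} G d M}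
  {τ : TrivializationSystem P} {g : τ.TransitionFamily}

/-- The value of an element of `D` at a point of `U_k`, in the `k`-th trivialization. -/
def sharp (k : Fin τ.m) {x : M} (hx : x ∈ τ.U k) (q : τ.D g) : G.A :=
  evTen (⟨x, hx⟩ : τ.U k) (τ.πSharp g k q)

theorem sharp_add (k : Fin τ.m) {x : M} (hx : x ∈ τ.U k) (q r : τ.D g) :
    sharp k hx (q + r) = sharp k hx q + sharp k hx r := by
  simp only [sharp, map_add]

theorem sharp_mul (k : Fin τ.m) {x : M} (hx : x ∈ τ.U k) (q r : τ.D g) :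
    sharp k hx (q * r) = sharp k hx q * sharp k hx r :=
  evTen_mul _ _ _

theorem sharp_star (k : Fin τ.m) {x : M} (hx : x ∈ τ.U k) (q : τ.D g) :
    sharp k hx (star q) = star (sharp k hx q) :=
  evTen_star _ _

theorem sharp_one (k : Fin τ.m) {x : M} (hx : x ∈ τ.U k) : sharp k hx (1 : τ.D g) = 1 :=
  evTen_one _

theorem sharp_algebraMap (k : Fin τ.m) {x : M} (hx : x ∈ τ.U k) (f : Smooth d M) :
    sharp k hx (algebraMap (Smooth d M) (τ.D g) f) = f.1 x • (1 : G.A) :=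
  evTen_tmul _ _ _

theorem sharp_eq_ad {k l : Fin τ.m} {x : M} (hk : x ∈ τ.U k) (hl : x ∈ τ.U l) (q : τ.D g) :
    sharp k hk q = ad (transition g hk hl) (sharp l hl q) :=
  τ.evTen_πSharp g q hk hl

/-- The `S(M)`-linear map `id ⊗ T` on `S(U) ⊗ V`. -/
def lTensorLinear {U : Opens M} {V W : Type*} [AddCommGroup V] [Module ℂ V] [AddCommGroup W]
    [Module ℂ W] (T : V →ₗ[ℂ] W) :
    Smooth d U ⊗[ℂ] V →ₗ[Smooth d M] Smooth d U ⊗[ℂ] W where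
  toFun := T.lTensor (Smooth d U)
  map_add' := map_add _
  map_smul' f z := evTen_ext fun x => by
    rw [RingHom.id_apply, evTen_lTensor, evTen_smul, evTen_smul, evTen_lTensor, map_smul]

/-- The map `q ⊗ b ↦ f(q) b` for a linear map `f : D → S(M)`. -/
def tensorIdLinear (f : τ.D g →ₗ[Smooth d M] Smooth d M) :
    τ.D g ⊗[Smooth d M] P.B →ₗ[Smooth d M] P.B :=
  TensorProduct.lift ((LinearMap.lsmul (Smooth d M) P.B).comp f)

theorem fib_tensorIdLinear (f : τ.D g →ₗ[Smooth d M] Smooth d M) (k : Fin τ.m) {x : M}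
    (hx : x ∈ τ.U k) {χ : G.A →ₗ[ℂ] ℂ} (hχ : ∀ q, (f q).1 x = χ (sharp k hx q))
    (t : τ.D g ⊗[Smooth d M] P.B) : τ.fib k hx (tensorIdLinear f t) =
      TensorProduct.lid ℂ G.A (χ.rTensor G.A
        (evTen (⟨x, hx⟩ : τ.U k) (tensorLocal (τ.πSharp g k) (τ.πLinear k) t))) := by
  induction t with
  | zero => simp
  | add t t' ht ht' => simp only [map_add, ht, ht']
  | tmul q b =>
    rw [evTen_tensorLocal_tmul]
    refine ((τ.isLocalTrivialization k).fiber_smul (⟨x, hx⟩ : τ.U k) (f q) b).trans ?_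
    rw [LinearMap.rTensor_tmul, TensorProduct.lid_tmul]
    exact congrArg (· • _) (hχ q)

/-- Locally `β_M` is the coproduct, and `f` contracts its first leg. The map `f` is only assumed
linear so that this also applies to `f ∘ κ_M`, whose multiplicativity is not established separately.
-/
theorem fib_coaction {βM : P.B →ₗ[Smooth d M] τ.D g ⊗[Smooth d M] P.B} (hβ : τ.IsCoaction g βM)
    (f : τ.D g →ₗ[Smooth d M] Smooth d M) (k : Fin τ.m) {x : M}
    (hx : x ∈ τ.U k) {χ : G.A →ₗ[ℂ] ℂ} (hχ : ∀ q, (f q).1 x = χ (sharp k hx q)) (b : P.B) :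
    τ.fib k hx (tensorIdLinear f (βM b)) = lam χ (τ.fib k hx b) := by
  rw [fib_tensorIdLinear f k hx hχ, hβ, evTen_lTensor]
  rfl

/-- The right-hand side is the product of characters `χ'χ`, evaluated at the value of `q`. -/
theorem tensorSect_comul {φM : τ.D g →ₗ[Smooth d M] τ.D g ⊗[Smooth d M] τ.D g}
    (hφ : τ.IsComul g φM) (f' f : τ.Sect g) (k : Fin τ.m) {x : M} (hx : x ∈ τ.U k) {χ' χ : G.Cl}
    (hχ' : ∀ q, (f' q).1 x = χ' (sharp k hx q)) (hχ : ∀ q, (f q).1 x = χ (sharp k hx q))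
    (q : τ.D g) : (tensorSect f' f (φM q)).1 x = χ (lam χ'.lin (sharp k hx q)) := by
  have h : ∀ t, (tensorSect f' f t).1 x = χ (TensorProduct.lid ℂ G.A (χ'.lin.rTensor G.A
      (evTen (⟨x, hx⟩ : τ.U k) (tensorLocal (τ.πSharp g k) (τ.πSharp g k) t)))) := fun t => by
    induction t with
    | zero => simp
    | add t t' ht ht' => simp only [map_add, smooth_add_apply, ht, ht']
    | tmul q r =>
      rw [evTen_tensorLocal_tmul, LinearMap.rTensor_tmul, TensorProduct.lid_tmul, map_smul]
      exact congrArg₂ (· * ·) (hχ' q) (hχ r)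
  rw [h, hφ, evTen_lTensor]
  rfl

/-! ### Existence and uniqueness of the structure maps -/

section Compact

variable [T2Space M] [CompactSpace M] [IsManifold (𝓡 d) ∞ M]

namespace IsCocycle

theorem sharp_surjective (hg : τ.IsCocycle g) (k : Fin τ.m) {x : M} (hx : x ∈ τ.U k) (a : G.A) :
    ∃ q : τ.D g, sharp k hx q = a := (hg.πSharp_isLocallySplit k).surjective _ a

theorem exists_isComul (hg : τ.IsCocycle g) :
    ∃ φM, τ.IsComul g φM ∧ ∀ φ', τ.IsComul g φ' → φ' = φM := by
  obtain ⟨φM, hφ⟩ := exists_tensorLocal_eq τ.cover hg.πSharp_isLocallySplit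
    hg.πSharp_isLocallySplit (fun k => lTensorLinear (comul (R := ℂ) (A := G.A)) ∘ₗ τ.πSharp g k)
    fun k l x hk hl => ⟨ad (transition g hl hk), ad (transition g hl hk),
      sharp_eq_ad hl hk, sharp_eq_ad hl hk, fun q => by
        refine (evTen_lTensor _ _ _).trans (Eq.trans ?_
          (congrArg _ (evTen_lTensor comul (⟨x, hk⟩ : τ.U k) (τ.πSharp g k q)).symm))
        rw [τ.evTen_πSharp g q hl hk, comul_ad]⟩
  refine ⟨φM, hφ, fun φ' hφ' => LinearMap.ext fun q => sub_eq_zero.1 ?_⟩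
  refine eq_zero_of_tensorLocal τ.cover hg.πSharp_isLocallySplit hg.πSharp_isLocallySplit _
    fun k => ?_
  rw [map_sub, hφ' k q]
  exact sub_eq_zero.2 (hφ k q).symm

theorem exists_isCoaction (hg : τ.IsCocycle g) :
    ∃ βM, τ.IsCoaction g βM ∧ ∀ β', τ.IsCoaction g β' → β' = βM := by
  obtain ⟨βM, hβ⟩ := exists_tensorLocal_eq τ.cover hg.πSharp_isLocallySplit
    τ.πLinear_isLocallySplit (fun k => lTensorLinear (comul (R := ℂ) (A := G.A)) ∘ₗ τ.πLinear k)
    fun k l x hk hl => by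
      have h : ∀ b, evTen (⟨x, hl⟩ : τ.U l) (τ.πLinear l b) = lam (transition g hl hk).inv.lin
          (evTen (⟨x, hk⟩ : τ.U k) (τ.πLinear k b)) := fun b => by
        rw [← hg.transition_inv hl hk]
        exact (τ.isCocycle_iff g).1 hg k l x hk hl b
      refine ⟨ad (transition g hl hk), lam (transition g hl hk).inv.lin,
        sharp_eq_ad hl hk, h, fun b => ?_⟩
      refine (evTen_lTensor _ _ _).trans (Eq.trans ?_
          (congrArg _ (evTen_lTensor comul (⟨x, hk⟩ : τ.U k) (τ.πLinear k b)).symm))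
      rw [h, comul_lam_inv]
  refine ⟨βM, hβ, fun β' hβ' => LinearMap.ext fun b => sub_eq_zero.1 ?_⟩
  refine eq_zero_of_tensorLocal τ.cover hg.πSharp_isLocallySplit τ.πLinear_isLocallySplit _
    fun k => ?_
  rw [map_sub, hβ' k b]
  exact sub_eq_zero.2 (hβ k b).symm

end IsCocycle

end Compact

theorem exists_isAntipode (g : τ.TransitionFamily) :
    ∃ κM, τ.IsAntipode g κM ∧ ∀ κ', τ.IsAntipode g κ' → κ' = κM := by
  have h : ∀ (q : τ.D g), (fun k => (antipode ℂ (A := G.A)).lTensor (Smooth d (τ.U k)) (q.1 k)) ∈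
      τ.gaugeAlgebra g := fun q => (τ.mem_gaugeAlgebra_iff g _).2 fun k l x hk hl => by
    rw [evTen_lTensor, evTen_lTensor, ← antipode_ad]
    exact congrArg _ (sharp_eq_ad hk hl q)
  refine ⟨{ toFun := fun q => ⟨_, h q⟩, map_add' := fun q r => ?_, map_smul' := fun f q => ?_ },
    fun k q => rfl, fun κ' hκ' => LinearMap.ext fun q => Subtype.ext (funext fun k => hκ' k q)⟩
  · exact Subtype.ext (funext fun k => map_add _ _ _)
  · exact Subtype.ext (funext fun k => (lTensorLinear (antipode ℂ (A := G.A))).map_smul f (q.1 k))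

/-! ### Sections of the quantum gauge bundle -/

/-- Values of a section of the gauge bundle in two trivializations related by `χ`. -/
theorem char_ad_of_compatible {χ c c' : G.Cl} (h : ∀ a, c' (lam χ.lin a) = χ (lam c.lin a))
    (a : G.A) : c' (ad χ.inv a) = c a := by
  -- The hypothesis reads `χc' = cχ`. After using it, the right translation by `χ⁻¹` moves past `lam
  -- c`, and `χ` cancels against it, leaving the counit of `lam c a`.
  rw [ad_apply, CompactMatrixQuantumGroup.Cl.inv_inv, h, lam_rho]
  refine (apply_rho χ.lin χ.inv.lin _).trans ((χ.inv_lam_apply _).trans (counit_lam _ _))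

section Compact

variable [T2Space M] [CompactSpace M] [IsManifold (𝓡 d) ∞ M]

/-- A smooth compatible family of characters is a section of the gauge bundle. -/
theorem exists_sect (hg : τ.IsCocycle g) (c : ∀ k, τ.U k → G.Cl)
    (hs : ∀ k a, ContMDiff (𝓡 d) 𝓘(ℝ, ℂ) ∞ fun x => c k x a)
    (hc : ∀ k l x (hk : x ∈ τ.U k) (hl : x ∈ τ.U l) a,
      c l ⟨x, hl⟩ (lam (transition g hk hl).lin a) =
        transition g hk hl (lam (c k ⟨x, hk⟩).lin a)) :
    ∃ f : τ.Sect g, ∀ k x (hx : x ∈ τ.U k) q, (f q).1 x = c k ⟨x, hx⟩ (sharp k hx q) := by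
  -- The value at `x` is defined with an arbitrarily chosen index `κ x`; compatibility makes it
  -- independent of this choice, and so smooth in each `U_k`.
  choose κ hκ using τ.cover
  let F : τ.D g → M → ℂ := fun q x => c (κ x) ⟨x, hκ x⟩ (sharp (κ x) (hκ x) q)
  have hF : ∀ q k x (hx : x ∈ τ.U k), F q x = c k ⟨x, hx⟩ (sharp k hx q) := by
    intro q k x hx
    have h1 := char_ad_of_compatible (hc (κ x) k x (hκ x) hx) (sharp (κ x) (hκ x) q)
    rw [← hg.transition_inv (hκ x) hx, ← sharp_eq_ad hx (hκ x) q] at h1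
    exact h1.symm
  have hsm : ∀ q, ContMDiff (𝓡 d) 𝓘(ℝ, ℂ) ∞ (F q) := by
    intro q x
    obtain ⟨k, hk⟩ := τ.cover x
    refine (contMDiffAt_subtype_iff (U := τ.U k) (x := ⟨x, hk⟩)).1 ?_
    have h1 : ∀ z : Smooth d (τ.U k) ⊗[ℂ] G.A,
        ContMDiff (𝓡 d) 𝓘(ℝ, ℂ) ∞ fun y : τ.U k => c k y (evTen y z) := fun z => by
      induction z with
      | zero => simpa using contMDiff_const
      | add t t' ht ht' =>
        simp only [map_add]
        exact ht.add ht'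
      | tmul φ a =>
        simp only [evTen_tmul, map_smul, smul_eq_mul]
        let ψ : Smooth d (τ.U k) := ⟨_, hs k a⟩
        exact (φ * ψ).2
    exact (h1 (τ.πSharp g k q)).contMDiffAt.congr_of_eventuallyEq
      (Filter.Eventually.of_forall fun y => hF q k y.1 y.2)
  let f : τ.Sect g :=
    { toFun := fun q => ⟨F q, hsm q⟩
      map_one' := smooth_ext fun x => by
        change c _ _ (sharp _ _ _) = 1
        rw [sharp_one, map_one]
      map_mul' := fun q r => smooth_ext fun x => by
        change c _ _ (sharp _ _ _) = c _ _ (sharp _ _ _) * c _ _ (sharp _ _ _)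
        rw [sharp_mul, map_mul]
      map_zero' := smooth_ext fun x => by
        change c _ _ (sharp _ _ _) = 0
        simp [sharp]
      map_add' := fun q r => smooth_ext fun x => by
        change c _ _ (sharp _ _ _) = c _ _ (sharp _ _ _) + c _ _ (sharp _ _ _)
        rw [sharp_add, map_add]
      commutes' := fun h => smooth_ext fun x => by
        change c _ _ (sharp _ _ _) = h.1 x
        rw [sharp_algebraMap, map_smul, map_one, smul_eq_mul, mul_one]
      map_star' := fun q => smooth_ext fun x => by
        change c _ _ (sharp _ _ _) = star (c _ _ (sharp _ _ _))
        rw [sharp_star, map_star] }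
  exact ⟨f, fun k x hx q => hF q k x hx⟩

/-- The trivial character is fixed by every conjugation, so the constant family is a section.
Building `ε_M` this way gives its multiplicativity and smoothness at once. -/
theorem exists_isCounit (hg : τ.IsCocycle g) : ∃ f : τ.Sect g,
    (∀ k x (hx : x ∈ τ.U k) q, (f q).1 x = counit (R := ℂ) (sharp k hx q)) ∧
    τ.IsCounit g f.toAlgHom.toLinearMap ∧
    ∀ ε', τ.IsCounit g ε' → ε' = f.toAlgHom.toLinearMap := by
  obtain ⟨f, hf⟩ := exists_sect hg (fun k x => CompactMatrixQuantumGroup.Cl.one G)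
    (fun k a => contMDiff_const) fun k l x hk hl a => by
      rw [show (CompactMatrixQuantumGroup.Cl.one G).lin = counit from rfl, lam_counit]
      exact counit_lam _ _
  have h : ∀ ε' : τ.D g →ₗ[Smooth d M] Smooth d M, τ.IsCounit g ε' ↔
      ∀ k x (hx : x ∈ τ.U k) q, (ε' q).1 x = counit (R := ℂ) (sharp k hx q) := fun ε' =>
    ⟨fun h k x hx q => (congrArg (fun φ : Smooth d (τ.U k) => φ.1 ⟨x, hx⟩) (h k q)).trans
      (slice_apply counit (τ.πSharp g k q) (⟨x, hx⟩ : τ.U k)),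
    fun h k q => smooth_ext fun x => (h k x.1 x.2 q).trans
      (slice_apply counit (τ.πSharp g k q) x).symm⟩
  refine ⟨f, hf, (h _).2 hf, fun ε' hε' => LinearMap.ext fun q => smooth_ext fun x => ?_⟩
  obtain ⟨k, hk⟩ := τ.cover x
  exact ((h ε').1 hε' k x hk q).trans (hf k x hk q).symm

/-- The values of a section of the gauge bundle at a point, as a character. -/
theorem exists_sect_char (hg : τ.IsCocycle g) (f : τ.Sect g) (k : Fin τ.m) {x : M}
    (hx : x ∈ τ.U k) : ∃ χ : G.Cl, ∀ q, (f q).1 x = χ (sharp k hx q) := by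
  obtain ⟨T, hT⟩ := (hg.πSharp_isLocallySplit k).exists_factor (⟨x, hx⟩ : τ.U k)
    ((evalAt d x).toAlgHom.toLinearMap.toAddMonoidHom.comp
      f.toAlgHom.toLinearMap.toAddMonoidHom) fun h q => by
        change (f (h • q)).1 x = h.1 x • (f q).1 x
        rw [map_smul]
        rfl
  replace hT : ∀ q, (f q).1 x = T (sharp k hx q) := hT
  have h1 : T 1 = 1 := by rw [← sharp_one (g := g) k hx, ← hT, map_one]; rfl
  refine ⟨{ T with
    map_one' := h1, map_mul' := ?_, map_zero' := T.map_zero, commutes' := ?_, map_star' := ?_ },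
    hT⟩
  · intro a b
    change T (a * b) = T a * T b
    obtain ⟨q, rfl⟩ := hg.sharp_surjective k hx a
    obtain ⟨r, rfl⟩ := hg.sharp_surjective k hx b
    rw [← sharp_mul, ← hT, ← hT, ← hT, map_mul]
    rfl
  · intro c
    change T (algebraMap ℂ _ c) = c
    rw [Algebra.algebraMap_eq_smul_one, map_smul, h1, smul_eq_mul, mul_one]
  · intro a
    change T (star a) = star (T a)
    obtain ⟨q, rfl⟩ := hg.sharp_surjective k hx a
    rw [← sharp_star, ← hT, ← hT, map_star]
    rfl

end Compact

end TrivializationSystem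

/-! ### Gauge transformations -/

section Gauge

open Coalgebra HopfAlgebra

variable {G : CompactMatrixQuantumGroup.{v}} {d : ℕ} {M : Type w} [TopologicalSpace M]
  [ChartedSpace (EuclideanSpace ℝ (Fin d)) M] {P : QuantumPrincipalBundle.{v, w, y} G d M}

theorem gauge_base (γ : P.gaugeGroup) (f : Smooth d M) : γ.1 (P.i f) = P.i f := by
  have h := γ.2.1 f 1
  rwa [map_one, P.smul_def, mul_one] at h

variable [T2Space M] [CompactSpace M] [IsManifold (𝓡 d) ∞ M]

/-- In a local trivialization, a gauge transformation is the translation by a smooth family of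
characters. -/
theorem IsLocalTrivialization.exists_gauge_char {U : Opens M}
    {π : P.B →⋆ₐ[ℂ] Smooth d U ⊗[ℂ] G.A} (hπ : IsLocalTrivialization P.i P.F U π)
    (γ : P.gaugeGroup) : ∃ c : U → G.Cl,
      (∀ x b, fiber π x (γ.1 b) = lam (c x).lin (fiber π x b)) ∧
      ∀ a, ContMDiff (𝓡 d) 𝓘(ℝ, ℂ) ∞ fun x => c x a := by
  have h : ∀ x, ∃ χ : G.Cl, ∀ b, fiber π x (γ.1 b) = lam χ.lin (fiber π x b) := fun x =>
    hπ.exists_lam x ((fiber π x).comp (StarAlgHomClass.toStarAlgHom γ.1))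
      (fun f => by
        change fiber π x (γ.1 (P.i f)) = _
        rw [gauge_base, hπ.fiber_base])
      (fun b => by
        change comul (fiber π x (γ.1 b)) = _
        rw [hπ.comul_fiber, γ.2.2]
        generalize P.F b = t
        induction t with
        | zero => simp
        | add t t' ht ht' => simp only [map_add, ht, ht']
        | tmul b a => rfl)
  choose c hc using h
  refine ⟨c, hc, fun a => hπ.contMDiff_char le_rfl c (fun b => ?_) a⟩
  -- The counit recovers the translating character, so its values on fibers of `b` form a slice of
  -- `π (γ b)`.
  refine (slice counit (π (γ.1 b))).2.congr fun x => ?_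
  rw [slice_apply]
  change c x (fiber π x b) = counit (fiber π x (γ.1 b))
  rw [hc, counit_lam]
  rfl

namespace TrivializationSystem

variable {τ : TrivializationSystem P} {g : τ.TransitionFamily}

/-- Coordinates in a basis of `A` reduce the claim to elements of `B`, which `ext_fib` separates. It
is needed to verify covariance of a map known only fiberwise. -/
theorem rTensor_ext (τ : TrivializationSystem P) {t t' : P.B ⊗[ℂ] G.A}
    (h : ∀ k x (hx : x ∈ τ.U k), (τ.fib k hx).toAlgHom.toLinearMap.rTensor G.A t =
      (τ.fib k hx).toAlgHom.toLinearMap.rTensor G.A t') : t = t' := by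
  let b := Module.Free.chooseBasis ℂ G.A
  let e := TensorProduct.equivFinsuppOfBasisRight (M := P.B) b
  have he : ∀ u i k x (hx : x ∈ τ.U k), τ.fib k hx (e u i) = TensorProduct.rid ℂ G.A
      ((b.coord i).lTensor G.A ((τ.fib k hx).toAlgHom.toLinearMap.rTensor G.A u)) := by
    intro u i k x hx
    induction u with
    | zero => simp
    | add z w hz hw => simp only [map_add, Finsupp.add_apply, hz, hw]
    | tmul c a => simp [e]
  apply e.injective
  ext1 i
  exact τ.ext_fib fun k x hx => by rw [he, he, h]

/-- The gauge transformation with given values in the local trivializations. -/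
theorem exists_gauge (τ : TrivializationSystem P) (L L' : P.B →ₗ[Smooth d M] P.B)
    (c : ∀ (k : Fin τ.m) (x : M), x ∈ τ.U k → G.Cl)
    (hL : ∀ k x hx b, τ.fib k hx (L b) = lam (c k x hx).lin (τ.fib k hx b))
    (hL' : ∀ k x hx b, τ.fib k hx (L' b) = lam (c k x hx).inv.lin (τ.fib k hx b)) :
    ∃ γ : P.gaugeGroup, ∀ b, γ.1 b = L b := by
  let γ : P.B ≃⋆ₐ[ℂ] P.B :=
    { toFun := L
      invFun := L'
      left_inv := fun b => τ.ext_fib fun k x hx => by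
        rw [hL', hL, CompactMatrixQuantumGroup.Cl.lam_inv_lam]
      right_inv := fun b => τ.ext_fib fun k x hx => by
        rw [hL, hL', CompactMatrixQuantumGroup.Cl.lam_lam_inv]
      map_mul' := fun b b' => τ.ext_fib fun k x hx => by
        rw [hL, map_mul (τ.fib k hx), map_mul (τ.fib k hx), hL, hL,
          CompactMatrixQuantumGroup.Cl.lam_mul]
      map_add' := map_add L
      map_star' := fun b => τ.ext_fib fun k x hx => by
        rw [hL, map_star (τ.fib k hx), map_star (τ.fib k hx), hL,
          CompactMatrixQuantumGroup.Cl.lam_star]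
      map_smul' := fun z b => τ.ext_fib fun k x hx => by
        rw [fib_smul_complex, hL, hL, fib_smul_complex, map_smul] }
  refine ⟨⟨γ, L.map_smul, fun b => τ.rTensor_ext fun k x hx => ?_⟩, fun b => rfl⟩
  have hk := τ.isLocalTrivialization k
  refine (hk.comul_fiber (⟨x, hx⟩ : τ.U k) _).symm.trans ?_
  change comul (τ.fib k hx (L b)) = _
  rw [hL, comul_lam, show comul (R := ℂ) (τ.fib k hx b) = _ from
    hk.comul_fiber (⟨x, hx⟩ : τ.U k) b]
  generalize P.F b = t
  induction t with
  | zero => simp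
  | add t t' ht ht' => simp only [map_add, ht, ht']
  | tmul b a => exact congrArg (· ⊗ₜ a) (hL k x hx b).symm

theorem gauge_ext (τ : TrivializationSystem P) {γ γ' : P.gaugeGroup}
    (h : ∀ k x (hx : x ∈ τ.U k) b, τ.fib k hx (γ.1 b) = τ.fib k hx (γ'.1 b)) : γ = γ' :=
  Subtype.ext (StarAlgEquiv.ext fun b => τ.ext_fib fun k x hx => h k x hx b)

/-- Every gauge transformation is given by the translations by the values of a section. -/
theorem exists_sect_of_gauge (hg : τ.IsCocycle g) (γ : P.gaugeGroup) : ∃ f : τ.Sect g,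
    ∀ k x (hx : x ∈ τ.U k) (χ : G.Cl), (∀ q, (f q).1 x = χ (sharp k hx q)) →
      ∀ b, τ.fib k hx (γ.1 b) = lam χ.lin (τ.fib k hx b) := by
  choose c hc hs using fun k => (τ.isLocalTrivialization k).exists_gauge_char γ
  have hc' : ∀ k x (hx : x ∈ τ.U k) b,
      τ.fib k hx (γ.1 b) = lam (c k ⟨x, hx⟩).lin (τ.fib k hx b) := fun k x hx => hc k ⟨x, hx⟩
  have hgl := (τ.isCocycle_iff g).1 hg
  -- Expressing the `l`-th fiber value of `γ b` through the `k`-th in two ways, and applying the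
  -- counit, gives the compatibility `c_k g_{kl} = g_{kl} c_l`.
  obtain ⟨f, hf⟩ := exists_sect hg c hs fun k l x hk hl a => by
    obtain ⟨b, rfl⟩ := τ.fib_surjective k hk a
    have h := hc' l x hl b
    rw [hgl k l x hk hl, hc', hgl k l x hk hl] at h
    have h' := congrArg (counit (R := ℂ)) h
    rw [counit_lam, counit_lam] at h'
    exact h'.symm
  refine ⟨f, fun k x hx χ hχ b => ?_⟩
  have h1 : c k ⟨x, hx⟩ = χ := StarAlgHom.ext fun a => by
    obtain ⟨q, rfl⟩ := hg.sharp_surjective k hx a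
    rw [← hf, hχ]
  rw [hc', h1]

/-- Sections of the gauge bundle correspond to gauge transformations. -/
theorem exists_equiv_sect_gauge (hg : τ.IsCocycle g)
    {κM : τ.D g →ₗ[Smooth d M] τ.D g} (hκ : τ.IsAntipode g κM)
    {βM : P.B →ₗ[Smooth d M] τ.D g ⊗[Smooth d M] P.B} (hβ : τ.IsCoaction g βM) :
    ∃ Φ : τ.Sect g ≃ P.gaugeGroup, ∀ f b, (Φ f).1 b = tensorId f (βM b) := by
  choose c hc using fun (f : τ.Sect g) (k : Fin τ.m) (x : M) (hx : x ∈ τ.U k) =>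
    exists_sect_char hg f k hx
  have hfib : ∀ (f : τ.Sect g) k x (hx : x ∈ τ.U k) b,
      τ.fib k hx (tensorIdLinear f.toAlgHom.toLinearMap (βM b)) =
        lam (c f k x hx).lin (τ.fib k hx b) := fun f k x hx b =>
    fib_coaction hβ f.toAlgHom.toLinearMap k hx (χ := (c f k x hx).lin) (hc f k x hx) b
  -- The inverse is built from `f ∘ κ_M`, whose value at each point is the inverse character.
  choose Φ hΦ using fun f : τ.Sect g => τ.exists_gauge
    (tensorIdLinear f.toAlgHom.toLinearMap ∘ₗ βM)
    (tensorIdLinear (f.toAlgHom.toLinearMap ∘ₗ κM) ∘ₗ βM) (c f) (hfib f) fun k x hx b =>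
      fib_coaction hβ (f.toAlgHom.toLinearMap ∘ₗ κM) k hx (χ := (c f k x hx).inv.lin)
        (fun q => (hc f k x hx (κM q)).trans (congrArg (c f k x hx)
          ((congrArg (evTen _) (hκ k q)).trans (evTen_lTensor _ _ _)))) b
  refine ⟨Equiv.ofBijective Φ ⟨fun f f' h => ?_, fun γ => ?_⟩, hΦ⟩
  · refine StarAlgHom.ext fun q => smooth_ext fun x => ?_
    obtain ⟨k, hk⟩ := τ.cover x
    have h1 : c f k x hk = c f' k x hk :=
      (τ.isLocalTrivialization k).lam_unique (⟨x, hk⟩ : τ.U k) fun b =>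
        (hfib f k x hk b).symm.trans ((congrArg (τ.fib k hk) ((hΦ f b).symm.trans
          ((congrArg (fun γ : P.gaugeGroup => γ.1 b) h).trans (hΦ f' b)))).trans
            (hfib f' k x hk b))
    rw [hc f k x hk, hc f' k x hk, h1]
  · obtain ⟨f, hf⟩ := exists_sect_of_gauge hg γ
    refine ⟨f, τ.gauge_ext fun k x hx b => ?_⟩
    rw [hΦ, hf k x hx _ (hc f k x hx)]
    exact hfib f k x hx b

/-- The cocycle, the structure maps of the quantum gauge bundle and the correspondence between its
sections and gauge transformations. -/
theorem quantumGaugeBundle_structure (τ : TrivializationSystem P) :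
    (∃! g : τ.TransitionFamily, τ.IsCocycle g) ∧
      ∀ g : τ.TransitionFamily, τ.IsCocycle g →
        ∃ φM εM κM βM,
          (τ.IsComul g φM ∧ ∀ φ', τ.IsComul g φ' → φ' = φM) ∧
          (τ.IsCounit g εM ∧ ∀ ε', τ.IsCounit g ε' → ε' = εM) ∧
          (τ.IsAntipode g κM ∧ ∀ κ', τ.IsAntipode g κ' → κ' = κM) ∧
          (τ.IsCoaction g βM ∧ ∀ β', τ.IsCoaction g β' → β' = βM) ∧
          ∃ Φ : τ.Sect g ≃ P.gaugeGroup,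
            (∀ f b, (Φ f).1 b = tensorId f (βM b)) ∧
            (∀ q, Φ.symm 1 q = εM q) ∧
            (∀ f q, Φ.symm (Φ f)⁻¹ q = f (κM q)) ∧
            (∀ f f' q, Φ.symm (Φ f * Φ f') q = tensorSect f' f (φM q)) := by
  refine ⟨τ.existsUnique_isCocycle, fun g hg => ?_⟩
  obtain ⟨φM, hφ⟩ := hg.exists_isComul
  obtain ⟨ε, hε, hε'⟩ := exists_isCounit hg
  obtain ⟨κM, hκ⟩ := exists_isAntipode g
  obtain ⟨βM, hβ⟩ := hg.exists_isCoaction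
  obtain ⟨Φ, hΦ⟩ := exists_equiv_sect_gauge hg hκ.1 hβ.1
  have hfib : ∀ (f : τ.Sect g) k x (hx : x ∈ τ.U k) (χ : G.Cl),
      (∀ q, (f q).1 x = χ (sharp k hx q)) →
      ∀ b, τ.fib k hx ((Φ f).1 b) = lam χ.lin (τ.fib k hx b) :=
    fun f k x hx χ hχ b => (congrArg (τ.fib k hx) (hΦ f b)).trans
      (fib_coaction hβ.1 f.toAlgHom.toLinearMap k hx (χ := χ.lin) hχ b)
  refine ⟨φM, ε.toAlgHom.toLinearMap, κM, βM, hφ, hε', hκ, hβ, Φ, hΦ, fun q => ?_,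
    fun f q => ?_, fun f f' q => ?_⟩
  · have h : Φ ε = 1 := τ.gauge_ext fun k x hx b => by
      rw [hfib ε k x hx (CompactMatrixQuantumGroup.Cl.one G) (hε k x hx)]
      exact lam_counit _
    rw [← h, Equiv.symm_apply_apply]
    rfl
  · refine smooth_ext fun x => ?_
    obtain ⟨k, hk⟩ := τ.cover x
    obtain ⟨χ, hχ⟩ := exists_sect_char hg f k hk
    obtain ⟨χ', hχ'⟩ := exists_sect_char hg (Φ.symm (Φ f)⁻¹) k hk
    have h : χ' = χ.inv := CompactMatrixQuantumGroup.Cl.eq_inv_of_lam_lam fun a => by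
      obtain ⟨b, rfl⟩ := τ.fib_surjective k hk a
      rw [← hfib _ k x hk χ' hχ', Equiv.apply_symm_apply, ← hfib f k x hk χ hχ]
      congr 1
      exact (Φ f).1.apply_symm_apply b
    rw [hχ', hχ, h, CompactMatrixQuantumGroup.Cl.inv_apply]
    exact congrArg χ ((congrArg (evTen (⟨x, hk⟩ : τ.U k)) (hκ.1 k q)).trans
      (evTen_lTensor _ _ _)).symm
  · refine smooth_ext fun x => ?_
    obtain ⟨k, hk⟩ := τ.cover x
    obtain ⟨χ, hχ⟩ := exists_sect_char hg f k hk
    obtain ⟨χ', hχ'⟩ := exists_sect_char hg f' k hk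
    obtain ⟨χ₂, hχ₂⟩ := exists_sect_char hg (Φ.symm (Φ f * Φ f')) k hk
    rw [tensorSect_comul hφ.1 f' f k hk hχ' hχ, hχ₂]
    obtain ⟨b, hb⟩ := τ.fib_surjective k hk (sharp k hk q)
    have h := hfib _ k x hk χ₂ hχ₂ b
    rw [Equiv.apply_symm_apply] at h
    -- Composing translations first by `χ'`, then by `χ`, corresponds to the product `χ'χ`; this is
    -- why `f'` stands on the left in `f' ⊗ f`.
    have h' : τ.fib k hk ((Φ f * Φ f').1 b) = lam χ.lin (lam χ'.lin (τ.fib k hk b)) := by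
      rw [← hfib f' k x hk χ' hχ', ← hfib f k x hk χ hχ]
      rfl
    rw [h', hb] at h
    have h2 := congrArg (counit (R := ℂ)) h
    rw [counit_lam, counit_lam] at h2
    exact h2.symm

end TrivializationSystem

end Gauge

/-! ### Gauge transformations of the classical part -/

section Classical

open Coalgebra QuantumPrincipalBundle

variable {G : CompactMatrixQuantumGroup.{v}} {d : ℕ} {M : Type w} [TopologicalSpace M]
  [ChartedSpace (EuclideanSpace ℝ (Fin d)) M] {P : QuantumPrincipalBundle.{v, w, y} G d M}

/-! ### Products of characters and smooth dependence on their matrices -/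

namespace CompactMatrixQuantumGroup.Cl

/-- The product of two characters. -/
def mul (χ θ : G.Cl) : G.Cl where
  toFun a := θ (lam χ.lin a)
  map_one' := by rw [lam_one, map_one]
  map_mul' a b := by rw [lam_mul, map_mul]
  map_zero' := by rw [map_zero, map_zero]
  map_add' a b := by rw [map_add, map_add]
  commutes' c := by
    rw [Algebra.algebraMap_eq_smul_one, map_smul, lam_one, map_smul, map_one,
      Algebra.algebraMap_eq_smul_one]
  map_star' a := by rw [lam_star, map_star]

theorem mul_apply (χ θ : G.Cl) (a : G.A) : χ.mul θ a = θ (lam χ.lin a) := rfl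

theorem toMatrix_mul (χ θ : G.Cl) :
    (χ.mul θ).toMatrix = fun i j => ∑ k, χ.toMatrix i k * θ.toMatrix k j := by
  funext i j
  rw [toMatrix, mul_apply, lam_apply, G.comul_u]
  simp [toMatrix]

theorem one_mul (χ : G.Cl) : (one G).mul χ = χ :=
  StarAlgHom.ext fun a => congrArg χ (lam_counit a)

/-- The value of a character at an element of `A` is a smooth function of its matrix. -/
theorem exists_contDiff_eq (a : G.A) : ∃ Q : (Fin G.n → Fin G.n → ℂ) → ℂ,
    ContDiff ℝ ∞ Q ∧ ∀ χ : G.Cl, χ a = Q χ.toMatrix := by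
  have ha : a ∈ StarAlgebra.adjoin ℂ {a : G.A | ∃ i j, a = G.u i j} := by
    rw [G.generates]
    trivial
  induction ha using StarAlgebra.adjoin_induction with
  | mem a h =>
    obtain ⟨i, j, rfl⟩ := h
    exact ⟨fun m => m i j, by fun_prop, fun χ => rfl⟩
  | algebraMap c => exact ⟨fun _ => c, contDiff_const, fun χ => AlgHomClass.commutes χ c⟩
  | add a b _ _ h h' =>
    obtain ⟨Q, hQ, h1⟩ := h
    obtain ⟨Q', hQ', h1'⟩ := h'
    exact ⟨fun m => Q m + Q' m, hQ.add hQ', fun χ => by rw [map_add, h1, h1']⟩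
  | mul a b _ _ h h' =>
    obtain ⟨Q, hQ, h1⟩ := h
    obtain ⟨Q', hQ', h1'⟩ := h'
    exact ⟨fun m => Q m * Q' m, hQ.mul hQ', fun χ => by rw [map_mul, h1, h1']⟩
  | star a _ h =>
    obtain ⟨Q, hQ, h1⟩ := h
    exact ⟨fun m => star (Q m), (starL' ℝ : ℂ ≃L[ℝ] ℂ).contDiff.comp hQ,
      fun χ => by rw [map_star, h1]⟩

end CompactMatrixQuantumGroup.Cl

open CompactMatrixQuantumGroup

/-- The model of the manifold of all pairs of a point of `M` and an `n × n` matrix. -/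
abbrev pairModel (d n : ℕ) := (𝓡 d).prod 𝓘(ℝ, Fin n → Fin n → ℂ)

theorem contMDiffAt_mul_matrix {n : ℕ} {C : M → Fin n → Fin n → ℂ}
    {q : M × (Fin n → Fin n → ℂ)}
    (hC : ContMDiffAt (𝓡 d) 𝓘(ℝ, Fin n → Fin n → ℂ) ∞ C q.1) :
    ContMDiffAt (pairModel d n) (pairModel d n) ∞ (fun q : M × (Fin n → Fin n → ℂ) =>
      (q.1, fun i j => ∑ k, C q.1 i k * q.2 k j)) q := by
  have hm : ContDiff ℝ ∞ (fun p : (Fin n → Fin n → ℂ) × (Fin n → Fin n → ℂ) =>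
      fun i j => ∑ k, p.1 i k * p.2 k j) := by fun_prop
  exact contMDiffAt_fst.prodMk (hm.contMDiff.contMDiffAt.comp q
    ((hC.comp q contMDiffAt_fst).prodMk_space contMDiffAt_snd))

/-- Elements of `B` define smooth functions on the classical part. -/
theorem isSmoothFunction_apply (b : P.B) : IsSmoothFunction fun p : P.Cl => p b := by
  intro U π _ x g
  have h : ∀ z : Smooth d U ⊗[ℂ] G.A, ∃ f' : M × (Fin G.n → Fin G.n → ℂ) → ℂ,
      ContMDiffOn (pairModel d G.n) 𝓘(ℝ, ℂ) ∞ f' ((U : Set M) ×ˢ Set.univ) ∧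
      ∀ (y : U) (χ : G.Cl), χ (evTen y z) = f' (y.1, χ.toMatrix) := fun z => by
    induction z with
    | zero => exact ⟨fun _ => 0, contMDiffOn_const, fun y χ => by simp⟩
    | add z w hz hw =>
      obtain ⟨f, hf, h1⟩ := hz
      obtain ⟨f', hf', h1'⟩ := hw
      exact ⟨fun q => f q + f' q, hf.add hf', fun y χ => by rw [map_add, map_add, h1, h1']⟩
    | tmul φ a =>
      obtain ⟨Q, hQ, h1⟩ := Cl.exists_contDiff_eq a
      have hm : ContDiff ℝ ∞ (fun p : ℂ × ℂ => p.1 * p.2) := contDiff_mul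
      refine ⟨fun q => extendZero φ.1 q.1 * Q q.2, fun q hq => ContMDiffAt.contMDiffWithinAt ?_,
        fun y χ => ?_⟩
      · exact hm.contMDiff.contMDiffAt.comp q
          (((contMDiffAt_extendZero φ (⟨q.1, hq.1⟩ : U)).comp q contMDiffAt_fst).prodMk_space
            (hQ.contMDiff.contMDiffAt.comp q contMDiffAt_snd))
      · rw [evTen_tmul, map_smul, h1]
        exact congrArg (· * _) (extendZero_apply φ.1 y).symm
  obtain ⟨f', hf', h1⟩ := h (π b)
  exact ⟨_, f', U.2.prod isOpen_univ, ⟨x.2, trivial⟩, hf', fun y χ _ =>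
    (localPoint_apply π y χ b).trans (h1 y χ)⟩

/-- Covariance of `π` turns the action into right multiplication in a trivialization. Hence a
fiber-preserving map commuting with the action is a left multiplication. -/
theorem localPoint_act {U : Opens M} {π : P.B →⋆ₐ[ℂ] Smooth d U ⊗[ℂ] G.A}
    (hπ : IsLocalTrivialization P.i P.F U π) (x : U) (χ θ : G.Cl) :
    Cl.act (localPoint π x χ) θ = localPoint π x (χ.mul θ) := by
  refine StarAlgHom.ext fun b => ?_
  rw [localPoint_apply, CompactMatrixQuantumGroup.Cl.mul_apply, lam_apply, hπ.comul_fiber]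
  change starLift (localPoint π x χ) θ (P.F b) = _
  generalize P.F b = t
  induction t with
  | zero => simp
  | add t t' ht ht' => simp only [map_add, ht, ht']
  | tmul c a =>
    refine (Algebra.TensorProduct.lift_tmul _ _ (fun _ _ => Commute.all _ _) _ _).trans ?_
    simp only [LinearMap.rTensor_tmul, TensorProduct.lid_tmul, map_smul]
    exact congrArg (· * _) (localPoint_apply π x χ c)

theorem localPoint_liesOver {U : Opens M} {π : P.B →⋆ₐ[ℂ] Smooth d U ⊗[ℂ] G.A}
    (hπ : IsLocalTrivialization P.i P.F U π) (x : U) (χ : G.Cl) :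
    Cl.LiesOver (localPoint π x χ) x.1 := fun f => by
  rw [localPoint_apply, hπ.fiber_base]
  exact AlgHomClass.commutes χ _

/-- A gauge transformation as a `*`-homomorphism. -/
def gaugeHom (γ : P.gaugeGroup) : P.B →⋆ₐ[ℂ] P.B := StarAlgHomClass.toStarAlgHom γ.1

theorem gaugeHom_apply (γ : P.gaugeGroup) (b : P.B) : gaugeHom γ b = γ.1 b := rfl

theorem act_comp_gaugeHom (γ : P.gaugeGroup) (p : P.Cl) (θ : G.Cl) :
    (p.act θ).comp (gaugeHom γ) = Cl.act (StarAlgHom.comp p (gaugeHom γ)) θ := by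
  refine StarAlgHom.ext fun b => ?_
  change starLift p θ (P.F (γ.1 b)) = starLift (StarAlgHom.comp p (gaugeHom γ)) θ (P.F b)
  rw [γ.2.2]
  generalize P.F b = t
  induction t with
  | zero => simp
  | add t t' ht ht' => simp only [map_add, ht, ht']
  | tmul c a => rfl

theorem liesOver_comp_gaugeHom (γ : P.gaugeGroup) (p : P.Cl) (x : M) :
    Cl.LiesOver (StarAlgHom.comp p (gaugeHom γ) : P.Cl) x ↔ p.LiesOver x :=
  forall_congr' fun f => by
    rw [StarAlgHom.comp_apply, gaugeHom_apply, gauge_base]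

theorem exists_liesOver [CompactSpace M] (p : P.Cl) : ∃ x, p.LiesOver x :=
  exists_eq_evalAt (p.comp P.i)

/-- The base is covered by finitely many local trivializations. -/
theorem nonempty_trivializationSystem [CompactSpace M]
    (P : QuantumPrincipalBundle.{v, w, y} G d M) :
    Nonempty (TrivializationSystem P) := by
  choose U hU π hπ using P.locallyTrivial
  obtain ⟨t, ht⟩ := isCompact_univ.elim_finite_subcover (fun x => (U x : Set M))
    (fun x => (U x).2) (fun x _ => Set.mem_iUnion.2 ⟨x, hU x⟩)
  refine ⟨⟨t.card, fun k => U (t.equivFin.symm k), fun x => ?_, fun k => π _, fun k => hπ _⟩⟩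
  obtain ⟨y, hy⟩ := Set.mem_iUnion.1 (ht (Set.mem_univ x))
  obtain ⟨hyt, hxy⟩ := Set.mem_iUnion.1 hy
  exact ⟨t.equivFin ⟨y, hyt⟩, by simpa using hxy⟩

/-! ### The isomorphism with classical gauge transformations -/

section Compact

variable [T2Space M] [CompactSpace M] [IsManifold (𝓡 d) ∞ M]

theorem exists_eq_localPoint {U : Opens M} {π : P.B →⋆ₐ[ℂ] Smooth d U ⊗[ℂ] G.A}
    (hπ : IsLocalTrivialization P.i P.F U π) (x : U) (p : P.Cl) (hp : p.LiesOver x.1) :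
    ∃ χ : G.Cl, p = localPoint π x χ := by
  obtain ⟨χ, hχ⟩ := hπ.exists_factor x p hp
  exact ⟨χ, StarAlgHom.ext fun b => (hχ b).trans (localPoint_apply π x χ b).symm⟩

/-- In a trivialization the map is `(x, χ) ↦ (x, c(x) χ)`. Multiplication by the matrix of `c(x)`
extends it smoothly to all matrices, so local smooth extensions can be pulled back. -/
theorem isSmoothMap_comp_gaugeHom (γ : P.gaugeGroup) :
    IsSmoothMap fun p : P.Cl => (StarAlgHom.comp p (gaugeHom γ) : P.Cl) := by
  intro f hf U π hπ x g
  obtain ⟨c, hc, hs⟩ := hπ.exists_gauge_char γ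
  have hcomp : ∀ y χ, (StarAlgHom.comp (localPoint π y χ) (gaugeHom γ) : P.Cl) =
      localPoint π y ((c y).mul χ) := fun y χ => StarAlgHom.ext fun b => by
    rw [StarAlgHom.comp_apply, gaugeHom_apply, localPoint_apply, localPoint_apply, hc]
    rfl
  obtain ⟨O, f', hO, hxO, hf', h1⟩ := hf U π hπ x ((c x).mul g)
  -- The extension by zero is smooth only over `U`, which is why the new domain is intersected with
  -- `U × univ`.
  let C : M → Fin G.n → Fin G.n → ℂ := fun y i j => extendZero (fun z : U => c z (G.u i j)) y
  have hCx : ∀ y : U, C y.1 = (c y).toMatrix := fun y => by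
    funext i j
    exact extendZero_apply _ y
  have hC : ∀ y : U, ContMDiffAt (𝓡 d) 𝓘(ℝ, Fin G.n → Fin G.n → ℂ) ∞ C y.1 := fun y =>
    contMDiffAt_pi_space.2 fun i => contMDiffAt_pi_space.2 fun j =>
      contMDiffAt_extendZero (⟨_, hs (G.u i j)⟩ : Smooth d U) y
  let Ψ : M × (Fin G.n → Fin G.n → ℂ) → M × (Fin G.n → Fin G.n → ℂ) := fun q =>
    (q.1, fun i j => ∑ k, C q.1 i k * q.2 k j)
  have hΨ : ContMDiffOn (pairModel d G.n) (pairModel d G.n) ∞ Ψ ((U : Set M) ×ˢ Set.univ) := fun q hq =>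
    (contMDiffAt_mul_matrix (hC ⟨q.1, hq.1⟩)).contMDiffWithinAt
  have hΨx : ∀ (y : U) (χ : G.Cl), Ψ (y.1, χ.toMatrix) = (y.1, ((c y).mul χ).toMatrix) :=
    fun y χ => by rw [Cl.toMatrix_mul, ← hCx]
  refine ⟨((U : Set M) ×ˢ Set.univ) ∩ Ψ ⁻¹' O, f' ∘ Ψ,
    hΨ.continuousOn.isOpen_inter_preimage (U.2.prod isOpen_univ) hO, ⟨⟨x.2, trivial⟩, ?_⟩,
    hf'.comp (hΨ.mono Set.inter_subset_left) Set.inter_subset_right, fun y χ hy => ?_⟩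
  · rw [Set.mem_preimage, hΨx]
    exact hxO
  · have hy' := hy.2
    rw [Set.mem_preimage, hΨx] at hy'
    change f (StarAlgHom.comp (localPoint π y χ) (gaugeHom γ)) = f' (Ψ _)
    rw [hcomp, hΨx]
    exact h1 y _ hy'

/-- The homomorphism `γ ↦ γ_cl`, `γ_cl(p) = p γ⁻¹`. -/
def classicalGauge (P : QuantumPrincipalBundle.{v, w, y} G d M) :
    P.gaugeGroup →* P.classicalGaugeGroup where
  toFun γ := ⟨{ toFun := fun p => StarAlgHom.comp p (gaugeHom γ⁻¹)
                invFun := fun p => StarAlgHom.comp p (gaugeHom γ)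
                left_inv := fun p => StarAlgHom.ext fun b =>
                  congrArg p (γ.1.symm_apply_apply b)
                right_inv := fun p => StarAlgHom.ext fun b =>
                  congrArg p (γ.1.apply_symm_apply b) },
    isSmoothMap_comp_gaugeHom γ⁻¹, isSmoothMap_comp_gaugeHom γ, liesOver_comp_gaugeHom γ⁻¹,
    act_comp_gaugeHom γ⁻¹⟩
  map_one' := rfl
  map_mul' γ γ' := Subtype.ext (Equiv.ext fun p => StarAlgHom.ext fun b =>
    congrArg (fun δ : P.gaugeGroup => p (δ.1 b)) (mul_inv_rev γ γ'))

theorem classicalGauge_apply (γ : P.gaugeGroup) (p : P.Cl) (b : P.B) :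
    (classicalGauge P γ).1 p b = p (γ.1⁻¹ b) := rfl

/-- In each fiber the image of the point with trivial character is the translating character itself,
and these characters determine the gauge transformation. -/
theorem classicalGauge_injective : Function.Injective (classicalGauge P) := by
  obtain ⟨τ⟩ := nonempty_trivializationSystem P
  intro γ γ' h
  refine inv_injective (τ.gauge_ext fun k x hx b => ?_)
  obtain ⟨c, hc, -⟩ := (τ.isLocalTrivialization k).exists_gauge_char γ⁻¹
  obtain ⟨c', hc', -⟩ := (τ.isLocalTrivialization k).exists_gauge_char γ'⁻¹
  have h1 : ∀ b, c ⟨x, hx⟩ (τ.fib k hx b) = c' ⟨x, hx⟩ (τ.fib k hx b) := fun b => by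
    have h2 := congrArg (fun ψ : P.classicalGaugeGroup =>
      ψ.1 (localPoint (τ.π k) ⟨x, hx⟩ (Cl.one G)) b) h
    simp only [classicalGauge_apply, localPoint_apply, Cl.one_apply] at h2
    have h3 := congrArg (counit (R := ℂ)) (hc ⟨x, hx⟩ b)
    have h3' := congrArg (counit (R := ℂ)) (hc' ⟨x, hx⟩ b)
    rw [counit_lam] at h3 h3'
    exact h3.symm.trans (h2.trans h3')
  have h4 : c ⟨x, hx⟩ = c' ⟨x, hx⟩ := StarAlgHom.ext fun a => by
    obtain ⟨b, rfl⟩ := τ.fib_surjective k hx a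
    exact h1 b
  exact (hc ⟨x, hx⟩ b).trans (h4 ▸ (hc' ⟨x, hx⟩ b).symm)

/-- In a local trivialization, a classical gauge transformation is the translation by a smooth
family of characters. -/
theorem IsLocalTrivialization.exists_classicalGauge_char {U : Opens M}
    {π : P.B →⋆ₐ[ℂ] Smooth d U ⊗[ℂ] G.A} (hπ : IsLocalTrivialization P.i P.F U π)
    (ψ : P.classicalGaugeGroup) : ∃ c : U → G.Cl,
      (∀ x χ, ψ.1 (localPoint π x χ) = localPoint π x ((c x).mul χ)) ∧
      ∀ a, ContMDiff (𝓡 d) 𝓘(ℝ, ℂ) ∞ fun x => c x a := by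
  -- The family is read off from the images of the points with trivial character; commutation with
  -- the action determines all other images.
  choose c hc using fun x : U => exists_eq_localPoint hπ x (ψ.1 (localPoint π x (Cl.one G)))
    ((ψ.2.2.2.1 _ _).2 (localPoint_liesOver hπ x _))
  refine ⟨c, fun x χ => ?_, fun a => hπ.contMDiff_char le_rfl c (fun b x => ?_) a⟩
  · rw [← localPoint_act hπ, ← hc, ← ψ.2.2.2.2, localPoint_act hπ, Cl.one_mul]
  -- Smoothness of `ψ` is used on the functions `p ↦ p b`, restricted to the local section of
  -- trivial characters.
  · obtain ⟨O, f', hO, hxO, hf', h1⟩ := ψ.2.1 _ (isSmoothFunction_apply b) U π hπ x (Cl.one G)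
    have h2 : ContMDiffAt (𝓡 d) (pairModel d G.n) ∞
        (fun y : U => (y.1, (Cl.one G).toMatrix)) x :=
      contMDiff_subtype_val.contMDiffAt.prodMk contMDiffAt_const
    refine ((hf'.contMDiffAt (hO.mem_nhds hxO)).comp x h2).congr_of_eventuallyEq ?_
    filter_upwards [h2.continuousAt.eventually (hO.mem_nhds hxO)] with y hy
    rw [Function.comp_apply, ← h1 y (Cl.one G) hy]
    change _ = ψ.1 (localPoint π y (Cl.one G)) b
    rw [hc, localPoint_apply]
    rfl

theorem classicalGauge_surjective : Function.Surjective (classicalGauge P) := by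
  obtain ⟨τ⟩ := nonempty_trivializationSystem P
  intro ψ
  obtain ⟨g, hg, -⟩ := τ.existsUnique_isCocycle
  choose c hc hs using fun k => (τ.isLocalTrivialization k).exists_classicalGauge_char ψ
  have hloc : ∀ k x (hx : x ∈ τ.U k) (χ : G.Cl) b,
      ψ.1 (localPoint (τ.π k) ⟨x, hx⟩ χ) b = χ (lam (c k ⟨x, hx⟩).lin (τ.fib k hx b)) :=
    fun k x hx χ b => by rw [hc, localPoint_apply]; rfl
  have hgl := (τ.isCocycle_iff g).1 hg
  obtain ⟨f, hf⟩ := TrivializationSystem.exists_sect hg c hs fun k l x hk hl a => by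
    obtain ⟨b, rfl⟩ := τ.fib_surjective k hk a
    -- The trivial point in the `l`-th trivialization has coordinate `g_{kl}` in the `k`-th.
    -- Computing its image under `ψ` in both gives the compatibility.
    have h1 : localPoint (τ.π l) ⟨x, hl⟩ (Cl.one G) =
        localPoint (τ.π k) ⟨x, hk⟩ (TrivializationSystem.transition g hk hl) :=
      StarAlgHom.ext fun b => by
        rw [localPoint_apply, localPoint_apply, Cl.one_apply]
        exact (congrArg _ (hgl k l x hk hl b)).trans (counit_lam _ _)
    have h2 := congrArg (fun p => ψ.1 p b) h1
    simp only [hloc, Cl.one_apply, counit_lam] at h2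
    rw [← hgl k l x hk hl]
    exact h2
  obtain ⟨κM, hκ⟩ := TrivializationSystem.exists_isAntipode g
  obtain ⟨βM, hβ⟩ := hg.exists_isCoaction
  obtain ⟨Φ, hΦ⟩ := TrivializationSystem.exists_equiv_sect_gauge hg hκ.1 hβ.1
  -- The inverse appears because `γ_cl` is composition with `γ⁻¹`, whereas `ψ` is composition with
  -- `Φ f`.
  refine ⟨(Φ f)⁻¹, Subtype.ext (Equiv.ext fun p => StarAlgHom.ext fun b => ?_)⟩
  obtain ⟨x, hx⟩ := exists_liesOver p
  obtain ⟨k, hk⟩ := τ.cover x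
  obtain ⟨χ, rfl⟩ := exists_eq_localPoint (τ.isLocalTrivialization k) ⟨x, hk⟩ p hx
  refine Eq.trans ?_ (hloc k x hk χ b).symm
  have h1 : (classicalGauge P (Φ f)⁻¹).1 (localPoint (τ.π k) ⟨x, hk⟩ χ) b =
      localPoint (τ.π k) ⟨x, hk⟩ χ ((Φ f).1 b) := rfl
  rw [h1, localPoint_apply, hΦ]
  exact congrArg χ (TrivializationSystem.fib_coaction hβ.1 f.toAlgHom.toLinearMap k hk
    (χ := (c k ⟨x, hk⟩).lin) (hf k x hk) b)

end Compact

end Classical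

end QGauge

end

theorem proposition3p4 {d : ℕ} {M : Type*} [TopologicalSpace M] [T2Space M] [CompactSpace M]
    [ChartedSpace (EuclideanSpace ℝ (Fin d)) M] [IsManifold (𝓡 d) ∞ M]
    (G : QGauge.CompactMatrixQuantumGroup) (P : QGauge.QuantumPrincipalBundle G d M) :
    (∀ τ : QGauge.TrivializationSystem P,
      (∃! g : τ.TransitionFamily, τ.IsCocycle g) ∧
      ∀ g : τ.TransitionFamily, τ.IsCocycle g →
        ∃ φM εM κM βM,
          (τ.IsComul g φM ∧ ∀ φ', τ.IsComul g φ' → φ' = φM) ∧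
          (τ.IsCounit g εM ∧ ∀ ε', τ.IsCounit g ε' → ε' = εM) ∧
          (τ.IsAntipode g κM ∧ ∀ κ', τ.IsAntipode g κ' → κ' = κM) ∧
          (τ.IsCoaction g βM ∧ ∀ β', τ.IsCoaction g β' → β' = βM) ∧
          ∃ Φ : τ.Sect g ≃ P.gaugeGroup,
            (∀ f b, (Φ f).1 b = QGauge.TrivializationSystem.tensorId f (βM b)) ∧
            (∀ q, Φ.symm 1 q = εM q) ∧
            (∀ f q, Φ.symm (Φ f)⁻¹ q = f (κM q)) ∧
            (∀ f f' q, Φ.symm (Φ f * Φ f') q =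
              QGauge.TrivializationSystem.tensorSect f' f (φM q))) ∧
    ∃ Θ : P.gaugeGroup ≃* P.classicalGaugeGroup,
      ∀ (γ : P.gaugeGroup) (p : P.Cl) (b : P.B), (Θ γ).1 p b = p (γ.1⁻¹ b) := by
  refine ⟨fun τ => τ.quantumGaugeBundle_structure, MulEquiv.ofBijective (QGauge.classicalGauge P)
    ⟨QGauge.classicalGauge_injective, QGauge.classicalGauge_surjective⟩, fun γ p b => rfl⟩
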